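/- Let $0\le k_1<k_2$, put $a=k_1^2$, $b=k_2^2$, and let $H$ be the finite Hilbert transform on $[a,b]$, $$H[\psi](s)=\frac1\pi\,\mathrm{p.v.}\!\int_a^b\frac{\psi(r)}{r-s}\,dr,\qquad s\in(a,b).$$ Let $\alpha$ be a real Hölder continuous function on $[a,b]$ such that $\cos(\pi\alpha(s))\neq0$ for all $s\in[a,b]$ (so that $\tan(\pi\alpha)$ is defined), and $|\alpha(a)|<1$, $|\alpha(b)|<1$. Let $X_\alpha$ be the space of all real functions on $(a,b)$ of the form $$\psi(s)=\frac{g(s)}{(s-a)^{\gamma}(b-s)^{\delta}},\qquad g\ \text{Hölder continuous on }[a,b],\quad 0\le\gamma<1-\max(\alpha(a),0),\quad 0\le\delta<1-\max(-\alpha(b),0),$$ where $g,\gamma,\delta$ may depend on $\psi$. (So $X_\alpha$ contains all Hölder continuous functions on $[a,b]$; functions are identified when they agree on $(a,b)$.) Then the principal values below exist at every $s\in(a,b)$ for all $\psi,\varphi\in X_\alpha$, the operator $$L_\alpha[\psi]=\psi+\tan(\pi\alpha)\,H[\psi]$$ maps $X_\alpha$ into itself, and it has a unique inverse $L_\alpha^{-1}:X_\alpha\to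 X_\alpha$, given by $$L_\alpha^{-1}[\varphi]=\cos^2(\pi\alpha)\,\varphi-\sin(\pi\alpha)\,e^{-\pi H[\alpha]}\,H\big[\cos(\pi\alpha)\,e^{\pi H[\alpha]}\,\varphi\big].$$ That is, the right-hand side lies in $X_\alpha$ for all $\varphi\in X_\alpha$, this map is a two-sided inverse of $L_\alpha$, and for each $\varphi\in X_\alpha$ it gives the only solution $\psi\in X_\alpha$ of $L_\alpha[\psi]=\varphi$. All identities hold at every point of $(a,b)$. If $\alpha$ is constant, then for all $\varphi\in X_\alpha$ and $s\in(a,b)$ $$L_\alpha^{-1}[\varphi](s)=\cos^2(\pi\alpha)\,\varphi(s)-\sin(\pi\alpha)\cos(\pi\alpha)\left(\frac{s-a}{b-s}\right)^{\alpha}H\!\left[\left(\frac{b-r}{r-a}\right)^{\alpha}\varphi(r)\right](s),$$ where $H$ acts on the variable $r$. -/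

import Mathlib

open Real Set Filter Topology MeasureTheory

noncomputable section

/-- `f` is Hölder continuous on `S` (with some exponent in `(0, 1]`). -/
def IsHolderOn (f : ℝ → ℝ) (S : Set ℝ) : Prop :=
  ∃ C r : NNReal, 0 < r ∧ r ≤ 1 ∧ HolderOnWith C r f S

/-- The integral `(1/π) ∫ ψ(r) / (r - s) dr` over the part of `(a, b)` at distance more than `ε`
from `s`. -/
def truncHilbert (a b : ℝ) (ψ : ℝ → ℝ) (s ε : ℝ) : ℝ :=
  (1 / π) * ∫ r in {r : ℝ | r ∈ Ioo a b ∧ ε < |r - s|}, ψ r / (r - s)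

/-- The principal value defining the finite Hilbert transform of `ψ` at `s` exists: all truncated
integrals converge absolutely, and they have a limit as `ε → 0+`. -/
def HilbertExists (a b : ℝ) (ψ : ℝ → ℝ) (s : ℝ) : Prop :=
  (∀ ε : ℝ, 0 < ε → IntegrableOn (fun r => ψ r / (r - s)) {r : ℝ | r ∈ Ioo a b ∧ ε < |r - s|}) ∧
    ∃ v : ℝ, Tendsto (truncHilbert a b ψ s) (𝓝[>] 0) (𝓝 v)

/-- The finite Hilbert transform `H[ψ](s) = (1/π) p.v. ∫_a^b ψ(r) / (r - s) dr`
(meaningful where `HilbertExists a b ψ s` holds). -/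
def hilbert (a b : ℝ) (ψ : ℝ → ℝ) (s : ℝ) : ℝ :=
  limUnder (𝓝[>] (0 : ℝ)) (truncHilbert a b ψ s)

/-- The operator `L_α[ψ] = ψ + tan(πα) H[ψ]`. -/
def opL (a b : ℝ) (α ψ : ℝ → ℝ) (s : ℝ) : ℝ :=
  ψ s + tan (π * α s) * hilbert a b ψ s

/-- The density `cos(πα) e^{πH[α]} φ` whose Hilbert transform occurs in the inverse of `L_α`. -/
def invDensity (a b : ℝ) (α φ : ℝ → ℝ) (s : ℝ) : ℝ :=
  cos (π * α s) * exp (π * hilbert a b α s) * φ s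

/-- `cos²(πα) φ - sin(πα) e^{-πH[α]} H[cos(πα) e^{πH[α]} φ]`. -/
def opLInv (a b : ℝ) (α φ : ℝ → ℝ) (s : ℝ) : ℝ :=
  cos (π * α s) ^ 2 * φ s -
    sin (π * α s) * exp (-(π * hilbert a b α s)) * hilbert a b (invDensity a b α φ) s

/-- Functions on `(a, b)` of the form `g(s) / ((s - a)^γ (b - s)^δ)` with `g` Hölder continuous on
`[a, b]`, `0 ≤ γ < μ` and `0 ≤ δ < ν`. Values outside `(a, b)` are irrelevant. -/
def EndpointClass (a b μ ν : ℝ) : Set (ℝ → ℝ) :=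
  {ψ | ∃ γ δ : ℝ, 0 ≤ γ ∧ γ < μ ∧ 0 ≤ δ ∧ δ < ν ∧ ∃ g : ℝ → ℝ, IsHolderOn g (Icc a b) ∧
    ∀ s ∈ Ioo a b, ψ s = g s / ((s - a) ^ γ * (b - s) ^ δ)}

/-- The domain of `L_α`: Hölder continuous functions with singularities at the endpoints of order
`γ < 1` such that multiplication by `e^{πH[α]}`, which is comparable to
`(s - a)^{-α(a)} (b - s)^{α(b)}`, leaves the order of the singularities below `1`. -/
def domL (a b : ℝ) (α : ℝ → ℝ) : Set (ℝ → ℝ) :=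
  EndpointClass a b (1 - max (α a) 0) (1 - max (-α b) 0)

end

/-!
Write `H` for the finite Hilbert transform on `(a, b)`. By Privalov's argument `H` maps Hölder
functions with endpoint singularities of order less than `1` to functions of the same kind, with
slightly larger orders. The partial fraction identity
`1 / ((r - z) (t - z)) = (1 / (r - z) - 1 / (t - z)) / (t - r)` shows that the Cauchy transforms
`Φ_f`, whose boundary values on `(a, b)` are `H[f] + i f`, satisfy `Φ_f Φ_g = Φ_{f H[g] + g H[f]}`;
taking boundary values, `H[f H[g] + g H[f]] = H[f] H[g] - f g`. Induction on the power turns this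
into a power series statement: `exp(π Φ_α)` has boundary values `e^{π H[α]} (cos πα + i sin πα)`,
and `H[sin(πα) e^{π H[α]}] = cos(πα) e^{π H[α]} - 1`, together with its analogue for `-α`.
Applying the product formula to these two functions and the unknown density gives both inverse
identities. All products stay integrable because `e^{π H[α]}` is comparable to
`(s - a)^{-α(a)} (b - s)^{α(b)}`.
-/

noncomputable section

/-! ### Weighted Hölder spaces on an interval -/

/-- The distance from a point `s` of `(a, b)` to the boundary of the interval. -/
def edgeDist (a b s : ℝ) : ℝ := min (s - a) (b - s)

/-- The weight `(s - a)^{-γ} (b - s)^{-δ}`. -/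
def edgeWeight (a b γ δ s : ℝ) : ℝ := (s - a) ^ (-γ) * (b - s) ^ (-δ)

/-- `f` is bounded by `M (s - a)^{-γ} (b - s)^{-δ}` and satisfies the corresponding scale-invariant
Hölder condition of exponent `μ`. Both conditions refer to the weight at the centre `s` of the
interval `|p - s| ≤ d(s) / 2`, on which weights and distances to the boundary are comparable. -/
structure WeightedHolderWith (a b γ δ M μ : ℝ) (f : ℝ → ℝ) : Prop where
  nonneg : 0 ≤ M
  exponent_pos : 0 < μ
  exponent_le_one : μ ≤ 1
  abs_le : ∀ s ∈ Ioo a b, ∀ p, |p - s| ≤ edgeDist a b s / 2 → |f p| ≤ M * edgeWeight a b γ δ s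
  abs_sub_le : ∀ s ∈ Ioo a b, ∀ p q, |p - s| ≤ edgeDist a b s / 2 → |q - s| ≤ edgeDist a b s / 2 →
    |f p - f q| ≤ M * edgeWeight a b γ δ s * (|p - q| / edgeDist a b s) ^ μ

/-- Functions on `(a, b)` that are locally Hölder continuous with singularities of order `γ` at `a`
and `δ` at `b`; these spaces are stable under products and under the finite Hilbert transform. -/
def WeightedHolder (a b γ δ : ℝ) (f : ℝ → ℝ) : Prop :=
  ∃ M μ, WeightedHolderWith a b γ δ M μ f

section Weight

variable {a b γ δ γ' δ' s p q : ℝ}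

theorem edgeDist_pos (hs : s ∈ Ioo a b) : 0 < edgeDist a b s :=
  lt_min (sub_pos.2 hs.1) (sub_pos.2 hs.2)

theorem edgeDist_le_left : edgeDist a b s ≤ s - a := min_le_left _ _

theorem edgeDist_le_right : edgeDist a b s ≤ b - s := min_le_right _ _

theorem edgeDist_le_add (a b s t : ℝ) : edgeDist a b t ≤ edgeDist a b s + |t - s| := by
  have := le_abs_self (t - s)
  have := neg_abs_le (t - s)
  rcases min_cases (s - a) (b - s) with h | h <;> rcases min_cases (t - a) (b - t) with h' | h' <;>
    simp only [edgeDist] <;> linarith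

theorem edgeDist_le_length (hs : s ∈ Ioo a b) : edgeDist a b s ≤ b - a :=
  edgeDist_le_left.trans (by linarith [hs.2])

theorem edgeDist_reflect : edgeDist a b (a + b - s) = edgeDist a b s := by
  rw [edgeDist, edgeDist, min_comm]
  ring_nf

theorem mem_Ioo_of_near (hs : s ∈ Ioo a b) (hp : |p - s| ≤ edgeDist a b s / 2) : p ∈ Ioo a b := by
  have h₀ := edgeDist_pos hs
  have h₁ := edgeDist_le_left (a := a) (b := b) (s := s)
  have h₂ := edgeDist_le_right (a := a) (b := b) (s := s)
  rw [abs_le] at hp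
  constructor <;> linarith

theorem half_edgeDist_le_of_near (hp : |p - s| ≤ edgeDist a b s / 2) :
    edgeDist a b s / 2 ≤ edgeDist a b p := by
  have := edgeDist_le_add a b p s
  rw [abs_sub_comm] at this
  linarith

theorem near_self (hs : s ∈ Ioo a b) : |s - s| ≤ edgeDist a b s / 2 := by
  simpa using (half_pos (edgeDist_pos hs)).le

theorem ratio_nonneg (hs : s ∈ Ioo a b) : 0 ≤ |p - q| / edgeDist a b s :=
  div_nonneg (abs_nonneg _) (edgeDist_pos hs).le

theorem ratio_le_one (hs : s ∈ Ioo a b) (hp : |p - s| ≤ edgeDist a b s / 2)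
    (hq : |q - s| ≤ edgeDist a b s / 2) : |p - q| / edgeDist a b s ≤ 1 := by
  rw [div_le_one (edgeDist_pos hs)]
  have := abs_sub_le p s q
  rw [abs_sub_comm s q] at this
  linarith

theorem edgeWeight_pos (hs : s ∈ Ioo a b) : 0 < edgeWeight a b γ δ s :=
  mul_pos (rpow_pos_of_pos (sub_pos.2 hs.1) _) (rpow_pos_of_pos (sub_pos.2 hs.2) _)

theorem edgeWeight_mul (hs : s ∈ Ioo a b) :
    edgeWeight a b γ δ s * edgeWeight a b γ' δ' s = edgeWeight a b (γ + γ') (δ + δ') s := by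
  simp only [edgeWeight]
  rw [neg_add, neg_add, rpow_add (sub_pos.2 hs.1), rpow_add (sub_pos.2 hs.2)]
  ring

theorem edgeWeight_zero : edgeWeight a b 0 0 s = 1 := by simp [edgeWeight]

theorem edgeWeight_reflect : edgeWeight a b γ δ (a + b - s) = edgeWeight a b δ γ s := by
  rw [edgeWeight, edgeWeight, mul_comm]
  ring_nf

theorem rpow_le_of_le_two_mul {x y : ℝ} (c : ℝ) (hx : 0 < x) (hy : 0 < y) (hyx : y ≤ 2 * x)
    (hxy : x ≤ 2 * y) : x ^ c ≤ 2 ^ |c| * y ^ c := by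
  rcases le_total 0 c with hc | hc
  · rw [abs_of_nonneg hc, ← mul_rpow two_pos.le hy.le]
    exact rpow_le_rpow hx.le hxy hc
  · rw [abs_of_nonpos hc, rpow_neg two_pos.le, ← inv_rpow two_pos.le,
      ← mul_rpow (by norm_num) hy.le]
    exact rpow_le_rpow_of_nonpos (by positivity) (by linarith) hc

theorem exists_edgeWeight_le_of_near (a b γ δ : ℝ) :
    ∃ C, 0 < C ∧ ∀ s ∈ Ioo a b, ∀ p, |p - s| ≤ edgeDist a b s / 2 →
      edgeWeight a b γ δ p ≤ C * edgeWeight a b γ δ s := by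
  refine ⟨2 ^ |-γ| * 2 ^ |-δ|, by positivity, fun s hs p hp => ?_⟩
  have hp' := mem_Ioo_of_near hs hp
  have h₁ := edgeDist_le_left (a := a) (b := b) (s := s)
  have h₂ := edgeDist_le_right (a := a) (b := b) (s := s)
  have := sub_pos.2 hs.1
  have := sub_pos.2 hs.2
  rw [abs_le] at hp
  calc (p - a) ^ (-γ) * (b - p) ^ (-δ)
      ≤ (2 ^ |-γ| * (s - a) ^ (-γ)) * (2 ^ |-δ| * (b - s) ^ (-δ)) :=
        mul_le_mul
          (rpow_le_of_le_two_mul _ (sub_pos.2 hp'.1) (by linarith) (by linarith) (by linarith))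
          (rpow_le_of_le_two_mul _ (sub_pos.2 hp'.2) (by linarith) (by linarith) (by linarith))
          (rpow_nonneg (sub_pos.2 hp'.2).le _) (by positivity)
    _ = 2 ^ |-γ| * 2 ^ |-δ| * edgeWeight a b γ δ s := by rw [edgeWeight]; ring

theorem rpow_neg_le_of_exponent_le {x L : ℝ} (hx : 0 < x) (hxL : x ≤ L) (hγ : γ ≤ γ') :
    x ^ (-γ) ≤ L ^ (γ' - γ) * x ^ (-γ') := by
  rw [show -γ = (γ' - γ) + -γ' by ring, rpow_add hx]
  gcongr

theorem exists_edgeWeight_le_mul (a b : ℝ) (hγ : γ ≤ γ') (hδ : δ ≤ δ') :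
    ∃ C, 0 ≤ C ∧ ∀ s ∈ Ioo a b, edgeWeight a b γ δ s ≤ C * edgeWeight a b γ' δ' s := by
  refine ⟨|b - a| ^ (γ' - γ) * |b - a| ^ (δ' - δ), by positivity, fun s hs => ?_⟩
  have hL : b - a ≤ |b - a| := le_abs_self _
  have := sub_pos.2 hs.1
  have := sub_pos.2 hs.2
  calc (s - a) ^ (-γ) * (b - s) ^ (-δ)
      ≤ (|b - a| ^ (γ' - γ) * (s - a) ^ (-γ')) * (|b - a| ^ (δ' - δ) * (b - s) ^ (-δ')) := by
        gcongr <;> exact rpow_neg_le_of_exponent_le (by linarith) (by linarith) (by assumption)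
    _ = |b - a| ^ (γ' - γ) * |b - a| ^ (δ' - δ) * edgeWeight a b γ' δ' s := by
        rw [edgeWeight]; ring

theorem edgeWeight_neg_le_edgeDist_rpow {η ν : ℝ} (hη : 0 ≤ η) (hνη : ν ≤ η) (hs : s ∈ Ioo a b) :
    edgeWeight a b (-η) (-η) s ≤ (b - a) ^ η * (b - a) ^ (η - ν) * edgeDist a b s ^ ν := by
  have hd := edgeDist_pos hs
  have h₁ : 0 < s - a := sub_pos.2 hs.1
  have h₂ : 0 < b - s := sub_pos.2 hs.2
  have hmax : edgeWeight a b (-η) (-η) s = edgeDist a b s ^ η * max (s - a) (b - s) ^ η := by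
    rw [edgeWeight, neg_neg, ← mul_rpow h₁.le h₂.le, ← mul_rpow hd.le (le_max_of_le_left h₁.le),
      edgeDist, min_mul_max]
  calc edgeWeight a b (-η) (-η) s ≤ edgeDist a b s ^ η * (b - a) ^ η := by
        rw [hmax]
        gcongr
        exact max_le (by linarith) (by linarith)
    _ = (edgeDist a b s ^ (η - ν) * edgeDist a b s ^ ν) * (b - a) ^ η := by
        rw [← rpow_add hd, sub_add_cancel]
    _ ≤ ((b - a) ^ (η - ν) * edgeDist a b s ^ ν) * (b - a) ^ η := by
        have hL : 0 ≤ b - a := by linarith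
        gcongr
        exact edgeDist_le_length hs
    _ = (b - a) ^ η * (b - a) ^ (η - ν) * edgeDist a b s ^ ν := by ring

end Weight

section Algebra

variable {a b γ δ γ' δ' M μ : ℝ} {f g : ℝ → ℝ}

theorem WeightedHolderWith.mono_const {M' : ℝ} (hf : WeightedHolderWith a b γ δ M μ f)
    (h : M ≤ M') : WeightedHolderWith a b γ δ M' μ f where
  nonneg := hf.nonneg.trans h
  exponent_pos := hf.exponent_pos
  exponent_le_one := hf.exponent_le_one
  abs_le s hs p hp := (hf.abs_le s hs p hp).trans
    (mul_le_mul_of_nonneg_right h (edgeWeight_pos hs).le)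
  abs_sub_le s hs p q hp hq := (hf.abs_sub_le s hs p q hp hq).trans <|
    mul_le_mul_of_nonneg_right (mul_le_mul_of_nonneg_right h (edgeWeight_pos hs).le)
      (rpow_nonneg (ratio_nonneg hs) _)

theorem WeightedHolderWith.mono_exponent {ν : ℝ} (hf : WeightedHolderWith a b γ δ M μ f)
    (hν : 0 < ν) (hνμ : ν ≤ μ) : WeightedHolderWith a b γ δ M ν f where
  nonneg := hf.nonneg
  exponent_pos := hν
  exponent_le_one := hνμ.trans hf.exponent_le_one
  abs_le := hf.abs_le
  abs_sub_le s hs p q hp hq := (hf.abs_sub_le s hs p q hp hq).trans <|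
    mul_le_mul_of_nonneg_left
      (rpow_le_rpow_of_exponent_ge' (ratio_nonneg hs) (ratio_le_one hs hp hq) hν.le hνμ)
      (mul_nonneg hf.nonneg (edgeWeight_pos hs).le)

theorem WeightedHolder.exists_common (hf : WeightedHolder a b γ δ f)
    (hg : WeightedHolder a b γ' δ' g) :
    ∃ M μ, WeightedHolderWith a b γ δ M μ f ∧ WeightedHolderWith a b γ' δ' M μ g := by
  obtain ⟨M, μ, hf⟩ := hf
  obtain ⟨M', μ', hg⟩ := hg
  have hμ : 0 < min μ μ' := lt_min hf.exponent_pos hg.exponent_pos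
  exact ⟨max M M', min μ μ', (hf.mono_const (le_max_left _ _)).mono_exponent hμ (min_le_left _ _),
    (hg.mono_const (le_max_right _ _)).mono_exponent hμ (min_le_right _ _)⟩

theorem WeightedHolder.exists_abs_le (hf : WeightedHolder a b γ δ f) :
    ∃ M, 0 ≤ M ∧ ∀ s ∈ Ioo a b, |f s| ≤ M * edgeWeight a b γ δ s := by
  obtain ⟨M, μ, hf⟩ := hf
  exact ⟨M, hf.nonneg, fun s hs => hf.abs_le s hs s (near_self hs)⟩

theorem WeightedHolder.congr (hf : WeightedHolder a b γ δ f) (h : EqOn g f (Ioo a b)) :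
    WeightedHolder a b γ δ g := by
  obtain ⟨M, μ, hf⟩ := hf
  refine ⟨M, μ, hf.nonneg, hf.exponent_pos, hf.exponent_le_one, fun s hs p hp => ?_,
    fun s hs p q hp hq => ?_⟩
  · rw [h (mem_Ioo_of_near hs hp)]
    exact hf.abs_le s hs p hp
  · rw [h (mem_Ioo_of_near hs hp), h (mem_Ioo_of_near hs hq)]
    exact hf.abs_sub_le s hs p q hp hq

theorem WeightedHolder.mono (hf : WeightedHolder a b γ δ f) (hγ : γ ≤ γ') (hδ : δ ≤ δ') :
    WeightedHolder a b γ' δ' f := by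
  obtain ⟨M, μ, hf⟩ := hf
  obtain ⟨C, hC, hCs⟩ := exists_edgeWeight_le_mul a b hγ hδ
  have hw : ∀ s ∈ Ioo a b, M * edgeWeight a b γ δ s ≤ M * C * edgeWeight a b γ' δ' s :=
    fun s hs => by
      rw [mul_assoc]
      exact mul_le_mul_of_nonneg_left (hCs s hs) hf.nonneg
  exact ⟨M * C, μ, mul_nonneg hf.nonneg hC, hf.exponent_pos, hf.exponent_le_one,
    fun s hs p hp => (hf.abs_le s hs p hp).trans (hw s hs),
    fun s hs p q hp hq => (hf.abs_sub_le s hs p q hp hq).trans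
      (mul_le_mul_of_nonneg_right (hw s hs) (rpow_nonneg (ratio_nonneg hs) _))⟩

theorem WeightedHolder.comp_reflect (hf : WeightedHolder a b γ δ f) :
    WeightedHolder a b δ γ (fun s => f (a + b - s)) := by
  obtain ⟨M, μ, hf⟩ := hf
  have hmem : ∀ s ∈ Ioo a b, a + b - s ∈ Ioo a b := fun s hs =>
    ⟨by linarith [hs.2], by linarith [hs.1]⟩
  have hnear : ∀ s p : ℝ, |p - s| ≤ edgeDist a b s / 2 →
      |(a + b - p) - (a + b - s)| ≤ edgeDist a b (a + b - s) / 2 := fun s p hp => by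
    rwa [sub_sub_sub_cancel_left, abs_sub_comm, edgeDist_reflect]
  refine ⟨M, μ, hf.nonneg, hf.exponent_pos, hf.exponent_le_one, fun s hs p hp => ?_,
    fun s hs p q hp hq => ?_⟩
  · simpa only [edgeWeight_reflect] using hf.abs_le _ (hmem s hs) _ (hnear s p hp)
  · simpa only [edgeWeight_reflect, edgeDist_reflect, sub_sub_sub_cancel_left, abs_sub_comm q p]
      using hf.abs_sub_le _ (hmem s hs) _ _ (hnear s p hp) (hnear s q hq)

theorem WeightedHolder.add (hf : WeightedHolder a b γ δ f) (hg : WeightedHolder a b γ δ g) :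
    WeightedHolder a b γ δ (fun s => f s + g s) := by
  obtain ⟨M, μ, hf, hg⟩ := hf.exists_common hg
  have hM := hf.nonneg
  refine ⟨2 * M, μ, by positivity, hf.exponent_pos, hf.exponent_le_one, fun s hs p hp => ?_,
    fun s hs p q hp hq => ?_⟩
  · linarith [abs_add_le (f p) (g p), hf.abs_le s hs p hp, hg.abs_le s hs p hp]
  · rw [add_sub_add_comm]
    linarith [abs_add_le (f p - f q) (g p - g q), hf.abs_sub_le s hs p q hp hq,
      hg.abs_sub_le s hs p q hp hq]

theorem WeightedHolder.mul (hf : WeightedHolder a b γ δ f) (hg : WeightedHolder a b γ' δ' g) :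
    WeightedHolder a b (γ + γ') (δ + δ') (fun s => f s * g s) := by
  obtain ⟨M, μ, hf, hg⟩ := hf.exists_common hg
  have hM := hf.nonneg
  refine ⟨2 * (M * M), μ, by positivity, hf.exponent_pos, hf.exponent_le_one, fun s hs p hp => ?_,
    fun s hs p q hp hq => ?_⟩
  all_goals
    rw [← edgeWeight_mul hs]
    have hW := (edgeWeight_pos (γ := γ) (δ := δ) hs).le
    have hW' := (edgeWeight_pos (γ := γ') (δ := δ') hs).le
    set W := edgeWeight a b γ δ s
    set W' := edgeWeight a b γ' δ' s
  · calc |f p * g p| ≤ (M * W) * (M * W') := by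
          rw [abs_mul]
          exact mul_le_mul (hf.abs_le s hs p hp) (hg.abs_le s hs p hp) (abs_nonneg _)
            (by positivity)
      _ ≤ 2 * ((M * W) * (M * W')) := le_mul_of_one_le_left (by positivity) one_le_two
      _ = 2 * (M * M) * (W * W') := by ring
  · set R := (|p - q| / edgeDist a b s) ^ μ
    have hR : 0 ≤ R := rpow_nonneg (ratio_nonneg hs) _
    calc |f p * g p - f q * g q| = |(f p - f q) * g p + f q * (g p - g q)| := by ring_nf
      _ ≤ |f p - f q| * |g p| + |f q| * |g p - g q| := by
        rw [← abs_mul, ← abs_mul]; exact abs_add_le _ _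
      _ ≤ (M * W * R) * (M * W') + (M * W) * (M * W' * R) := by
        gcongr
        exacts [hf.abs_sub_le s hs p q hp hq, hg.abs_le s hs p hp, hf.abs_le s hs q hq,
          hg.abs_sub_le s hs p q hp hq]
      _ = 2 * (M * M) * (W * W') * R := by ring

theorem weightedHolder_const (c : ℝ) : WeightedHolder a b 0 0 (fun _ => c) := by
  refine ⟨|c|, 1, abs_nonneg _, one_pos, le_rfl, fun s _ p _ => ?_, fun s hs p q _ _ => ?_⟩
  · rw [edgeWeight_zero, mul_one]
  · rw [edgeWeight_zero, sub_self, abs_zero, rpow_one]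
    exact mul_nonneg (by positivity) (ratio_nonneg hs)

theorem WeightedHolder.const_mul (c : ℝ) (hf : WeightedHolder a b γ δ f) :
    WeightedHolder a b γ δ (fun s => c * f s) := by
  simpa using (weightedHolder_const c).mul hf

theorem WeightedHolder.neg (hf : WeightedHolder a b γ δ f) :
    WeightedHolder a b γ δ (fun s => -f s) :=
  (hf.const_mul (-1)).congr fun s _ => by simp

theorem WeightedHolder.sub (hf : WeightedHolder a b γ δ f) (hg : WeightedHolder a b γ δ g) :
    WeightedHolder a b γ δ (fun s => f s - g s) :=
  (hf.add hg.neg).congr fun s _ => by simp [sub_eq_add_neg]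

end Algebra

section Composition

variable {a b γ δ γ' δ' : ℝ} {f : ℝ → ℝ}

theorem WeightedHolder.comp_of_lipschitz {F : ℝ → ℝ} {K M : ℝ}
    (hF : ∀ p ∈ Ioo a b, ∀ q ∈ Ioo a b, |F (f p) - F (f q)| ≤ K * |f p - f q|)
    (hM : ∀ p ∈ Ioo a b, |F (f p)| ≤ M)
    (hf : WeightedHolder a b 0 0 f) : WeightedHolder a b 0 0 (fun s => F (f s)) := by
  obtain ⟨N, μ, hf⟩ := hf
  have hN := hf.nonneg
  refine ⟨|M| + |K| * N, μ, by positivity, hf.exponent_pos, hf.exponent_le_one,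
    fun s hs p hp => ?_, fun s hs p q hp hq => ?_⟩
  · rw [edgeWeight_zero, mul_one]
    have : 0 ≤ |K| * N := by positivity
    linarith [hM p (mem_Ioo_of_near hs hp), le_abs_self M]
  · have hsub := hf.abs_sub_le s hs p q hp hq
    rw [edgeWeight_zero, mul_one] at *
    have hR : 0 ≤ (|p - q| / edgeDist a b s) ^ μ := rpow_nonneg (ratio_nonneg hs) _
    calc |F (f p) - F (f q)| ≤ K * |f p - f q| :=
          hF p (mem_Ioo_of_near hs hp) q (mem_Ioo_of_near hs hq)
      _ ≤ |K| * |f p - f q| := by gcongr; exact le_abs_self K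
      _ ≤ |K| * (N * (|p - q| / edgeDist a b s) ^ μ) := by gcongr
      _ ≤ (|M| + |K| * N) * (|p - q| / edgeDist a b s) ^ μ := by
        rw [← mul_assoc]
        gcongr
        exact le_add_of_nonneg_left (abs_nonneg M)

theorem WeightedHolder.sin_comp (hf : WeightedHolder a b 0 0 f) :
    WeightedHolder a b 0 0 (fun s => sin (f s)) :=
  hf.comp_of_lipschitz (F := sin) (K := 1) (M := 1)
    (fun p _ q _ => by simpa using abs_sin_sub_sin_le (f p) (f q)) (fun p _ => abs_sin_le_one _)

theorem WeightedHolder.cos_comp (hf : WeightedHolder a b 0 0 f) :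
    WeightedHolder a b 0 0 (fun s => cos (f s)) :=
  hf.comp_of_lipschitz (F := cos) (K := 1) (M := 1)
    (fun p _ q _ => by simpa using abs_cos_sub_cos_le (f p) (f q)) (fun p _ => abs_cos_le_one _)

theorem WeightedHolder.inv {c : ℝ} (hc : 0 < c) (hfc : ∀ s ∈ Ioo a b, c ≤ |f s|)
    (hf : WeightedHolder a b 0 0 f) : WeightedHolder a b 0 0 (fun s => (f s)⁻¹) := by
  refine hf.comp_of_lipschitz (F := fun x => x⁻¹) (K := (c * c)⁻¹) (M := c⁻¹)
    (fun p hp q hq => ?_) (fun p hp => ?_)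
  · have hp₀ := hfc p hp
    have hq₀ := hfc q hq
    rw [inv_sub_inv (abs_pos.1 (hc.trans_le hp₀)) (abs_pos.1 (hc.trans_le hq₀)), abs_div, abs_mul,
      abs_sub_comm, div_eq_inv_mul]
    gcongr
  · rw [abs_inv]
    exact inv_anti₀ hc (hfc p hp)

theorem abs_exp_sub_exp_le (x y : ℝ) : |exp x - exp y| ≤ (exp x + exp y) * |x - y| := by
  wlog h : y ≤ x generalizing x y
  · rw [abs_sub_comm, add_comm, abs_sub_comm x]
    exact this y x (le_of_not_ge h)
  have hxy : exp y = exp x * exp (y - x) := by rw [← exp_add]; ring_nf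
  rw [abs_of_nonneg (sub_nonneg.2 (exp_le_exp.2 h)), abs_of_nonneg (sub_nonneg.2 h)]
  nlinarith [add_one_le_exp (y - x), exp_pos x, mul_nonneg (exp_pos y).le (sub_nonneg.2 h)]

theorem WeightedHolder.exp_comp {M : ℝ} (hM : 0 ≤ M) (hf : WeightedHolder a b γ δ f)
    (hγ : 0 ≤ γ) (hδ : 0 ≤ δ)
    (hexp : ∀ s ∈ Ioo a b, exp (f s) ≤ M * edgeWeight a b γ' δ' s) :
    WeightedHolder a b (γ' + γ) (δ' + δ) (fun s => exp (f s)) := by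
  obtain ⟨K, μ, hf⟩ := hf
  have hK := hf.nonneg
  obtain ⟨C, hC, hnear⟩ := exists_edgeWeight_le_of_near a b γ' δ'
  obtain ⟨D, hD, hmono⟩ := exists_edgeWeight_le_mul a b (le_add_of_nonneg_right hγ : γ' ≤ γ' + γ)
    (le_add_of_nonneg_right hδ : δ' ≤ δ' + δ)
  have hexp_near : ∀ s ∈ Ioo a b, ∀ p, |p - s| ≤ edgeDist a b s / 2 →
      exp (f p) ≤ M * C * edgeWeight a b γ' δ' s := fun s hs p hp => by
    rw [mul_assoc]
    exact (hexp p (mem_Ioo_of_near hs hp)).trans (mul_le_mul_of_nonneg_left (hnear s hs p hp) hM)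
  refine ⟨M * C * D + 2 * (M * C * K), μ, by positivity, hf.exponent_pos, hf.exponent_le_one,
    fun s hs p hp => ?_, fun s hs p q hp hq => ?_⟩
  all_goals have hw := (edgeWeight_pos (γ := γ' + γ) (δ := δ' + δ) hs).le
  · have : 0 ≤ 2 * (M * C * K) * edgeWeight a b (γ' + γ) (δ' + δ) s := by positivity
    rw [abs_of_pos (exp_pos _)]
    linarith [hexp_near s hs p hp,
      mul_le_mul_of_nonneg_left (hmono s hs) (by positivity : 0 ≤ M * C)]
  · have hR : 0 ≤ (|p - q| / edgeDist a b s) ^ μ := rpow_nonneg (ratio_nonneg hs) _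
    have hw' := (edgeWeight_pos (γ := γ') (δ := δ') hs).le
    calc |exp (f p) - exp (f q)| ≤ (exp (f p) + exp (f q)) * |f p - f q| := abs_exp_sub_exp_le _ _
      _ ≤ (2 * (M * C * edgeWeight a b γ' δ' s)) *
          (K * edgeWeight a b γ δ s * (|p - q| / edgeDist a b s) ^ μ) := by
        gcongr
        · linarith [hexp_near s hs p hp, hexp_near s hs q hq]
        · exact hf.abs_sub_le s hs p q hp hq
      _ = 2 * (M * C * K) * edgeWeight a b (γ' + γ) (δ' + δ) s *
          (|p - q| / edgeDist a b s) ^ μ := by rw [← edgeWeight_mul hs]; ring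
      _ ≤ _ := by
        gcongr
        exact le_add_of_nonneg_left (by positivity)

end Composition

section Local

variable {a b γ δ s p : ℝ} {f : ℝ → ℝ}

theorem rpow_div_edgeDist_le_of_near {x μ : ℝ} (hx : 0 ≤ x) (hμ : 0 ≤ μ) (hμ1 : μ ≤ 1)
    (hs : s ∈ Ioo a b) (hp : |p - s| ≤ edgeDist a b s / 2) :
    (x / edgeDist a b p) ^ μ ≤ 2 * (x / edgeDist a b s) ^ μ := by
  have hds := edgeDist_pos hs
  have hdp := edgeDist_pos (mem_Ioo_of_near hs hp)
  calc (x / edgeDist a b p) ^ μ ≤ (2 * (x / edgeDist a b s)) ^ μ := by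
        gcongr
        rw [← mul_div_assoc, div_le_div_iff₀ hdp hds]
        nlinarith [half_edgeDist_le_of_near hp]
    _ = 2 ^ μ * (x / edgeDist a b s) ^ μ := mul_rpow two_pos.le (by positivity)
    _ ≤ 2 * (x / edgeDist a b s) ^ μ := by
        gcongr
        exact rpow_le_self_of_one_le one_le_two hμ1

/- Points `p, q` near `s` that are too far apart for the local estimate satisfy
`|p - q| ≥ d(s) / 16`, and for these the size estimate is enough. -/
theorem WeightedHolder.of_local {M μ : ℝ} (hM : 0 ≤ M) (hμ : 0 < μ) (hμ1 : μ ≤ 1)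
    (habs : ∀ s ∈ Ioo a b, |f s| ≤ M * edgeWeight a b γ δ s)
    (hsub : ∀ s ∈ Ioo a b, ∀ t ∈ Ioo a b, |t - s| ≤ edgeDist a b s / 8 →
      |f t - f s| ≤ M * edgeWeight a b γ δ s * (|t - s| / edgeDist a b s) ^ μ) :
    WeightedHolder a b γ δ f := by
  obtain ⟨C, hC, hnear⟩ := exists_edgeWeight_le_of_near a b γ δ
  have hweight : ∀ s ∈ Ioo a b, ∀ p, |p - s| ≤ edgeDist a b s / 2 →
      M * edgeWeight a b γ δ p ≤ M * C * edgeWeight a b γ δ s := fun s hs p hp => by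
    rw [mul_assoc]
    exact mul_le_mul_of_nonneg_left (hnear s hs p hp) hM
  have hpos : ∀ s ∈ Ioo a b, 0 ≤ M * C * edgeWeight a b γ δ s := fun s hs =>
    mul_nonneg (by positivity) (edgeWeight_pos hs).le
  have habs_near : ∀ s ∈ Ioo a b, ∀ p, |p - s| ≤ edgeDist a b s / 2 →
      |f p| ≤ M * C * edgeWeight a b γ δ s := fun s hs p hp =>
    (habs p (mem_Ioo_of_near hs hp)).trans (hweight s hs p hp)
  refine ⟨32 * (M * C), μ, by positivity, hμ, hμ1,
    fun s hs p hp => by linarith [hpos s hs, habs_near s hs p hp], fun s hs p q hp hq => ?_⟩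
  have hd := edgeDist_pos hs
  have hW := hpos s hs
  have hR : 0 ≤ (|p - q| / edgeDist a b s) ^ μ := by positivity
  rcases le_or_gt |q - p| (edgeDist a b p / 8) with hclose | hfar
  · calc |f p - f q| = |f q - f p| := abs_sub_comm _ _
      _ ≤ M * edgeWeight a b γ δ p * (|q - p| / edgeDist a b p) ^ μ :=
        hsub p (mem_Ioo_of_near hs hp) q (mem_Ioo_of_near hs hq) hclose
      _ ≤ (M * C * edgeWeight a b γ δ s) * (2 * (|p - q| / edgeDist a b s) ^ μ) := by
        rw [abs_sub_comm q p]
        have := edgeDist_pos (mem_Ioo_of_near hs hp)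
        exact mul_le_mul (hweight s hs p hp)
          (rpow_div_edgeDist_le_of_near (abs_nonneg _) hμ.le hμ1 hs hp) (by positivity) hW
      _ ≤ 32 * (M * C) * edgeWeight a b γ δ s * (|p - q| / edgeDist a b s) ^ μ := by
        linarith [mul_nonneg hW hR]
  · have hratio : 1 / 16 ≤ |p - q| / edgeDist a b s := by
      rw [le_div_iff₀ hd, abs_sub_comm]
      linarith [half_edgeDist_le_of_near hp]
    have hR16 : 1 / 16 ≤ (|p - q| / edgeDist a b s) ^ μ :=
      (self_le_rpow_of_le_one (by norm_num) (by norm_num) hμ1).trans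
        (rpow_le_rpow (by norm_num) hratio hμ.le)
    linarith [abs_sub (f p) (f q), habs_near s hs p hp, habs_near s hs q hq,
      mul_le_mul_of_nonneg_left hR16 hW]

theorem WeightedHolder.continuousOn (hf : WeightedHolder a b γ δ f) :
    ContinuousOn f (Ioo a b) := by
  obtain ⟨M, μ, hf⟩ := hf
  intro s hs
  refine ContinuousAt.continuousWithinAt (tendsto_iff_norm_sub_tendsto_zero.2 ?_)
  have hlim : Tendsto (fun p => M * edgeWeight a b γ δ s * (|p - s| / edgeDist a b s) ^ μ) (𝓝 s)
      (𝓝 0) := by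
    have : Continuous fun p => M * edgeWeight a b γ δ s * (|p - s| / edgeDist a b s) ^ μ :=
      continuous_const.mul
        (Continuous.rpow_const (by fun_prop) fun _ => Or.inr hf.exponent_pos.le)
    simpa [zero_rpow hf.exponent_pos.ne'] using this.tendsto s
  refine squeeze_zero' (Eventually.of_forall fun _ => norm_nonneg _) ?_ hlim
  filter_upwards [Metric.closedBall_mem_nhds s (half_pos (edgeDist_pos hs))] with p hp
  exact hf.abs_sub_le s hs p s hp (near_self hs)

end Local

section Power

variable {a b γ δ : ℝ}

theorem abs_log_sub_log_le {x y m : ℝ} (hm : 0 < m) (hx : m ≤ x) (hy : m ≤ y) :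
    |log x - log y| ≤ |x - y| / m := by
  wlog h : y ≤ x generalizing x y
  · rw [abs_sub_comm, abs_sub_comm x]
    exact this hy hx (le_of_not_ge h)
  have hx₀ := hm.trans_le hx
  have hy₀ := hm.trans_le hy
  rw [abs_of_nonneg (sub_nonneg.2 (log_le_log hy₀ h)), abs_of_nonneg (sub_nonneg.2 h),
    ← log_div hx₀.ne' hy₀.ne']
  calc log (x / y) ≤ x / y - 1 := log_le_sub_one_of_pos (by positivity)
    _ = (x - y) / y := by field_simp
    _ ≤ (x - y) / m := div_le_div_of_nonneg_left (sub_nonneg.2 h) hm hy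

theorem abs_rpow_sub_rpow_le {x y z : ℝ} (c : ℝ) (hz : 0 < z) (hx : |x - z| ≤ z / 2)
    (hy : |y - z| ≤ z / 2) :
    |x ^ c - y ^ c| ≤ 4 * |c| * 2 ^ |c| * z ^ c * (|x - y| / z) := by
  rw [abs_le] at hx hy
  have hx₀ : 0 < x := by linarith
  have hy₀ : 0 < y := by linarith
  have hxc := rpow_le_of_le_two_mul c hx₀ hz (by linarith) (by linarith)
  have hyc := rpow_le_of_le_two_mul c hy₀ hz (by linarith) (by linarith)
  have hlog := abs_log_sub_log_le (half_pos hz) (x := x) (y := y) (by linarith) (by linarith)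
  calc |x ^ c - y ^ c| ≤ (x ^ c + y ^ c) * (|log x - log y| * |c|) := by
        rw [← abs_mul, sub_mul, rpow_def_of_pos hx₀, rpow_def_of_pos hy₀]
        exact abs_exp_sub_exp_le _ _
    _ ≤ (2 ^ |c| * z ^ c + 2 ^ |c| * z ^ c) * (|x - y| / (z / 2) * |c|) := by gcongr
    _ = 4 * |c| * 2 ^ |c| * z ^ c * (|x - y| / z) := by field_simp; ring

theorem weightedHolder_rpow_sub_left (a b c : ℝ) :
    WeightedHolder a b (-c) 0 (fun s => (s - a) ^ c) := by
  have hnear : ∀ s p : ℝ, |p - s| ≤ edgeDist a b s / 2 → |(p - a) - (s - a)| ≤ (s - a) / 2 :=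
    fun s p hp => by
      rw [sub_sub_sub_cancel_right]
      linarith [edgeDist_le_left (a := a) (b := b) (s := s)]
  have hweight : ∀ s, edgeWeight a b (-c) 0 s = (s - a) ^ c := by simp [edgeWeight]
  refine ⟨2 ^ |c| + 4 * |c| * 2 ^ |c|, 1, by positivity, one_pos, le_rfl,
    fun s hs p hp => ?_, fun s hs p q hp hq => ?_⟩
  all_goals
    rw [hweight]
    have hz : 0 < s - a := sub_pos.2 hs.1
  · have hp₀ : 0 < p - a := sub_pos.2 (mem_Ioo_of_near hs hp).1
    have hpz := abs_le.1 (hnear s p hp)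
    have hpc : (p - a) ^ c ≤ 2 ^ |c| * (s - a) ^ c :=
      rpow_le_of_le_two_mul c hp₀ hz (by linarith) (by linarith)
    have : 0 ≤ 4 * |c| * 2 ^ |c| * (s - a) ^ c := by positivity
    rw [abs_of_pos (rpow_pos_of_pos hp₀ c)]
    linarith
  · have hd := edgeDist_pos hs
    calc |(p - a) ^ c - (q - a) ^ c|
        ≤ 4 * |c| * 2 ^ |c| * (s - a) ^ c * (|p - q| / (s - a)) := by
          simpa only [sub_sub_sub_cancel_right] using
            abs_rpow_sub_rpow_le c hz (hnear s p hp) (hnear s q hq)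
      _ ≤ (2 ^ |c| + 4 * |c| * 2 ^ |c|) * (s - a) ^ c * (|p - q| / edgeDist a b s) ^ (1 : ℝ) := by
          rw [rpow_one]
          gcongr
          · exact le_add_of_nonneg_left (by positivity)
          · exact edgeDist_le_left

theorem weightedHolder_rpow_sub_right (a b c : ℝ) :
    WeightedHolder a b 0 (-c) (fun s => (b - s) ^ c) := by
  refine (weightedHolder_rpow_sub_left a b c).comp_reflect.congr fun s _ => ?_
  exact congrArg (· ^ c) (by ring)

theorem weightedHolder_edgeWeight (a b γ δ : ℝ) : WeightedHolder a b γ δ (edgeWeight a b γ δ) := by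
  have h := (weightedHolder_rpow_sub_left a b (-γ)).mul (weightedHolder_rpow_sub_right a b (-δ))
  simp only [neg_neg, add_zero, zero_add] at h
  exact h

end Power

section EndpointClass

variable {a b γ δ : ℝ} {f : ℝ → ℝ}

theorem isHolderOn_iff {S : Set ℝ} : IsHolderOn f S ↔
    ∃ C r : ℝ, 0 ≤ C ∧ 0 < r ∧ r ≤ 1 ∧ ∀ x ∈ S, ∀ y ∈ S, |f x - f y| ≤ C * |x - y| ^ r := by
  constructor
  · rintro ⟨C, r, hr, hr1, h⟩
    exact ⟨C, r, C.2, hr, hr1, fun x hx y hy => h.dist_le hx hy⟩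
  · rintro ⟨C, r, hC, hr, hr1, h⟩
    lift C to NNReal using hC
    lift r to NNReal using hr.le
    refine ⟨C, r, hr, hr1, fun x hx y hy => ?_⟩
    rw [edist_dist, edist_dist, ENNReal.ofReal_rpow_of_nonneg dist_nonneg r.coe_nonneg,
      ← ENNReal.ofReal_coe_nnreal, ← ENNReal.ofReal_mul C.coe_nonneg]
    exact ENNReal.ofReal_le_ofReal (h x hx y hy)

theorem IsHolderOn.neg {S : Set ℝ} (hf : IsHolderOn f S) : IsHolderOn (fun s => -f s) S := by
  rw [isHolderOn_iff] at hf ⊢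
  simpa only [neg_sub_neg, abs_sub_comm] using hf

theorem weightedHolder_of_isHolderOn (hf : IsHolderOn f (Icc a b)) : WeightedHolder a b 0 0 f := by
  obtain ⟨C, r, hC, hr, hr1, h⟩ := isHolderOn_iff.1 hf
  refine ⟨|f a| + C * |b - a| ^ r, r, by positivity, hr, hr1, fun s hs p hp => ?_,
    fun s hs p q hp hq => ?_⟩
  all_goals
    have hp' := mem_Ioo_of_near hs hp
    have hL := le_abs_self (b - a)
    rw [edgeWeight_zero, mul_one]
  · have hpa : |p - a| ≤ |b - a| := by
      rw [abs_of_pos (sub_pos.2 hp'.1)]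
      linarith [hp'.2]
    calc |f p| ≤ |f a| + |f p - f a| := by linarith [abs_sub_abs_le_abs_sub (f p) (f a)]
      _ ≤ |f a| + C * |p - a| ^ r := by
        gcongr
        exact h p (Ioo_subset_Icc_self hp') a (left_mem_Icc.2 (hp'.1.trans hp'.2).le)
      _ ≤ |f a| + C * |b - a| ^ r := by gcongr
  · have hd := edgeDist_pos hs
    have hratio : |p - q| ≤ |b - a| * (|p - q| / edgeDist a b s) := by
      rw [← mul_div_assoc, le_div_iff₀ hd, mul_comm]
      exact mul_le_mul_of_nonneg_right ((edgeDist_le_length hs).trans hL) (abs_nonneg _)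
    calc |f p - f q| ≤ C * |p - q| ^ r :=
          h p (Ioo_subset_Icc_self hp') q (Ioo_subset_Icc_self (mem_Ioo_of_near hs hq))
      _ ≤ C * (|b - a| * (|p - q| / edgeDist a b s)) ^ r := by gcongr
      _ = C * |b - a| ^ r * (|p - q| / edgeDist a b s) ^ r := by
        rw [mul_rpow (abs_nonneg _) (by positivity), mul_assoc]
      _ ≤ (|f a| + C * |b - a| ^ r) * (|p - q| / edgeDist a b s) ^ r := by
        gcongr
        exact le_add_of_nonneg_left (abs_nonneg _)

/- If `t` is not near `s`, then `d(s)` and `d(t)` are at most a multiple of `|s - t|`, and the size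
bound alone suffices. -/
theorem isHolderOn_Icc_of_near {C ν : ℝ} (hC : 0 ≤ C) (hν : 0 < ν) (hν1 : ν ≤ 1)
    (habs : ∀ s ∈ Icc a b, |f s| ≤ C * edgeDist a b s ^ ν)
    (hsub : ∀ s ∈ Ioo a b, ∀ t, |t - s| ≤ edgeDist a b s / 2 → |f s - f t| ≤ C * |s - t| ^ ν) :
    IsHolderOn f (Icc a b) := by
  have hd₀ : ∀ s ∈ Icc a b, 0 ≤ edgeDist a b s := fun s hs =>
    le_min (sub_nonneg.2 hs.1) (sub_nonneg.2 hs.2)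
  refine isHolderOn_iff.2 ⟨C * (2 ^ ν + 3 ^ ν), ν, by positivity, hν, hν1, fun s hs t ht => ?_⟩
  have hpow : (1 : ℝ) ≤ 2 ^ ν + 3 ^ ν :=
    (one_le_rpow one_le_two hν.le).trans (le_add_of_nonneg_right (by positivity))
  rcases le_or_gt (edgeDist a b s) (2 * |s - t|) with hfar | hclose
  · have hdt : edgeDist a b t ≤ 3 * |s - t| := by
      have := edgeDist_le_add a b s t
      rw [abs_sub_comm] at this
      linarith
    calc |f s - f t| ≤ |f s| + |f t| := abs_sub _ _
      _ ≤ C * (2 * |s - t|) ^ ν + C * (3 * |s - t|) ^ ν := by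
        refine add_le_add ((habs s hs).trans ?_) ((habs t ht).trans ?_)
        · exact mul_le_mul_of_nonneg_left (rpow_le_rpow (hd₀ s hs) hfar hν.le) hC
        · exact mul_le_mul_of_nonneg_left (rpow_le_rpow (hd₀ t ht) hdt hν.le) hC
      _ = C * (2 ^ ν + 3 ^ ν) * |s - t| ^ ν := by
        rw [mul_rpow two_pos.le (abs_nonneg _), mul_rpow zero_le_three (abs_nonneg _)]
        ring
  · have hs' : s ∈ Ioo a b := by
      obtain ⟨h₁, h₂⟩ := lt_min_iff.1 ((by positivity : 0 ≤ 2 * |s - t|).trans_lt hclose)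
      exact ⟨sub_pos.1 h₁, sub_pos.1 h₂⟩
    refine (hsub s hs' t (by rw [abs_sub_comm]; linarith)).trans ?_
    exact mul_le_mul_of_nonneg_right (le_mul_of_one_le_right hC hpow) (by positivity)

theorem WeightedHolder.isHolderOn_of_neg {η : ℝ} (hη : 0 < η)
    (hf : WeightedHolder a b (-η) (-η) f) (hf₀ : ∀ s ∉ Ioo a b, f s = 0) :
    IsHolderOn f (Icc a b) := by
  obtain ⟨M, μ, hf⟩ := hf
  have hM := hf.nonneg
  have hν : 0 < min η μ := lt_min hη hf.exponent_pos
  replace hf := hf.mono_exponent hν (min_le_right η μ)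
  set ν := min η μ
  set C := M * (|b - a| ^ η * |b - a| ^ (η - ν))
  have hC : 0 ≤ C := by positivity
  have hweight : ∀ s ∈ Ioo a b, M * edgeWeight a b (-η) (-η) s ≤ C * edgeDist a b s ^ ν := by
    intro s hs
    rw [mul_assoc, abs_of_pos (sub_pos.2 (hs.1.trans hs.2))]
    exact mul_le_mul_of_nonneg_left
      (edgeWeight_neg_le_edgeDist_rpow hη.le (min_le_left η μ) hs) hM
  refine isHolderOn_Icc_of_near hC hν hf.exponent_le_one (fun s hs => ?_) fun s hs t ht => ?_
  · by_cases hs' : s ∈ Ioo a b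
    · exact (hf.abs_le s hs' s (near_self hs')).trans (hweight s hs')
    · rw [hf₀ s hs', abs_zero]
      exact mul_nonneg hC
        (rpow_nonneg (le_min (sub_nonneg.2 hs.1) (sub_nonneg.2 hs.2)) _)
  · have hd := edgeDist_pos hs
    calc |f s - f t| ≤ C * edgeDist a b s ^ ν * (|s - t| / edgeDist a b s) ^ ν :=
          (hf.abs_sub_le s hs s t (near_self hs) ht).trans
            (mul_le_mul_of_nonneg_right (hweight s hs) (by positivity))
      _ = C * |s - t| ^ ν := by
          rw [mul_assoc, ← mul_rpow hd.le (by positivity), mul_div_cancel₀ _ hd.ne']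

theorem mem_endpointClass_iff {μ ν : ℝ} (hμ : 0 < μ) (hν : 0 < ν) {ψ : ℝ → ℝ} :
    ψ ∈ EndpointClass a b μ ν ↔ ∃ γ δ, γ < μ ∧ δ < ν ∧ WeightedHolder a b γ δ ψ := by
  constructor
  · rintro ⟨γ, δ, -, hγ, -, hδ, g, hg, hψ⟩
    have hgw := (weightedHolder_of_isHolderOn hg).mul (weightedHolder_edgeWeight a b γ δ)
    rw [zero_add, zero_add] at hgw
    refine ⟨γ, δ, hγ, hδ, hgw.congr fun s hs => ?_⟩
    change ψ s = g s * ((s - a) ^ (-γ) * (b - s) ^ (-δ))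
    rw [hψ s hs, rpow_neg (sub_pos.2 hs.1).le, rpow_neg (sub_pos.2 hs.2).le, ← mul_inv,
      div_eq_mul_inv]
  · rintro ⟨γ, δ, hγ, hδ, hψ⟩
    obtain ⟨γ', hγ', hγμ⟩ := exists_between (max_lt hγ hμ)
    obtain ⟨δ', hδ', hδν⟩ := exists_between (max_lt hδ hν)
    rw [max_lt_iff] at hγ' hδ'
    refine ⟨γ', δ', hγ'.2.le, hγμ, hδ'.2.le, hδν,
      (Ioo a b).indicator fun s => ψ s * edgeWeight a b (-γ') (-δ') s, ?_, fun s hs => ?_⟩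
    · have hη : 0 < min (γ' - γ) (δ' - δ) := lt_min (by linarith) (by linarith)
      refine WeightedHolder.isHolderOn_of_neg hη ?_ fun s hs => indicator_of_notMem hs _
      refine ((hψ.mul (weightedHolder_edgeWeight a b (-γ') (-δ'))).congr
        fun s hs => indicator_of_mem hs _).mono ?_ ?_
      · linarith [min_le_left (γ' - γ) (δ' - δ)]
      · linarith [min_le_right (γ' - γ) (δ' - δ)]
    · have h₁ := rpow_pos_of_pos (sub_pos.2 hs.1) γ'
      have h₂ := rpow_pos_of_pos (sub_pos.2 hs.2) δ'
      rw [indicator_of_mem hs, edgeWeight, neg_neg, neg_neg]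
      field_simp

end EndpointClass

section Integrability

variable {a b γ δ : ℝ} {f : ℝ → ℝ}

theorem integrableOn_rpow_sub_left {c : ℝ} (hc : -1 < c) :
    IntegrableOn (fun s => (s - a) ^ c) (Ioo a b) := by
  rcases le_or_gt b a with hab | hab
  · simp [Ioo_eq_empty_of_le hab]
  have h := (intervalIntegral.intervalIntegrable_rpow' (a := 0) (b := b - a) hc).comp_sub_right a
  rwa [zero_add, sub_add_cancel, intervalIntegrable_iff_integrableOn_Ioo_of_le hab.le] at h

theorem integrableOn_rpow_sub_right {c : ℝ} (hc : -1 < c) :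
    IntegrableOn (fun s => (b - s) ^ c) (Ioo a b) := by
  rcases le_or_gt b a with hab | hab
  · simp [Ioo_eq_empty_of_le hab]
  have h := (intervalIntegral.intervalIntegrable_rpow' (a := b - a) (b := 0) hc).comp_sub_left b
  rwa [sub_zero, sub_sub_cancel, intervalIntegrable_iff_integrableOn_Ioo_of_le hab.le] at h

theorem WeightedHolder.integrableOn_of_abs_le (hf : WeightedHolder a b γ δ f) {g : ℝ → ℝ}
    (hg : IntegrableOn g (Ioo a b)) (hfg : ∀ s ∈ Ioo a b, |f s| ≤ g s) :
    IntegrableOn f (Ioo a b) :=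
  Integrable.mono' hg (hf.continuousOn.aestronglyMeasurable measurableSet_Ioo)
    ((ae_restrict_mem measurableSet_Ioo).mono hfg)

theorem edgeWeight_le_add {s : ℝ} (hγ : 0 ≤ γ) (hδ : 0 ≤ δ) (hs : s ∈ Ioo a b) :
    edgeWeight a b γ δ s ≤
      ((b - a) / 2) ^ (-δ) * (s - a) ^ (-γ) + ((b - a) / 2) ^ (-γ) * (b - s) ^ (-δ) := by
  have hL : 0 < (b - a) / 2 := by linarith [hs.1, hs.2]
  have hsa := rpow_pos_of_pos (sub_pos.2 hs.1) (-γ)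
  have hbs := rpow_pos_of_pos (sub_pos.2 hs.2) (-δ)
  have hLγ := rpow_pos_of_pos hL (-γ)
  have hLδ := rpow_pos_of_pos hL (-δ)
  rw [edgeWeight]
  rcases le_total ((b - a) / 2) (s - a) with h | h
  · have := rpow_le_rpow_of_nonpos hL h (neg_nonpos.2 hγ)
    nlinarith
  · have := rpow_le_rpow_of_nonpos hL (by linarith : (b - a) / 2 ≤ b - s) (neg_nonpos.2 hδ)
    nlinarith

theorem integrableOn_edgeWeight (hγ : γ < 1) (hδ : δ < 1) :
    IntegrableOn (edgeWeight a b γ δ) (Ioo a b) := by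
  have habs : ∀ s ∈ Ioo a b, |edgeWeight a b γ δ s| = edgeWeight a b γ δ s := fun s hs =>
    abs_of_pos (edgeWeight_pos hs)
  wlog h₀ : 0 ≤ γ ∧ 0 ≤ δ generalizing γ δ
  · obtain ⟨C, -, hC⟩ := exists_edgeWeight_le_mul a b (le_max_left γ 0) (le_max_left δ 0)
    refine (weightedHolder_edgeWeight a b γ δ).integrableOn_of_abs_le
      ((this (max_lt hγ one_pos) (max_lt hδ one_pos)
        (fun s hs => abs_of_pos (edgeWeight_pos hs))
        ⟨le_max_right _ _, le_max_right _ _⟩).const_mul C) fun s hs => ?_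
    rw [habs s hs]
    exact hC s hs
  refine (weightedHolder_edgeWeight a b γ δ).integrableOn_of_abs_le
    (((integrableOn_rpow_sub_left (neg_lt_neg hγ)).const_mul (((b - a) / 2) ^ (-δ))).add
      ((integrableOn_rpow_sub_right (neg_lt_neg hδ)).const_mul (((b - a) / 2) ^ (-γ))))
    fun s hs => ?_
  rw [habs s hs]
  exact edgeWeight_le_add h₀.1 h₀.2 hs

theorem WeightedHolder.integrableOn (hf : WeightedHolder a b γ δ f) (hγ : γ < 1) (hδ : δ < 1) :
    IntegrableOn f (Ioo a b) := by
  obtain ⟨M, -, hM⟩ := hf.exists_abs_le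
  exact hf.integrableOn_of_abs_le ((integrableOn_edgeWeight hγ hδ).const_mul M) hM

end Integrability

/-! ### Regularisation of the principal value -/

/-- An even cutoff function, equal to `1` at `0` and supported in `[-D, D]`. -/
def cutoff (D u : ℝ) : ℝ := max 0 (1 - (u / D) ^ 2)

/-- The bounded Lipschitz kernel `(1 - cutoff D u) / u`, which is `1 / u` for `|u| ≥ D`; see
`farKernel_eq`. -/
def farKernel (D u : ℝ) : ℝ := u / max D |u| ^ 2

/-- The integrand that remains when the odd function `f(s) cutoff(r - s) / (r - s)` is removed
from the integrand of the principal value. -/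
def pvIntegrand (f : ℝ → ℝ) (D s r : ℝ) : ℝ := (f r - f s * cutoff D (r - s)) / (r - s)

/-- The integrable singularity `|u|^{μ-1}` on `[-D, D]`. -/
def nearBound (D μ u : ℝ) : ℝ := (Iic D).indicator (fun x => x ^ (μ - 1)) |u|

/-- A quantitative Hölder condition at the point `s`, on an interval `[s - D, s + D]` inside
`(a, b)`. -/
structure HolderAt (a b : ℝ) (f : ℝ → ℝ) (s D A μ : ℝ) : Prop where
  pos : 0 < D
  nonneg : 0 ≤ A
  exponent_pos : 0 < μ
  left : a < s - D
  right : s + D < b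
  bound : ∀ r, |r - s| ≤ D → |f r - f s| ≤ A * |r - s| ^ μ

section Kernel

variable {D μ : ℝ}

theorem cutoff_neg (u : ℝ) : cutoff D (-u) = cutoff D u := by
  simp [cutoff, neg_div]

theorem abs_cutoff_le_one (u : ℝ) : |cutoff D u| ≤ 1 := by
  rw [cutoff, abs_of_nonneg (le_max_left _ _)]
  exact max_le zero_le_one (by linarith [sq_nonneg (u / D)])

theorem cutoff_eq_zero (hD : 0 < D) {u : ℝ} (hu : D ≤ |u|) : cutoff D u = 0 := by
  have : 1 ≤ (u / D) ^ 2 := by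
    rw [← sq_abs, abs_div, abs_of_pos hD]
    exact one_le_pow₀ ((one_le_div hD).2 hu)
  exact max_eq_left (by linarith)

theorem cutoff_zero : cutoff D 0 = 1 := by simp [cutoff]

theorem continuous_cutoff : Continuous (cutoff D) := by
  unfold cutoff
  fun_prop

theorem farKernel_eq (hD : 0 < D) (u : ℝ) : farKernel D u = (1 - cutoff D u) / u := by
  rcases eq_or_ne u 0 with rfl | hu
  · simp [farKernel]
  rcases le_total D |u| with h | h
  · rw [cutoff_eq_zero hD h, farKernel, max_eq_right h, sq_abs, sub_zero, sq,
      div_mul_cancel_left₀ hu, one_div]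
  · have : (u / D) ^ 2 ≤ 1 := by
      rw [← sq_abs, abs_div, abs_of_pos hD]
      exact pow_le_one₀ (by positivity) ((div_le_one hD).2 h)
    rw [farKernel, max_eq_left h, cutoff, max_eq_right (by linarith)]
    field_simp
    ring

theorem abs_farKernel_le (hD : 0 < D) (u : ℝ) : |farKernel D u| ≤ 1 / max D |u| := by
  have h : 0 < max D |u| := lt_max_of_lt_left hD
  rw [farKernel, abs_div, abs_of_pos (pow_pos h 2), div_le_div_iff₀ (pow_pos h 2) h, one_mul, sq]
  exact mul_le_mul_of_nonneg_right (le_max_right _ _) h.le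

theorem abs_farKernel_sub_le (hD : 0 < D) (u v : ℝ) :
    |farKernel D u - farKernel D v| ≤ 3 * |u - v| / (D * max D |u|) := by
  have hvQ : |v| ≤ max D |v| := le_max_right _ _
  have hPQ : |(max D |v|) - max D (|u|)| ≤ |u - v| := by
    have h := abs_max_sub_max_le_abs |v| |u| D
    rw [max_comm |v|, max_comm |u|] at h
    exact h.trans ((abs_abs_sub_abs_le v u).trans (abs_sub_comm v u).le)
  have hDP : D ≤ max D |u| := le_max_left _ _
  have hDQ : D ≤ max D |v| := le_max_left _ _
  simp only [farKernel]
  set P := max D |u|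
  set Q := max D |v|
  have hP : 0 < P := hD.trans_le hDP
  have hQ : 0 < Q := hD.trans_le hDQ
  have hfirst : |(u - v) / P ^ 2| ≤ |u - v| / (D * P) := by
    rw [abs_div, abs_of_pos (pow_pos hP 2), sq]
    gcongr
  have hsecond : |v * (Q - P) * ((Q + P) / (P ^ 2 * Q ^ 2))| ≤ 2 * |u - v| / (D * P) :=
    calc |v * (Q - P) * ((Q + P) / (P ^ 2 * Q ^ 2))|
        = |v| * |Q - P| * ((Q + P) / (P ^ 2 * Q ^ 2)) := by
          rw [abs_mul, abs_mul, abs_of_pos (by positivity : 0 < (Q + P) / (P ^ 2 * Q ^ 2))]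
      _ ≤ Q * |u - v| * ((Q + P) / (P ^ 2 * Q ^ 2)) := by gcongr
      _ = |u - v| / P * (1 / P + 1 / Q) := by field_simp
      _ ≤ |u - v| / P * (1 / D + 1 / D) := by gcongr
      _ = 2 * |u - v| / (D * P) := by field_simp; ring
  calc |u / P ^ 2 - v / Q ^ 2|
      = |(u - v) / P ^ 2 + v * (Q - P) * ((Q + P) / (P ^ 2 * Q ^ 2))| := by
        congr 1
        field_simp
        ring
    _ ≤ |u - v| / (D * P) + 2 * |u - v| / (D * P) :=
        (abs_add_le _ _).trans (add_le_add hfirst hsecond)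
    _ = 3 * |u - v| / (D * P) := by ring

theorem continuous_farKernel (hD : 0 < D) : Continuous (farKernel D) := by
  unfold farKernel
  refine Continuous.div (by fun_prop) (by fun_prop) fun u => ?_
  have : 0 < max D |u| := lt_max_of_lt_left hD
  positivity

theorem nearBound_nonneg (u : ℝ) : 0 ≤ nearBound D μ u :=
  indicator_apply_nonneg fun _ => rpow_nonneg (abs_nonneg u) _

theorem integral_nearBound (hD : 0 < D) (hμ : 0 < μ) :
    ∫ u, nearBound D μ u = 2 * (D ^ μ / μ) := by
  have h : ∫ u, nearBound D μ u = _ :=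
    integral_comp_abs (f := (Iic D).indicator fun x => x ^ (μ - 1))
  rw [h, setIntegral_indicator measurableSet_Iic, Ioi_inter_Iic,
    ← intervalIntegral.integral_of_le hD.le, integral_rpow (Or.inl (by linarith)),
    sub_add_cancel, zero_rpow hμ.ne', sub_zero]

theorem integrable_nearBound (hD : 0 < D) (hμ : 0 < μ) : Integrable (nearBound D μ) := by
  refine not_imp_comm.1 integral_undef ?_
  rw [integral_nearBound hD hμ]
  positivity

theorem integral_odd_comp_sub {φ : ℝ → ℝ} (hφ : ∀ u, φ (-u) = -φ u) (s : ℝ) :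
    ∫ r, φ (r - s) = 0 := by
  rw [integral_sub_right_eq_self]
  have h := integral_neg_eq_self φ volume
  simp only [hφ, integral_neg] at h
  linarith

end Kernel

section PvIntegrand

variable {a b s D A μ : ℝ} {f : ℝ → ℝ}

theorem pvIntegrand_eq (hD : 0 < D) (r : ℝ) : pvIntegrand f D s r =
    (f r - f s) * (cutoff D (r - s) / (r - s)) + f r * farKernel D (r - s) := by
  rw [farKernel_eq hD, pvIntegrand]
  ring

theorem HolderAt.mem_Ioo (h : HolderAt a b f s D A μ) {r : ℝ} (hr : |r - s| ≤ D) : r ∈ Ioo a b := by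
  rw [abs_le] at hr
  exact ⟨by linarith [h.left], by linarith [h.right]⟩

theorem HolderAt.abs_near_le (h : HolderAt a b f s D A μ) (r : ℝ) :
    |(f r - f s) * (cutoff D (r - s) / (r - s))| ≤ A * nearBound D μ (r - s) := by
  rcases lt_or_ge D |r - s| with hr | hr
  · rw [cutoff_eq_zero h.pos hr.le, zero_div, mul_zero, abs_zero]
    exact mul_nonneg h.nonneg (nearBound_nonneg _)
  rcases eq_or_ne (r - s) 0 with h₀ | h₀
  · rw [h₀, div_zero, mul_zero, abs_zero]
    exact mul_nonneg h.nonneg (nearBound_nonneg _)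
  have h₀' := abs_pos.2 h₀
  have hA := h.nonneg
  calc |(f r - f s) * (cutoff D (r - s) / (r - s))|
      = |f r - f s| * (|cutoff D (r - s)| / |r - s|) := by rw [abs_mul, abs_div]
    _ ≤ (A * |r - s| ^ μ) * (1 / |r - s|) := by
        gcongr
        · exact h.bound r hr
        · exact abs_cutoff_le_one _
    _ = A * nearBound D μ (r - s) := by
        rw [nearBound, indicator_of_mem (mem_Iic.2 hr), rpow_sub_one h₀'.ne']
        ring

theorem aestronglyMeasurable_near (hf : IntegrableOn f (Ioo a b)) :
    AEStronglyMeasurable (fun r => (f r - f s) * (cutoff D (r - s) / (r - s)))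
      (volume.restrict (Ioo a b)) :=
  (hf.1.sub aestronglyMeasurable_const).mul
    ((continuous_cutoff.measurable.div measurable_id).comp
      (measurable_id.sub_const s)).aestronglyMeasurable

theorem HolderAt.integrableOn_near (h : HolderAt a b f s D A μ) (hf : IntegrableOn f (Ioo a b)) :
    IntegrableOn (fun r => (f r - f s) * (cutoff D (r - s) / (r - s))) (Ioo a b) :=
  Integrable.mono' (((integrable_nearBound h.pos h.exponent_pos).comp_sub_right s).const_mul
    A).integrableOn (aestronglyMeasurable_near hf) (Eventually.of_forall fun r => h.abs_near_le r)

theorem integrableOn_div_max (hD : 0 < D) (hf : IntegrableOn f (Ioo a b)) :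
    IntegrableOn (fun r => |f r| / max D |r - s|) (Ioo a b) := by
  refine Integrable.mono' (hf.abs.div_const D) ?_ (Eventually.of_forall fun r => ?_)
  · exact hf.abs.1.div₀ (Continuous.aestronglyMeasurable (by fun_prop))
  · rw [norm_div, norm_of_nonneg (abs_nonneg _), norm_of_nonneg (hD.le.trans (le_max_left _ _))]
    exact div_le_div_of_nonneg_left (abs_nonneg _) hD (le_max_left _ _)

theorem abs_mul_farKernel_le (hD : 0 < D) (r : ℝ) :
    |f r * farKernel D (r - s)| ≤ |f r| / max D |r - s| := by
  rw [abs_mul, div_eq_mul_one_div]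
  exact mul_le_mul_of_nonneg_left (abs_farKernel_le hD _) (abs_nonneg _)

theorem integrableOn_far (hD : 0 < D) (hf : IntegrableOn f (Ioo a b)) :
    IntegrableOn (fun r => f r * farKernel D (r - s)) (Ioo a b) :=
  Integrable.mono' (integrableOn_div_max hD hf)
    (hf.1.mul ((continuous_farKernel hD).comp (by fun_prop)).aestronglyMeasurable)
    (Eventually.of_forall fun r => abs_mul_farKernel_le hD r)

theorem HolderAt.integrableOn_pvIntegrand (h : HolderAt a b f s D A μ)
    (hf : IntegrableOn f (Ioo a b)) : IntegrableOn (pvIntegrand f D s) (Ioo a b) :=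
  ((h.integrableOn_near hf).add (integrableOn_far h.pos hf)).congr
    (Eventually.of_forall fun r => (pvIntegrand_eq h.pos r).symm)

theorem HolderAt.integral_abs_pvIntegrand_le (h : HolderAt a b f s D A μ)
    (hf : IntegrableOn f (Ioo a b)) : ∫ r in Ioo a b, |pvIntegrand f D s r| ≤
      A * (2 * (D ^ μ / μ)) + ∫ r in Ioo a b, |f r| / max D |r - s| := by
  have hn : Integrable (fun r => A * nearBound D μ (r - s)) :=
    ((integrable_nearBound h.pos h.exponent_pos).comp_sub_right s).const_mul A
  calc ∫ r in Ioo a b, |pvIntegrand f D s r|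
      ≤ ∫ r in Ioo a b, (A * nearBound D μ (r - s) + |f r| / max D |r - s|) := by
        refine integral_mono_of_nonneg (Eventually.of_forall fun _ => abs_nonneg _)
          (hn.integrableOn.add (integrableOn_div_max h.pos hf)) (Eventually.of_forall fun r => ?_)
        simp only [pvIntegrand_eq h.pos]
        exact (abs_add_le _ _).trans (add_le_add (h.abs_near_le r) (abs_mul_farKernel_le h.pos r))
    _ = (∫ r in Ioo a b, A * nearBound D μ (r - s)) + ∫ r in Ioo a b, |f r| / max D |r - s| :=
        integral_add hn.integrableOn (integrableOn_div_max h.pos hf)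
    _ ≤ (∫ r, A * nearBound D μ (r - s)) + ∫ r in Ioo a b, |f r| / max D |r - s| :=
        add_le_add (setIntegral_le_integral hn (Eventually.of_forall fun r =>
          mul_nonneg h.nonneg (nearBound_nonneg _))) le_rfl
    _ = A * (2 * (D ^ μ / μ)) + ∫ r in Ioo a b, |f r| / max D |r - s| := by
        rw [integral_const_mul, integral_sub_right_eq_self (nearBound D μ),
          integral_nearBound h.pos h.exponent_pos]

theorem HolderAt.integral_mul_even (h : HolderAt a b f s D A μ) (hf : IntegrableOn f (Ioo a b))
    {m : ℝ → ℝ} (hm : ∀ u, m (-u) = m u) (hmeas : Measurable m) (hm_le : ∀ u, |m u| ≤ 1)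
    (hint : IntegrableOn (fun r => f r * (m (r - s) / (r - s))) (Ioo a b)) :
    ∫ r in Ioo a b, f r * (m (r - s) / (r - s)) =
      ∫ r in Ioo a b, pvIntegrand f D s r * m (r - s) := by
  have hpv : IntegrableOn (fun r => pvIntegrand f D s r * m (r - s)) (Ioo a b) :=
    (h.integrableOn_pvIntegrand hf).mul_bdd (c := 1)
      (hmeas.comp (measurable_id.sub_const s)).aestronglyMeasurable
      (Eventually.of_forall fun r => hm_le _)
  have hodd : ∫ r in Ioo a b, f s * (cutoff D (r - s) * m (r - s) / (r - s)) = 0 := by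
    rw [setIntegral_eq_integral_of_forall_compl_eq_zero, integral_const_mul,
      integral_odd_comp_sub (φ := fun u => cutoff D u * m u / u), mul_zero]
    · intro u
      simp only [cutoff_neg, hm, div_neg]
    · intro r hr
      rw [cutoff_eq_zero h.pos (le_of_not_ge fun hr' => hr (h.mem_Ioo hr')), zero_mul, zero_div,
        mul_zero]
  rw [← sub_eq_zero, ← integral_sub hint hpv, ← hodd]
  congr 1 with r
  rw [pvIntegrand]
  ring

theorem HolderAt.tendsto_integral_pvIntegrand_mul (h : HolderAt a b f s D A μ)
    (hf : IntegrableOn f (Ioo a b)) {m : ℝ → ℝ → ℝ} {c : ℝ}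
    (hmeas : ∀ ε > 0, Measurable (m ε)) (hm_le : ∀ ε > 0, ∀ u, |m ε u| ≤ 1)
    (hlim : ∀ u ≠ 0, Tendsto (m · u) (𝓝[>] 0) (𝓝 c)) :
    Tendsto (fun ε => ∫ r in Ioo a b, pvIntegrand f D s r * m ε (r - s)) (𝓝[>] 0)
      (𝓝 (∫ r in Ioo a b, pvIntegrand f D s r * c)) := by
  have hpv := h.integrableOn_pvIntegrand hf
  refine tendsto_integral_filter_of_dominated_convergence (fun r => |pvIntegrand f D s r|)
    ?_ ?_ hpv.abs (Eventually.of_forall fun r => ?_)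
  · filter_upwards [self_mem_nhdsWithin] with ε hε
    exact hpv.1.mul ((hmeas ε hε).comp (measurable_id.sub_const s)).aestronglyMeasurable
  · filter_upwards [self_mem_nhdsWithin] with ε hε
    refine Eventually.of_forall fun r => ?_
    rw [norm_mul]
    exact mul_le_of_le_one_right (abs_nonneg _) (hm_le ε hε _)
  · rcases eq_or_ne r s with rfl | hr
    · simp [pvIntegrand]
    · exact (hlim _ (sub_ne_zero.2 hr)).const_mul _

end PvIntegrand

section PrincipalValue

variable {a b s D A μ ε : ℝ} {f : ℝ → ℝ}

theorem measurableSet_lt_abs_sub (s ε : ℝ) : MeasurableSet {r : ℝ | ε < |r - s|} :=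
  (isOpen_lt continuous_const (by fun_prop)).measurableSet

theorem integrableOn_trunc (hf : IntegrableOn f (Ioo a b)) (hε : 0 < ε) :
    IntegrableOn (fun r => f r / (r - s)) (Ioo a b ∩ {r | ε < |r - s|}) := by
  have hf' : IntegrableOn f (Ioo a b ∩ {r | ε < |r - s|}) := hf.mono_set inter_subset_left
  refine Integrable.mono' (hf'.abs.div_const ε) (hf'.1.div₀ (Continuous.aestronglyMeasurable
    (by fun_prop))) ?_
  filter_upwards
    [ae_restrict_mem (measurableSet_Ioo.inter (measurableSet_lt_abs_sub s ε))] with r hr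
  rw [norm_div]
  exact div_le_div_of_nonneg_left (abs_nonneg _) hε (le_of_lt hr.2)

theorem mul_indicator_lt_abs (g : ℝ → ℝ) (r : ℝ) :
    g r * {u : ℝ | ε < |u|}.indicator 1 (r - s) = {r | ε < |r - s|}.indicator g r := by
  simp [indicator_apply]

theorem HolderAt.truncHilbert_eq (h : HolderAt a b f s D A μ) (hf : IntegrableOn f (Ioo a b))
    (hε : 0 < ε) : truncHilbert a b f s ε = (1 / π) *
      ∫ r in Ioo a b ∩ {r | ε < |r - s|}, pvIntegrand f D s r := by
  have hset := measurableSet_lt_abs_sub s ε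
  have hkernel : ∀ r, f r * ({u : ℝ | ε < |u|}.indicator 1 (r - s) / (r - s)) =
      {r | ε < |r - s|}.indicator (fun r => f r / (r - s)) r := fun r => by
    rw [← mul_indicator_lt_abs]
    ring
  have heven := h.integral_mul_even hf (m := {u : ℝ | ε < |u|}.indicator 1)
    (fun u => by simp [indicator_apply])
    (measurable_one.indicator (measurableSet_lt measurable_const (by fun_prop)))
    (fun u => by by_cases hu : ε < |u| <;> simp [hu])
    (by
      simp only [hkernel]
      rw [IntegrableOn, integrable_indicator_iff hset, IntegrableOn,
        Measure.restrict_restrict hset, inter_comm]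
      exact integrableOn_trunc hf hε)
  simp only [hkernel, mul_indicator_lt_abs] at heven
  rw [setIntegral_indicator hset, setIntegral_indicator hset] at heven
  exact congrArg ((1 / π) * ·) heven

theorem HolderAt.tendsto_truncHilbert (h : HolderAt a b f s D A μ)
    (hf : IntegrableOn f (Ioo a b)) : Tendsto (truncHilbert a b f s) (𝓝[>] 0)
      (𝓝 ((1 / π) * ∫ r in Ioo a b, pvIntegrand f D s r)) := by
  have hlim := h.tendsto_integral_pvIntegrand_mul hf
    (m := fun ε => {u : ℝ | ε < |u|}.indicator 1) (c := 1)
    (fun ε _ => measurable_one.indicator (measurableSet_lt measurable_const (by fun_prop)))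
    (fun ε _ u => by by_cases hu : ε < |u| <;> simp [hu]) (fun u hu => by
      refine tendsto_const_nhds.congr' ?_
      filter_upwards [mem_nhdsWithin_of_mem_nhds (Iio_mem_nhds (abs_pos.2 hu))] with ε hε
      exact (indicator_of_mem (s := {u : ℝ | ε < |u|}) hε (1 : ℝ → ℝ)).symm)
  simp only [mul_indicator_lt_abs, mul_one] at hlim
  refine (hlim.const_mul (1 / π)).congr' ?_
  filter_upwards [self_mem_nhdsWithin] with ε hε
  rw [h.truncHilbert_eq hf hε, setIntegral_indicator (measurableSet_lt_abs_sub s ε)]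

theorem HolderAt.hilbertExists (h : HolderAt a b f s D A μ) (hf : IntegrableOn f (Ioo a b)) :
    HilbertExists a b f s :=
  ⟨fun _ hε => integrableOn_trunc hf hε, _, h.tendsto_truncHilbert hf⟩

theorem HolderAt.hilbert_eq (h : HolderAt a b f s D A μ) (hf : IntegrableOn f (Ioo a b)) :
    hilbert a b f s = (1 / π) * ∫ r in Ioo a b, pvIntegrand f D s r :=
  (h.tendsto_truncHilbert hf).limUnder_eq

theorem HilbertExists.tendsto (h : HilbertExists a b f s) :
    Tendsto (truncHilbert a b f s) (𝓝[>] 0) (𝓝 (hilbert a b f s)) :=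
  tendsto_nhds_limUnder h.2

theorem HolderAt.abs_truncHilbert_le (h : HolderAt a b f s D A μ) (hf : IntegrableOn f (Ioo a b))
    (hε : 0 < ε) : |truncHilbert a b f s ε| ≤ ∫ r in Ioo a b, |pvIntegrand f D s r| := by
  have hpv := h.integrableOn_pvIntegrand hf
  have hpi : 1 / π ≤ 1 := (div_le_one pi_pos).2 (by linarith [pi_gt_three])
  rw [h.truncHilbert_eq hf hε, abs_mul, abs_of_pos (by positivity)]
  calc 1 / π * |∫ r in Ioo a b ∩ {r | ε < |r - s|}, pvIntegrand f D s r|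
      ≤ 1 * ∫ r in Ioo a b ∩ {r | ε < |r - s|}, |pvIntegrand f D s r| :=
        mul_le_mul hpi abs_integral_le_integral_abs (abs_nonneg _) zero_le_one
    _ ≤ ∫ r in Ioo a b, |pvIntegrand f D s r| := by
        rw [one_mul]
        exact setIntegral_mono_set hpv.abs (Eventually.of_forall fun _ => abs_nonneg _)
          inter_subset_left.eventuallyLE

end PrincipalValue

/-! ### The finite Hilbert transform on weighted Hölder spaces -/

section FarBound

variable {a b γ δ γ' δ' s t M μ : ℝ} {f : ℝ → ℝ}

theorem inv_le_of_le_mul {m d x θ : ℝ} (hd : 0 < d) (hx : 0 < x) (hθ₀ : 0 ≤ θ) (hθ₁ : θ ≤ 1)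
    (hmd : d ≤ 5 * m) (hmx : x ≤ 5 * m) : m⁻¹ ≤ 5 * d ^ (-θ) * x ^ (θ - 1) := by
  have hm : 0 < 5 * m := hd.trans_le hmd
  calc m⁻¹ = 5 * (5 * m) ^ (-θ) * (5 * m) ^ (θ - 1) := by
        rw [mul_assoc, ← rpow_add hm, show -θ + (θ - 1) = -1 by ring, rpow_neg_one, mul_inv,
          mul_inv_cancel_left₀ (by norm_num)]
    _ ≤ 5 * d ^ (-θ) * x ^ (θ - 1) := by
        have h₁ := rpow_le_rpow_of_nonpos hd hmd (neg_nonpos.2 hθ₀)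
        have h₂ := rpow_le_rpow_of_nonpos hx hmx (by linarith : θ - 1 ≤ 0)
        gcongr

theorem edgeWeight_div_max_le (hγ'₀ : 0 ≤ γ') (hγ'₁ : γ' ≤ 1) (hs : s ∈ Ioo a b)
    (hsab : s - a ≤ b - s) {r : ℝ} (hr : r ∈ Ioo a b) :
    edgeWeight a b γ δ r / max (edgeDist a b s / 4) |r - s| ≤
      5 * (s - a) ^ (-γ') * edgeWeight a b (γ + 1 - γ') δ r := by
  have hra : 0 < r - a := sub_pos.2 hr.1
  have hd : edgeDist a b s = s - a := min_eq_left hsab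
  have hleft : edgeDist a b s / 4 ≤ max (edgeDist a b s / 4) |r - s| := le_max_left _ _
  have hright : |r - s| ≤ max (edgeDist a b s / 4) |r - s| := le_max_right _ _
  have habs := le_abs_self (r - s)
  rw [hd] at hleft hright ⊢
  have hinv := inv_le_of_le_mul (m := max ((s - a) / 4) |r - s|) (sub_pos.2 hs.1) hra hγ'₀ hγ'₁
    (by linarith [sub_pos.2 hs.1]) (by linarith)
  calc edgeWeight a b γ δ r / max ((s - a) / 4) |r - s|
      ≤ edgeWeight a b γ δ r * (5 * (s - a) ^ (-γ') * (r - a) ^ (γ' - 1)) :=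
        mul_le_mul_of_nonneg_left hinv (edgeWeight_pos hr).le
    _ = 5 * (s - a) ^ (-γ') * edgeWeight a b (γ + 1 - γ') δ r := by
        rw [edgeWeight, edgeWeight, show -(γ + 1 - γ') = -γ + (γ' - 1) by ring, rpow_add hra]
        ring

theorem exists_integral_edgeWeight_div_max_le_left (a b : ℝ) (hγ : γ < γ') (hδ : δ < 1)
    (hγ'₀ : 0 ≤ γ') (hγ'₁ : γ' ≤ 1) : ∃ C, 0 ≤ C ∧ ∀ s ∈ Ioo a b, s - a ≤ b - s →
      ∫ r in Ioo a b, edgeWeight a b γ δ r / max (edgeDist a b s / 4) |r - s| ≤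
        C * (s - a) ^ (-γ') := by
  refine ⟨5 * ∫ r in Ioo a b, edgeWeight a b (γ + 1 - γ') δ r,
    mul_nonneg (by norm_num) (setIntegral_nonneg measurableSet_Ioo fun r hr =>
      (edgeWeight_pos hr).le), fun s hs hsab => ?_⟩
  have hd := edgeDist_pos hs
  calc ∫ r in Ioo a b, edgeWeight a b γ δ r / max (edgeDist a b s / 4) |r - s|
      ≤ ∫ r in Ioo a b, 5 * (s - a) ^ (-γ') * edgeWeight a b (γ + 1 - γ') δ r := by
        refine integral_mono_of_nonneg ?_
          ((integrableOn_edgeWeight (by linarith) hδ).const_mul _) ?_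
        all_goals filter_upwards [ae_restrict_mem measurableSet_Ioo] with r hr
        · exact div_nonneg (edgeWeight_pos hr).le (by positivity)
        · exact edgeWeight_div_max_le hγ'₀ hγ'₁ hs hsab hr
    _ = 5 * (∫ r in Ioo a b, edgeWeight a b (γ + 1 - γ') δ r) * (s - a) ^ (-γ') := by
        rw [integral_const_mul, mul_right_comm]

theorem setIntegral_Ioo_comp_reflect (φ : ℝ → ℝ) :
    ∫ r in Ioo a b, φ (a + b - r) = ∫ r in Ioo a b, φ r := by
  rw [← integral_indicator measurableSet_Ioo, ← integral_indicator measurableSet_Ioo,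
    ← integral_sub_left_eq_self ((Ioo a b).indicator φ) volume (a + b)]
  congr 1 with r
  refine indicator_eq_indicator ?_ rfl
  constructor <;> rintro ⟨h₁, h₂⟩ <;> constructor <;> linarith

theorem exists_integral_edgeWeight_div_max_le_right (a b : ℝ) (hγ : γ < 1) (hδ : δ < δ')
    (hδ'₀ : 0 ≤ δ') (hδ'₁ : δ' ≤ 1) : ∃ C, 0 ≤ C ∧ ∀ s ∈ Ioo a b, b - s ≤ s - a →
      ∫ r in Ioo a b, edgeWeight a b γ δ r / max (edgeDist a b s / 4) |r - s| ≤
        C * (b - s) ^ (-δ') := by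
  obtain ⟨C, hC, h⟩ := exists_integral_edgeWeight_div_max_le_left a b hδ hγ hδ'₀ hδ'₁
  refine ⟨C, hC, fun s hs hsab => ?_⟩
  have hreflect := h (a + b - s) ⟨by linarith [hs.2], by linarith [hs.1]⟩ (by linarith)
  rw [← setIntegral_Ioo_comp_reflect] at hreflect
  simpa only [edgeWeight_reflect, edgeDist_reflect, sub_sub_sub_cancel_left, abs_sub_comm s,
    show a + b - s - a = b - s by ring] using hreflect

theorem exists_integral_edgeWeight_div_max_le (a b : ℝ) (hγ : γ < γ') (hδ : δ < δ')
    (hγ'₀ : 0 ≤ γ') (hδ'₀ : 0 ≤ δ') (hγ'₁ : γ' ≤ 1) (hδ'₁ : δ' ≤ 1) :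
    ∃ C, 0 ≤ C ∧ ∀ s ∈ Ioo a b,
      ∫ r in Ioo a b, edgeWeight a b γ δ r / max (edgeDist a b s / 4) |r - s| ≤
        C * edgeWeight a b γ' δ' s := by
  obtain ⟨C₁, hC₁, h₁⟩ := exists_integral_edgeWeight_div_max_le_left a b hγ (hδ.trans_le hδ'₁)
    hγ'₀ hγ'₁
  obtain ⟨C₂, hC₂, h₂⟩ := exists_integral_edgeWeight_div_max_le_right a b (hγ.trans_le hγ'₁) hδ
    hδ'₀ hδ'₁
  obtain ⟨D₁, hD₁, hw₁⟩ := exists_edgeWeight_le_mul a b (le_refl γ') hδ'₀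
  obtain ⟨D₂, hD₂, hw₂⟩ := exists_edgeWeight_le_mul a b hγ'₀ (le_refl δ')
  refine ⟨C₁ * D₁ + C₂ * D₂, by positivity, fun s hs => ?_⟩
  have hw := (edgeWeight_pos (γ := γ') (δ := δ') hs).le
  have hnn₁ : 0 ≤ C₁ * (D₁ * edgeWeight a b γ' δ' s) := by positivity
  have hnn₂ : 0 ≤ C₂ * (D₂ * edgeWeight a b γ' δ' s) := by positivity
  have hleft : (s - a) ^ (-γ') ≤ D₁ * edgeWeight a b γ' δ' s := by
    simpa only [edgeWeight, neg_zero, rpow_zero, mul_one] using hw₁ s hs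
  have hright : (b - s) ^ (-δ') ≤ D₂ * edgeWeight a b γ' δ' s := by
    simpa only [edgeWeight, neg_zero, rpow_zero, one_mul] using hw₂ s hs
  rcases le_total (s - a) (b - s) with h | h
  · linarith [h₁ s hs h, mul_le_mul_of_nonneg_left hleft hC₁]
  · linarith [h₂ s hs h, mul_le_mul_of_nonneg_left hright hC₂]

theorem WeightedHolder.exists_integral_div_max_le (hf : WeightedHolder a b γ δ f) (hγ : γ < γ')
    (hδ : δ < δ') (hγ'₀ : 0 ≤ γ') (hδ'₀ : 0 ≤ δ') (hγ'₁ : γ' ≤ 1) (hδ'₁ : δ' ≤ 1) :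
    ∃ C, 0 ≤ C ∧ ∀ s ∈ Ioo a b,
      ∫ r in Ioo a b, |f r| / max (edgeDist a b s / 4) |r - s| ≤ C * edgeWeight a b γ' δ' s := by
  obtain ⟨C, hC, h⟩ := exists_integral_edgeWeight_div_max_le a b hγ hδ hγ'₀ hδ'₀ hγ'₁ hδ'₁
  obtain ⟨M, hM, habs⟩ := hf.exists_abs_le
  refine ⟨M * C, by positivity, fun s hs => ?_⟩
  have hd := edgeDist_pos hs
  have hweight : IntegrableOn
      (fun r => edgeWeight a b γ δ r / max (edgeDist a b s / 4) |r - s|) (Ioo a b) := by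
    refine (integrableOn_div_max (s := s) (by positivity : 0 < edgeDist a b s / 4)
      (integrableOn_edgeWeight (hγ.trans_le hγ'₁) (hδ.trans_le hδ'₁))).congr ?_
    filter_upwards [ae_restrict_mem measurableSet_Ioo] with r hr
    rw [abs_of_pos (edgeWeight_pos hr)]
  calc ∫ r in Ioo a b, |f r| / max (edgeDist a b s / 4) |r - s|
      ≤ ∫ r in Ioo a b, M * (edgeWeight a b γ δ r / max (edgeDist a b s / 4) |r - s|) := by
        refine integral_mono_of_nonneg
          (Eventually.of_forall fun r => div_nonneg (abs_nonneg _) (by positivity))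
          (hweight.const_mul M) ?_
        filter_upwards [ae_restrict_mem measurableSet_Ioo] with r hr
        rw [← mul_div_assoc]
        exact div_le_div_of_nonneg_right (habs r hr) (by positivity)
    _ ≤ M * (C * edgeWeight a b γ' δ' s) := by
        rw [integral_const_mul]
        exact mul_le_mul_of_nonneg_left (h s hs) hM
    _ = M * C * edgeWeight a b γ' δ' s := (mul_assoc _ _ _).symm

theorem near_self_eighth (hs : s ∈ Ioo a b) : |s - s| ≤ edgeDist a b s / 8 := by
  have := edgeDist_pos hs
  rw [sub_self, abs_zero]
  positivity

theorem WeightedHolderWith.holderAt (hf : WeightedHolderWith a b γ δ M μ f) (hs : s ∈ Ioo a b)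
    (ht : |t - s| ≤ edgeDist a b s / 8) : HolderAt a b f t (edgeDist a b s / 4)
      (M * edgeWeight a b γ δ s * edgeDist a b s ^ (-μ)) μ := by
  have hd := edgeDist_pos hs
  have hw := (edgeWeight_pos (γ := γ) (δ := δ) hs).le
  have hM := hf.nonneg
  have hdl := edgeDist_le_left (a := a) (b := b) (s := s)
  have hdr := edgeDist_le_right (a := a) (b := b) (s := s)
  have ht' := _root_.abs_le.1 ht
  refine ⟨by positivity, by positivity, hf.exponent_pos, by linarith, by linarith, fun r hr => ?_⟩
  have hrs : |r - s| ≤ edgeDist a b s / 2 := (_root_.abs_sub_le r t s).trans (by linarith)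
  refine (hf.abs_sub_le s hs r t hrs (by linarith)).trans_eq ?_
  rw [div_rpow (abs_nonneg _) hd.le, rpow_neg hd.le]
  ring

theorem WeightedHolder.exists_holderAt (hf : WeightedHolder a b γ δ f) (hs : s ∈ Ioo a b) :
    ∃ A μ, HolderAt a b f s (edgeDist a b s / 4) A μ := by
  obtain ⟨M, μ, hf⟩ := hf
  exact ⟨_, μ, hf.holderAt hs (near_self_eighth hs)⟩

theorem rpow_neg_mul_integral_nearBound_le {d : ℝ} (hd : 0 < d) (hμ : 0 < μ) :
    d ^ (-μ) * (2 * ((d / 4) ^ μ / μ)) ≤ 2 / μ := by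
  have hle : (d / 4) ^ μ ≤ d ^ μ := rpow_le_rpow (by positivity) (by linarith) hμ.le
  have := rpow_pos_of_pos hd μ
  rw [rpow_neg hd.le]
  calc (d ^ μ)⁻¹ * (2 * ((d / 4) ^ μ / μ)) ≤ (d ^ μ)⁻¹ * (2 * (d ^ μ / μ)) := by gcongr
    _ = 2 / μ := by field_simp

theorem WeightedHolder.exists_integral_abs_pvIntegrand_le (hf : WeightedHolder a b γ δ f)
    (hγ : γ < γ') (hδ : δ < δ') (hγ'₀ : 0 ≤ γ') (hδ'₀ : 0 ≤ δ') (hγ'₁ : γ' ≤ 1) (hδ'₁ : δ' ≤ 1) :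
    ∃ C, 0 ≤ C ∧ ∀ s ∈ Ioo a b,
      ∫ r in Ioo a b, |pvIntegrand f (edgeDist a b s / 4) s r| ≤ C * edgeWeight a b γ' δ' s := by
  have hint := hf.integrableOn (hγ.trans_le hγ'₁) (hδ.trans_le hδ'₁)
  obtain ⟨C, hC, hfar⟩ := hf.exists_integral_div_max_le hγ hδ hγ'₀ hδ'₀ hγ'₁ hδ'₁
  obtain ⟨C', hC', hw⟩ := exists_edgeWeight_le_mul a b hγ.le hδ.le
  obtain ⟨M, μ, hf⟩ := hf
  have hM := hf.nonneg
  have hμ := hf.exponent_pos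
  refine ⟨M * C' * (2 / μ) + C, by positivity, fun s hs => ?_⟩
  have hd := edgeDist_pos hs
  have hws := (edgeWeight_pos (γ := γ) (δ := δ) hs).le
  refine ((hf.holderAt hs (near_self_eighth hs)).integral_abs_pvIntegrand_le hint).trans ?_
  rw [add_mul]
  refine add_le_add ?_ (hfar s hs)
  calc M * edgeWeight a b γ δ s * edgeDist a b s ^ (-μ) * (2 * ((edgeDist a b s / 4) ^ μ / μ))
      ≤ M * (C' * edgeWeight a b γ' δ' s) * (2 / μ) := by
        rw [mul_assoc]
        exact mul_le_mul (mul_le_mul_of_nonneg_left (hw s hs) hM)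
          (rpow_neg_mul_integral_nearBound_le hd hμ) (by positivity)
          (mul_nonneg hM (hws.trans (hw s hs)))
    _ = M * C' * (2 / μ) * edgeWeight a b γ' δ' s := by ring

theorem WeightedHolder.hilbertExists (hf : WeightedHolder a b γ δ f) (hγ : γ < 1) (hδ : δ < 1)
    (hs : s ∈ Ioo a b) : HilbertExists a b f s := by
  obtain ⟨A, μ, h⟩ := hf.exists_holderAt hs
  exact h.hilbertExists (hf.integrableOn hγ hδ)

theorem WeightedHolder.exists_abs_truncHilbert_le (hf : WeightedHolder a b γ δ f) (hγ : γ < γ')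
    (hδ : δ < δ') (hγ'₀ : 0 ≤ γ') (hδ'₀ : 0 ≤ δ') (hγ'₁ : γ' ≤ 1) (hδ'₁ : δ' ≤ 1) :
    ∃ C, 0 ≤ C ∧ ∀ s ∈ Ioo a b, ∀ ε, 0 < ε →
      |truncHilbert a b f s ε| ≤ C * edgeWeight a b γ' δ' s := by
  obtain ⟨C, hC, h⟩ := hf.exists_integral_abs_pvIntegrand_le hγ hδ hγ'₀ hδ'₀ hγ'₁ hδ'₁
  refine ⟨C, hC, fun s hs ε hε => ?_⟩
  obtain ⟨A, μ, hA⟩ := hf.exists_holderAt hs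
  exact (hA.abs_truncHilbert_le
    (hf.integrableOn (hγ.trans_le hγ'₁) (hδ.trans_le hδ'₁)) hε).trans (h s hs)

theorem WeightedHolder.exists_abs_hilbert_le (hf : WeightedHolder a b γ δ f) (hγ : γ < γ')
    (hδ : δ < δ') (hγ'₀ : 0 ≤ γ') (hδ'₀ : 0 ≤ δ') (hγ'₁ : γ' ≤ 1) (hδ'₁ : δ' ≤ 1) :
    ∃ C, 0 ≤ C ∧ ∀ s ∈ Ioo a b, |hilbert a b f s| ≤ C * edgeWeight a b γ' δ' s := by
  obtain ⟨C, hC, h⟩ := hf.exists_abs_truncHilbert_le hγ hδ hγ'₀ hδ'₀ hγ'₁ hδ'₁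
  refine ⟨C, hC, fun s hs => le_of_tendsto
    (hf.hilbertExists (hγ.trans_le hγ'₁) (hδ.trans_le hδ'₁) hs).tendsto.abs ?_⟩
  filter_upwards [self_mem_nhdsWithin] with ε hε using h s hs ε hε

end FarBound

section HilbertHolder

variable {a b γ δ γ' δ' s t D A M μ : ℝ} {f : ℝ → ℝ}

theorem HolderAt.near_eq_zero (h : HolderAt a b f s D A μ) {r : ℝ} (hr : r ∉ Ioo a b) :
    (f r - f s) * (cutoff D (r - s) / (r - s)) = 0 := by
  rw [cutoff_eq_zero h.pos (le_of_not_ge fun hr' => hr (h.mem_Ioo hr')), zero_div, mul_zero]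

theorem HolderAt.integrable_near_shift (h : HolderAt a b f s D A μ)
    (hf : IntegrableOn f (Ioo a b)) :
    Integrable (fun u => (f (s + u) - f s) * (cutoff D u / u)) := by
  have hnear : Integrable (fun r => (f r - f s) * (cutoff D (r - s) / (r - s))) :=
    (integrableOn_iff_integrable_of_support_subset fun r hr =>
      by_contra fun hr' => hr (h.near_eq_zero hr')).1 (h.integrableOn_near hf)
  simpa using hnear.comp_add_left s

theorem HolderAt.hilbert_eq_near_add_far (h : HolderAt a b f s D A μ)
    (hf : IntegrableOn f (Ioo a b)) : hilbert a b f s = (1 / π) *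
      ((∫ u, (f (s + u) - f s) * (cutoff D u / u)) +
        ∫ r in Ioo a b, f r * farKernel D (r - s)) := by
  rw [h.hilbert_eq hf]
  simp only [pvIntegrand_eq h.pos]
  rw [integral_add (h.integrableOn_near hf) (integrableOn_far h.pos hf),
    setIntegral_eq_integral_of_forall_compl_eq_zero fun r hr => h.near_eq_zero hr,
    ← integral_add_left_eq_self _ s]
  simp only [add_sub_cancel_left]

theorem min_rpow_le {x y ν : ℝ} (hx : 0 ≤ x) (hy : 0 ≤ y) (hν : 0 < ν) :
    min (x ^ ν) (y ^ ν) ≤ y ^ (ν / 2) * x ^ (ν / 2) := by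
  have hsq : ∀ z : ℝ, 0 ≤ z → z ^ ν = z ^ (ν / 2) * z ^ (ν / 2) := fun z hz => by
    rw [← rpow_add_of_nonneg hz (by linarith) (by linarith), add_halves]
  rcases le_total x y with hxy | hxy
  · refine (min_le_left _ _).trans ?_
    rw [hsq x hx]
    gcongr
  · refine (min_le_right _ _).trans ?_
    rw [hsq y hy]
    gcongr

/- The second difference is at most a multiple of both `|u|^μ` and `|t - s|^μ`, hence of their
geometric mean, which leaves a factor `|u|^{μ/2}` to make `1 / u` integrable. -/
theorem WeightedHolderWith.abs_second_difference_le (hf : WeightedHolderWith a b γ δ M μ f)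
    (hs : s ∈ Ioo a b) (ht : |t - s| ≤ edgeDist a b s / 8) {u : ℝ}
    (hu : |u| ≤ edgeDist a b s / 4) :
    |f (t + u) - f t - (f (s + u) - f s)| ≤ 2 * (M * edgeWeight a b γ δ s) *
      ((|t - s| / edgeDist a b s) ^ (μ / 2) * (|u| / edgeDist a b s) ^ (μ / 2)) := by
  have hd := edgeDist_pos hs
  have hw := (edgeWeight_pos (γ := γ) (δ := δ) hs).le
  have hM := hf.nonneg
  have hnear_su : |s + u - s| ≤ edgeDist a b s / 2 := by rw [add_sub_cancel_left]; linarith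
  have hnear_tu : |t + u - s| ≤ edgeDist a b s / 2 := by
    rw [add_sub_right_comm]
    exact (abs_add_le _ _).trans (by linarith)
  have hnear_t : |t - s| ≤ edgeDist a b s / 2 := by linarith
  have ht_tu := hf.abs_sub_le s hs _ _ hnear_tu hnear_t
  have hs_su := hf.abs_sub_le s hs _ _ hnear_su (near_self hs)
  have hsu_tu := hf.abs_sub_le s hs _ _ hnear_tu hnear_su
  have hs_t := hf.abs_sub_le s hs _ _ hnear_t (near_self hs)
  rw [add_sub_cancel_left] at ht_tu hs_su
  rw [add_sub_add_right_eq_sub] at hsu_tu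
  have hle_u : |f (t + u) - f t - (f (s + u) - f s)| ≤
      2 * (M * edgeWeight a b γ δ s) * (|u| / edgeDist a b s) ^ μ :=
    (abs_sub _ _).trans (by linarith)
  have hle_t : |f (t + u) - f t - (f (s + u) - f s)| ≤
      2 * (M * edgeWeight a b γ δ s) * (|t - s| / edgeDist a b s) ^ μ := by
    rw [sub_sub_sub_comm]
    exact (abs_sub _ _).trans (by linarith)
  refine (le_min hle_u hle_t).trans ?_
  rw [← mul_min_of_nonneg _ _ (by positivity)]
  exact mul_le_mul_of_nonneg_left (min_rpow_le (by positivity) (by positivity) hf.exponent_pos)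
    (by positivity)

theorem WeightedHolderWith.abs_near_sub_le (hf : WeightedHolderWith a b γ δ M μ f)
    (hs : s ∈ Ioo a b) (ht : |t - s| ≤ edgeDist a b s / 8) (u : ℝ) :
    |(f (t + u) - f t) * (cutoff (edgeDist a b s / 4) u / u) -
        (f (s + u) - f s) * (cutoff (edgeDist a b s / 4) u / u)| ≤
      2 * (M * edgeWeight a b γ δ s) * (|t - s| / edgeDist a b s) ^ (μ / 2) *
        edgeDist a b s ^ (-(μ / 2)) * nearBound (edgeDist a b s / 4) (μ / 2) u := by
  have hd := edgeDist_pos hs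
  have hw := (edgeWeight_pos (γ := γ) (δ := δ) hs).le
  have hM := hf.nonneg
  have hbound := nearBound_nonneg (D := edgeDist a b s / 4) (μ := μ / 2) u
  rcases le_or_gt (edgeDist a b s / 4) |u| with hu | hu
  · rw [cutoff_eq_zero (by positivity) hu, zero_div, mul_zero, mul_zero, sub_zero, abs_zero]
    positivity
  rcases eq_or_ne u 0 with rfl | hu₀
  · rw [div_zero, mul_zero, mul_zero, sub_zero, abs_zero]
    positivity
  have hu_pos : 0 < |u| := abs_pos.2 hu₀
  have hkernel : |cutoff (edgeDist a b s / 4) u / u| ≤ 1 / |u| := by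
    rw [abs_div]
    gcongr
    exact abs_cutoff_le_one u
  rw [← sub_mul, abs_mul]
  calc |f (t + u) - f t - (f (s + u) - f s)| * |cutoff (edgeDist a b s / 4) u / u|
      ≤ 2 * (M * edgeWeight a b γ δ s) * ((|t - s| / edgeDist a b s) ^ (μ / 2) *
          (|u| / edgeDist a b s) ^ (μ / 2)) * (1 / |u|) :=
        mul_le_mul (hf.abs_second_difference_le hs ht hu.le) hkernel (abs_nonneg _) (by positivity)
    _ = 2 * (M * edgeWeight a b γ δ s) * (|t - s| / edgeDist a b s) ^ (μ / 2) *
          edgeDist a b s ^ (-(μ / 2)) * nearBound (edgeDist a b s / 4) (μ / 2) u := by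
        rw [nearBound, indicator_of_mem (mem_Iic.2 hu.le), rpow_sub_one hu_pos.ne',
          div_rpow (abs_nonneg u) hd.le, rpow_neg hd.le]
        ring

theorem WeightedHolderWith.abs_integral_near_sub_le (hf : WeightedHolderWith a b γ δ M μ f)
    (hint : IntegrableOn f (Ioo a b)) (hs : s ∈ Ioo a b) (ht : |t - s| ≤ edgeDist a b s / 8) :
    |(∫ u, (f (t + u) - f t) * (cutoff (edgeDist a b s / 4) u / u)) -
        ∫ u, (f (s + u) - f s) * (cutoff (edgeDist a b s / 4) u / u)| ≤
      2 * (M * edgeWeight a b γ δ s) * (|t - s| / edgeDist a b s) ^ (μ / 2) * (2 / (μ / 2)) := by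
  have hd := edgeDist_pos hs
  have hw := (edgeWeight_pos (γ := γ) (δ := δ) hs).le
  have hM := hf.nonneg
  have hμ := half_pos hf.exponent_pos
  have hD : 0 < edgeDist a b s / 4 := by positivity
  rw [← integral_sub ((hf.holderAt hs ht).integrable_near_shift hint)
    ((hf.holderAt hs (near_self_eighth hs)).integrable_near_shift hint)]
  refine (norm_integral_le_of_norm_le ((integrable_nearBound hD hμ).const_mul _)
    (Eventually.of_forall fun u => (norm_eq_abs _).trans_le (hf.abs_near_sub_le hs ht u))).trans ?_
  rw [integral_const_mul, integral_nearBound hD hμ, mul_assoc _ (edgeDist a b s ^ _)]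
  exact mul_le_mul_of_nonneg_left (rpow_neg_mul_integral_nearBound_le hd hμ) (by positivity)

theorem abs_integral_far_sub_le (hD : 0 < D) (hf : IntegrableOn f (Ioo a b)) :
    |(∫ r in Ioo a b, f r * farKernel D (r - t)) - ∫ r in Ioo a b, f r * farKernel D (r - s)| ≤
      3 * |t - s| / D * ∫ r in Ioo a b, |f r| / max D |r - s| := by
  rw [← integral_sub (integrableOn_far hD hf) (integrableOn_far hD hf), ← integral_const_mul,
    ← norm_eq_abs]
  refine norm_integral_le_of_norm_le ((integrableOn_div_max hD hf).const_mul _)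
    (Eventually.of_forall fun r => ?_)
  have hkernel := abs_farKernel_sub_le hD (r - s) (r - t)
  rw [sub_sub_sub_cancel_left] at hkernel
  have : 0 < max D |r - s| := lt_max_of_lt_left hD
  rw [← mul_sub, norm_mul, norm_eq_abs, norm_eq_abs, abs_sub_comm (farKernel D (r - t))]
  calc |f r| * |farKernel D (r - s) - farKernel D (r - t)|
      ≤ |f r| * (3 * |t - s| / (D * max D |r - s|)) :=
        mul_le_mul_of_nonneg_left hkernel (abs_nonneg _)
    _ = 3 * |t - s| / D * (|f r| / max D |r - s|) := by field_simp

theorem WeightedHolderWith.abs_hilbert_sub_le (hf : WeightedHolderWith a b γ δ M μ f)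
    (hint : IntegrableOn f (Ioo a b)) (hs : s ∈ Ioo a b) (ht : |t - s| ≤ edgeDist a b s / 8) :
    |hilbert a b f t - hilbert a b f s| ≤
      (8 / μ * (M * edgeWeight a b γ δ s) +
          12 * ∫ r in Ioo a b, |f r| / max (edgeDist a b s / 4) |r - s|) *
        (|t - s| / edgeDist a b s) ^ (μ / 2) := by
  have hd := edgeDist_pos hs
  have := hf.exponent_pos
  have hpi : 1 / π ≤ 1 := (div_le_one pi_pos).2 (by linarith [pi_gt_three])
  have hratio : |t - s| / edgeDist a b s ≤ (|t - s| / edgeDist a b s) ^ (μ / 2) :=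
    self_le_rpow_of_le_one (by positivity) ((div_le_one hd).2 (by linarith))
      (by linarith [hf.exponent_le_one])
  have hnear := hf.abs_integral_near_sub_le hint hs ht
  have hfar := abs_integral_far_sub_le (s := s) (t := t) (by positivity : 0 < edgeDist a b s / 4)
    hint
  have hI : 0 ≤ ∫ r in Ioo a b, |f r| / max (edgeDist a b s / 4) |r - s| :=
    integral_nonneg fun r => by positivity
  rw [(hf.holderAt hs ht).hilbert_eq_near_add_far hint,
    (hf.holderAt hs (near_self_eighth hs)).hilbert_eq_near_add_far hint, ← mul_sub,
    add_sub_add_comm, abs_mul, abs_of_pos (by positivity : 0 < 1 / π)]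
  set I := ∫ r in Ioo a b, |f r| / max (edgeDist a b s / 4) |r - s|
  set R := (|t - s| / edgeDist a b s) ^ (μ / 2)
  refine (mul_le_of_le_one_left (abs_nonneg _) hpi).trans ((abs_add_le _ _).trans ?_)
  calc _ ≤ 2 * (M * edgeWeight a b γ δ s) * R * (2 / (μ / 2)) +
        3 * |t - s| / (edgeDist a b s / 4) * I := add_le_add hnear hfar
    _ = 8 / μ * (M * edgeWeight a b γ δ s) * R + 12 * (|t - s| / edgeDist a b s) * I := by ring
    _ ≤ 8 / μ * (M * edgeWeight a b γ δ s) * R + 12 * R * I := by gcongr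
    _ = (8 / μ * (M * edgeWeight a b γ δ s) + 12 * I) * R := by ring

theorem WeightedHolder.hilbertTransform (hf : WeightedHolder a b γ δ f) (hγ : γ < γ') (hδ : δ < δ')
    (hγ'₀ : 0 ≤ γ') (hδ'₀ : 0 ≤ δ') (hγ'₁ : γ' ≤ 1) (hδ'₁ : δ' ≤ 1) :
    WeightedHolder a b γ' δ' (hilbert a b f) := by
  have hint := hf.integrableOn (hγ.trans_le hγ'₁) (hδ.trans_le hδ'₁)
  obtain ⟨C, hC, habs⟩ := hf.exists_abs_hilbert_le hγ hδ hγ'₀ hδ'₀ hγ'₁ hδ'₁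
  obtain ⟨C₁, hC₁, hfar⟩ := hf.exists_integral_div_max_le hγ hδ hγ'₀ hδ'₀ hγ'₁ hδ'₁
  obtain ⟨C₂, hC₂, hw⟩ := exists_edgeWeight_le_mul a b hγ.le hδ.le
  obtain ⟨M, μ, hf⟩ := hf
  have hM := hf.nonneg
  have hμ := hf.exponent_pos
  refine WeightedHolder.of_local (M := C + (8 / μ * (M * C₂) + 12 * C₁)) (μ := μ / 2)
    (by positivity) (by positivity) (by linarith [hf.exponent_le_one])
    (fun s hs => ?_) (fun s hs t _ hst => ?_)
  all_goals have hws := (edgeWeight_pos (γ := γ') (δ := δ') hs).le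
  · have : 0 ≤ (8 / μ * (M * C₂) + 12 * C₁) * edgeWeight a b γ' δ' s := by positivity
    linarith [habs s hs]
  · have hR : 0 ≤ (|t - s| / edgeDist a b s) ^ (μ / 2) := rpow_nonneg (ratio_nonneg hs) _
    refine (hf.abs_hilbert_sub_le hint hs hst).trans (mul_le_mul_of_nonneg_right ?_ hR)
    calc 8 / μ * (M * edgeWeight a b γ δ s) +
          12 * ∫ r in Ioo a b, |f r| / max (edgeDist a b s / 4) |r - s|
        ≤ 8 / μ * (M * (C₂ * edgeWeight a b γ' δ' s)) + 12 * (C₁ * edgeWeight a b γ' δ' s) := by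
          gcongr
          exacts [hw s hs, hfar s hs]
      _ = (8 / μ * (M * C₂) + 12 * C₁) * edgeWeight a b γ' δ' s := by ring
      _ ≤ (C + (8 / μ * (M * C₂) + 12 * C₁)) * edgeWeight a b γ' δ' s := by
          exact mul_le_mul_of_nonneg_right (le_add_of_nonneg_left hC) hws

end HilbertHolder

/-! ### The Cauchy transform -/

/-- The Cauchy transform `(1/π) ∫_a^b f(r) / (r - z) dr`, whose boundary values on `(a, b)` from
the upper half-plane are `H[f] + i f`. -/
def cauchyTransform (a b : ℝ) (f : ℝ → ℝ) (z : ℂ) : ℂ :=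
  (1 / (π : ℂ)) * ∫ r in Ioo a b, (f r : ℂ) / ((r : ℂ) - z)

section Plemelj

variable {a b γ δ s D A μ ε : ℝ} {f : ℝ → ℝ}

theorem abs_mul_div_sq_add_sq_le (hε : 0 < ε) (u : ℝ) : |u * ε / (u ^ 2 + ε ^ 2)| ≤ 1 := by
  have hpos : 0 < u ^ 2 + ε ^ 2 := by positivity
  rw [abs_div, abs_of_pos hpos, div_le_one hpos, abs_mul, abs_of_pos hε]
  nlinarith [two_mul_le_add_sq |u| ε, sq_abs u, abs_nonneg u]

theorem abs_div_sq_add_sq_le (hε : 0 < ε) (u : ℝ) : |u / (u ^ 2 + ε ^ 2)| ≤ 1 / ε := by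
  have h := abs_mul_div_sq_add_sq_le hε u
  rwa [mul_div_right_comm, abs_mul, abs_of_pos hε, ← le_div_iff₀ hε] at h

theorem abs_const_div_sq_add_sq_le (hε : 0 < ε) (u : ℝ) : |ε / (u ^ 2 + ε ^ 2)| ≤ 1 / ε := by
  have hpos : 0 < u ^ 2 + ε ^ 2 := by positivity
  rw [abs_div, abs_of_pos hpos, abs_of_pos hε, div_le_div_iff₀ hpos hε]
  nlinarith [sq_nonneg u]

theorem continuous_div_sq_add_sq {φ : ℝ → ℝ} (hφ : Continuous φ) (hε : 0 < ε) :
    Continuous fun u => φ u / (u ^ 2 + ε ^ 2) :=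
  hφ.div (by fun_prop) fun u => by positivity

theorem integrableOn_mul_conjugatePoisson (hf : IntegrableOn f (Ioo a b)) (hε : 0 < ε) :
    IntegrableOn (fun r => f r * ((r - s) / ((r - s) ^ 2 + ε ^ 2))) (Ioo a b) :=
  Integrable.mul_bdd (c := 1 / ε) hf
    ((continuous_div_sq_add_sq continuous_id hε).comp
      (continuous_id.sub continuous_const)).aestronglyMeasurable
    (Eventually.of_forall fun r => abs_div_sq_add_sq_le hε (r - s))

theorem integrableOn_mul_poisson (hf : IntegrableOn f (Ioo a b)) (hε : 0 < ε) :
    IntegrableOn (fun r => f r * (ε / ((r - s) ^ 2 + ε ^ 2))) (Ioo a b) :=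
  Integrable.mul_bdd (c := 1 / ε) hf
    ((continuous_div_sq_add_sq continuous_const hε).comp
      (continuous_id.sub continuous_const)).aestronglyMeasurable
    (Eventually.of_forall fun r => abs_const_div_sq_add_sq_le hε (r - s))

theorem cauchyTransform_eq (hf : IntegrableOn f (Ioo a b)) (hε : 0 < ε) :
    cauchyTransform a b f (s + ε * Complex.I) = (1 / (π : ℂ)) *
      (((∫ r in Ioo a b, f r * ((r - s) / ((r - s) ^ 2 + ε ^ 2)) : ℝ) : ℂ) +
        ((∫ r in Ioo a b, f r * (ε / ((r - s) ^ 2 + ε ^ 2)) : ℝ) : ℂ) * Complex.I) := by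
  rw [cauchyTransform, ← integral_complex_ofReal, ← integral_complex_ofReal,
    ← integral_mul_const, ← integral_add (integrableOn_mul_conjugatePoisson hf hε).ofReal
      ((integrableOn_mul_poisson hf hε).ofReal.mul_const _)]
  congr 2 with r
  have hsub : (r : ℂ) - (s + ε * Complex.I) ≠ 0 := fun h => by
    simpa [hε.ne'] using congrArg Complex.im h
  have hnorm : ((r : ℂ) - s) ^ 2 + ε ^ 2 ≠ 0 := by
    exact_mod_cast (by positivity : 0 < (r - s) ^ 2 + ε ^ 2).ne'
  push_cast
  field_simp
  linear_combination (f r * ε ^ 2 : ℂ) * Complex.I_sq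

theorem HolderAt.integral_mul_conjugatePoisson (h : HolderAt a b f s D A μ)
    (hf : IntegrableOn f (Ioo a b)) (hε : 0 < ε) :
    ∫ r in Ioo a b, f r * ((r - s) / ((r - s) ^ 2 + ε ^ 2)) =
      ∫ r in Ioo a b, pvIntegrand f D s r * ((r - s) ^ 2 / ((r - s) ^ 2 + ε ^ 2)) := by
  have hkernel : ∀ u : ℝ, u ^ 2 / (u ^ 2 + ε ^ 2) / u = u / (u ^ 2 + ε ^ 2) := fun u => by
    rcases eq_or_ne u 0 with rfl | hu
    · simp
    · field_simp
  have heven := h.integral_mul_even hf (m := fun u => u ^ 2 / (u ^ 2 + ε ^ 2)) (by simp)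
    (continuous_div_sq_add_sq (by fun_prop) hε).measurable
    (fun u => by
      rw [abs_of_nonneg (by positivity)]
      exact div_le_one_of_le₀ (by linarith [sq_nonneg ε]) (by positivity))
    (by simpa only [hkernel] using integrableOn_mul_conjugatePoisson hf hε)
  simpa only [hkernel] using heven

theorem HolderAt.tendsto_conjugatePoisson (h : HolderAt a b f s D A μ)
    (hf : IntegrableOn f (Ioo a b)) :
    Tendsto (fun ε => ∫ r in Ioo a b, f r * ((r - s) / ((r - s) ^ 2 + ε ^ 2))) (𝓝[>] 0)
      (𝓝 (∫ r in Ioo a b, pvIntegrand f D s r)) := by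
  have hlim := h.tendsto_integral_pvIntegrand_mul hf (m := fun ε u => u ^ 2 / (u ^ 2 + ε ^ 2))
    (c := 1) (fun ε hε => (continuous_div_sq_add_sq (by fun_prop) hε).measurable)
    (fun ε _ u => by
      rw [abs_of_nonneg (by positivity)]
      exact div_le_one_of_le₀ (by linarith [sq_nonneg ε]) (by positivity))
    (fun u hu => by
      have hcont : ContinuousAt (fun ε : ℝ => u ^ 2 / (u ^ 2 + ε ^ 2)) 0 :=
        ContinuousAt.div (by fun_prop) (by fun_prop) (by positivity)
      simpa [hu] using hcont.tendsto.mono_left nhdsWithin_le_nhds)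
  simp only [mul_one] at hlim
  refine hlim.congr' ?_
  filter_upwards [self_mem_nhdsWithin] with ε hε
  exact (h.integral_mul_conjugatePoisson hf hε).symm

theorem integral_cutoff_mul_poisson (hε : 0 < ε) :
    ∫ u, cutoff D u * (ε / (u ^ 2 + ε ^ 2)) = ∫ v, cutoff D (ε * v) * (1 + v ^ 2)⁻¹ := by
  have hsubst := Measure.integral_comp_mul_left (fun u => cutoff D u * (ε / (u ^ 2 + ε ^ 2))) ε
  rw [abs_of_pos (inv_pos.2 hε), smul_eq_mul, eq_inv_mul_iff_mul_eq₀ hε.ne'] at hsubst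
  rw [← hsubst, ← integral_const_mul]
  congr 1 with v
  have hv : 1 + v ^ 2 ≠ 0 := by positivity
  have : (ε * v) ^ 2 + ε ^ 2 ≠ 0 := by positivity
  field_simp
  ring

theorem tendsto_integral_cutoff_mul_poisson :
    Tendsto (fun ε : ℝ => ∫ u, cutoff D u * (ε / (u ^ 2 + ε ^ 2))) (𝓝[>] 0) (𝓝 π) := by
  have hlim : Tendsto (fun ε : ℝ => ∫ v : ℝ, cutoff D (ε * v) * (1 + v ^ 2)⁻¹) (𝓝[>] 0)
      (𝓝 (∫ v : ℝ, (1 + v ^ 2)⁻¹)) := by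
    refine tendsto_integral_filter_of_dominated_convergence (fun v => (1 + v ^ 2)⁻¹)
      (Eventually.of_forall fun ε => ?_) (Eventually.of_forall fun ε => Eventually.of_forall
        fun v => ?_) integrable_inv_one_add_sq (Eventually.of_forall fun v => ?_)
    · exact ((continuous_cutoff.comp (by fun_prop)).aestronglyMeasurable).mul
        integrable_inv_one_add_sq.1
    · rw [norm_mul, norm_of_nonneg (by positivity : (0 : ℝ) ≤ (1 + v ^ 2)⁻¹)]
      exact mul_le_of_le_one_left (by positivity) (abs_cutoff_le_one _)
    · have hcont : Continuous fun ε : ℝ => cutoff D (ε * v) * (1 + v ^ 2)⁻¹ :=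
        (continuous_cutoff.comp (by fun_prop)).mul continuous_const
      simpa [cutoff_zero] using (hcont.tendsto 0).mono_left nhdsWithin_le_nhds
  rw [integral_univ_inv_one_add_sq] at hlim
  refine hlim.congr' ?_
  filter_upwards [self_mem_nhdsWithin] with ε hε using (integral_cutoff_mul_poisson hε).symm

theorem HolderAt.integral_mul_poisson (h : HolderAt a b f s D A μ)
    (hf : IntegrableOn f (Ioo a b)) (hε : 0 < ε) :
    ∫ r in Ioo a b, f r * (ε / ((r - s) ^ 2 + ε ^ 2)) =
      (∫ r in Ioo a b, pvIntegrand f D s r * ((r - s) * ε / ((r - s) ^ 2 + ε ^ 2))) +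
        f s * ∫ u, cutoff D u * (ε / (u ^ 2 + ε ^ 2)) := by
  have hsplit : ∀ r, f r * (ε / ((r - s) ^ 2 + ε ^ 2)) -
      pvIntegrand f D s r * ((r - s) * ε / ((r - s) ^ 2 + ε ^ 2)) =
      f s * (cutoff D (r - s) * (ε / ((r - s) ^ 2 + ε ^ 2))) := fun r => by
    rcases eq_or_ne r s with rfl | hr
    · simp [cutoff_zero]
    · have := sub_ne_zero.2 hr
      rw [pvIntegrand]
      field_simp
      ring
  have hint : IntegrableOn (fun r => pvIntegrand f D s r *
      ((r - s) * ε / ((r - s) ^ 2 + ε ^ 2))) (Ioo a b) :=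
    (h.integrableOn_pvIntegrand hf).mul_bdd (c := 1)
      ((continuous_div_sq_add_sq (φ := fun u => u * ε) (by fun_prop) hε).comp
        (continuous_id.sub continuous_const)).aestronglyMeasurable
      (Eventually.of_forall fun r => abs_mul_div_sq_add_sq_le hε (r - s))
  rw [← sub_eq_iff_eq_add', ← integral_sub (integrableOn_mul_poisson hf hε) hint]
  simp only [hsplit]
  rw [setIntegral_eq_integral_of_forall_compl_eq_zero fun r hr => ?_, integral_const_mul,
    integral_sub_right_eq_self (fun u => cutoff D u * (ε / (u ^ 2 + ε ^ 2)))]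
  rw [cutoff_eq_zero h.pos (le_of_not_ge fun hr' => hr (h.mem_Ioo hr')), zero_mul, mul_zero]

theorem HolderAt.tendsto_poisson (h : HolderAt a b f s D A μ)
    (hf : IntegrableOn f (Ioo a b)) :
    Tendsto (fun ε => ∫ r in Ioo a b, f r * (ε / ((r - s) ^ 2 + ε ^ 2))) (𝓝[>] 0)
      (𝓝 (π * f s)) := by
  have hlim := h.tendsto_integral_pvIntegrand_mul hf (m := fun ε u => u * ε / (u ^ 2 + ε ^ 2))
    (c := 0) (fun ε hε => (continuous_div_sq_add_sq (by fun_prop) hε).measurable)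
    (fun ε hε => abs_mul_div_sq_add_sq_le hε)
    (fun u hu => by
      have hcont : ContinuousAt (fun ε : ℝ => u * ε / (u ^ 2 + ε ^ 2)) 0 :=
        ContinuousAt.div (by fun_prop) (by fun_prop) (by positivity)
      simpa using hcont.tendsto.mono_left nhdsWithin_le_nhds)
  have hsum := hlim.add ((tendsto_integral_cutoff_mul_poisson (D := D)).const_mul (f s))
  simp only [mul_zero, integral_zero, zero_add] at hsum
  rw [mul_comm π]
  refine hsum.congr' ?_
  filter_upwards [self_mem_nhdsWithin] with ε hε using (h.integral_mul_poisson hf hε).symm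

theorem WeightedHolder.tendsto_cauchyTransform (hf : WeightedHolder a b γ δ f) (hγ : γ < 1)
    (hδ : δ < 1) (hs : s ∈ Ioo a b) :
    Tendsto (fun ε : ℝ => cauchyTransform a b f (s + ε * Complex.I)) (𝓝[>] 0)
      (𝓝 (hilbert a b f s + f s * Complex.I)) := by
  obtain ⟨A, μ, h⟩ := hf.exists_holderAt hs
  have hint := hf.integrableOn hγ hδ
  have hre := (Complex.continuous_ofReal.tendsto _).comp (h.tendsto_conjugatePoisson hint)
  have him := (Complex.continuous_ofReal.tendsto _).comp (h.tendsto_poisson hint)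
  have hlim := (hre.add (him.mul_const Complex.I)).const_mul (1 / (π : ℂ))
  have hvalue : (1 / (π : ℂ)) *
      (((∫ r in Ioo a b, pvIntegrand f (edgeDist a b s / 4) s r : ℝ) : ℂ) +
        ((π * f s : ℝ) : ℂ) * Complex.I) = hilbert a b f s + f s * Complex.I := by
    have : (π : ℂ) ≠ 0 := by exact_mod_cast pi_ne_zero
    rw [h.hilbert_eq hint]
    push_cast
    field_simp
  rw [hvalue] at hlim
  refine hlim.congr' ?_
  filter_upwards [self_mem_nhdsWithin] with ε hε using (cauchyTransform_eq hint hε).symm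

end Plemelj

/-! ### The product formula -/

/-- The truncated Hilbert kernel `u⁻¹` on `{ε < |u|}`. -/
def truncKernel (ε u : ℝ) : ℝ := {u : ℝ | ε < |u|}.indicator (·⁻¹) u

section TruncKernel

variable {a b s ε u : ℝ} {f : ℝ → ℝ}

theorem truncKernel_of_lt (h : ε < |u|) : truncKernel ε u = u⁻¹ :=
  indicator_of_mem (s := {u : ℝ | ε < |u|}) h _

theorem truncKernel_of_not_lt (h : ¬ε < |u|) : truncKernel ε u = 0 :=
  indicator_of_notMem (s := {u : ℝ | ε < |u|}) h _

theorem measurable_truncKernel : Measurable (truncKernel ε) :=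
  measurable_inv.indicator (measurableSet_lt measurable_const (by fun_prop))

theorem truncKernel_neg (ε u : ℝ) : truncKernel ε (-u) = -truncKernel ε u := by
  by_cases h : ε < |u| <;> simp [truncKernel, indicator, h, inv_neg]

theorem abs_truncKernel_le (hε : 0 < ε) (u : ℝ) : |truncKernel ε u| ≤ 1 / ε := by
  by_cases h : ε < |u|
  · rw [truncKernel_of_lt h, abs_inv, ← one_div]
    exact one_div_le_one_div_of_le hε h.le
  · rw [truncKernel_of_not_lt h, abs_zero]
    positivity

theorem integral_mul_truncKernel (f : ℝ → ℝ) (s ε : ℝ) :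
    ∫ r in Ioo a b, f r * truncKernel ε (r - s) = π * truncHilbert a b f s ε := by
  have hkernel : ∀ r, f r * truncKernel ε (r - s) =
      {r | ε < |r - s|}.indicator (fun r => f r / (r - s)) r := fun r => by
    simp [truncKernel, indicator_apply, div_eq_mul_inv]
  simp only [hkernel]
  rw [setIntegral_indicator (measurableSet_lt_abs_sub s ε), truncHilbert, ← mul_assoc,
    mul_one_div_cancel pi_ne_zero, one_mul]
  rfl

theorem integral_ofReal_mul_truncKernel (f : ℝ → ℝ) (s ε : ℝ) :
    ∫ r in Ioo a b, (f r : ℂ) * (truncKernel ε (r - s) : ℂ) = π * truncHilbert a b f s ε := by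
  simp only [← Complex.ofReal_mul]
  rw [integral_complex_ofReal, integral_mul_truncKernel]

end TruncKernel

section ResolventKernel

variable {a b : ℝ} {f : ℝ → ℝ} {z : ℂ}

theorem ofReal_sub_ne_zero (hz : z.im ≠ 0) (r : ℝ) : (r : ℂ) - z ≠ 0 := fun h =>
  hz (by simpa using congrArg Complex.im h)

theorem norm_inv_ofReal_sub_le (hz : z.im ≠ 0) (r : ℝ) : ‖((r : ℂ) - z)⁻¹‖ ≤ 1 / |z.im| := by
  rw [norm_inv, ← one_div]
  refine one_div_le_one_div_of_le (abs_pos.2 hz) ?_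
  simpa using Complex.abs_im_le_norm ((r : ℂ) - z)

theorem integrableOn_div_ofReal_sub (hf : IntegrableOn f (Ioo a b)) (hz : z.im ≠ 0) :
    IntegrableOn (fun r => (f r : ℂ) / ((r : ℂ) - z)) (Ioo a b) := by
  have hcont : Continuous fun r : ℝ => ((r : ℂ) - z)⁻¹ :=
    Continuous.inv₀ (by fun_prop) (ofReal_sub_ne_zero hz)
  simp only [div_eq_mul_inv]
  exact Integrable.mul_bdd (c := 1 / |z.im|) hf.ofReal hcont.aestronglyMeasurable
    (Eventually.of_forall fun r => norm_inv_ofReal_sub_le hz r)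

end ResolventKernel

section TruncatedProduct

variable {a b ε : ℝ} {f g : ℝ → ℝ} {F G : ℝ → ℂ} {z : ℂ}

theorem ae_fst_ne_snd : ∀ᵐ p : ℝ × ℝ
    ∂((volume.restrict (Ioo a b)).prod (volume.restrict (Ioo a b))), p.1 ≠ p.2 := by
  have hdiag : MeasurableSet {p : ℝ × ℝ | p.1 = p.2} :=
    measurableSet_eq_fun measurable_fst measurable_snd
  have hfiber : ∀ x : ℝ, Prod.mk x ⁻¹' {p : ℝ × ℝ | p.1 = p.2} = {x} := fun x => by
    ext y
    simp [eq_comm]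
  have hnull := (Measure.measure_prod_null (μ := volume.restrict (Ioo a b))
    (ν := volume.restrict (Ioo a b)) hdiag).2
    (Eventually.of_forall fun x => by simp only [hfiber, Pi.zero_apply, measure_singleton])
  simpa [ae_iff] using hnull

theorem integrable_prod_mul_truncKernel (hF : IntegrableOn F (Ioo a b))
    (hG : IntegrableOn G (Ioo a b)) (hε : 0 < ε) :
    Integrable (fun p : ℝ × ℝ => F p.1 * G p.2 * (truncKernel ε (p.2 - p.1) : ℂ))
      ((volume.restrict (Ioo a b)).prod (volume.restrict (Ioo a b))) := by
  refine Integrable.mul_bdd (c := 1 / ε) (hF.mul_prod hG) ?_ (Eventually.of_forall fun p => ?_)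
  · exact (Complex.measurable_ofReal.comp
      (measurable_truncKernel.comp (measurable_snd.sub measurable_fst))).aestronglyMeasurable
  · rw [Complex.norm_real]
    exact abs_truncKernel_le hε _

theorem aestronglyMeasurable_truncHilbert (hf : IntegrableOn f (Ioo a b)) (hε : 0 < ε) :
    AEStronglyMeasurable (fun s => (truncHilbert a b f s ε : ℂ)) (volume.restrict (Ioo a b)) := by
  have hmeas := (integrable_prod_mul_truncKernel (a := a) (b := b) (F := fun _ => 1)
    (G := fun r => (f r : ℂ)) (by simp) hf.ofReal hε).integral_prod_left.1
  simp only [one_mul, integral_ofReal_mul_truncKernel] at hmeas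
  have hpi : (π : ℂ) ≠ 0 := by exact_mod_cast pi_ne_zero
  simpa only [inv_mul_cancel_left₀ hpi] using hmeas.const_mul (π : ℂ)⁻¹

theorem integral_prod_mul_truncKernel (hF : IntegrableOn F (Ioo a b))
    (hg : IntegrableOn g (Ioo a b)) (hε : 0 < ε) :
    ∫ p : ℝ × ℝ, F p.1 * (g p.2 : ℂ) * (truncKernel ε (p.2 - p.1) : ℂ)
      ∂((volume.restrict (Ioo a b)).prod (volume.restrict (Ioo a b))) =
      π * ∫ r in Ioo a b, F r * (truncHilbert a b g r ε : ℂ) := by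
  have hg' : IntegrableOn (fun r => (g r : ℂ)) (Ioo a b) := hg.ofReal
  rw [integral_prod _ (integrable_prod_mul_truncKernel hF hg' hε), ← integral_const_mul]
  congr 1 with r
  simp only [mul_assoc]
  rw [integral_const_mul, integral_ofReal_mul_truncKernel]
  ring

-- `1 / ((r - z) (t - r)) - 1 / ((t - z) (t - r)) = 1 / ((r - z) (t - z))`: with the odd kernel
-- `1 / (t - r)` cut off symmetrically, the partial fractions can be integrated separately.
theorem indicator_mul_div_ofReal_sub (f g : ℝ → ℝ) (hz : z.im ≠ 0) (hε : 0 < ε) (r t : ℝ) :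
    {p : ℝ × ℝ | ε < |p.2 - p.1|}.indicator
      (fun p => (f p.1 : ℂ) / ((p.1 : ℂ) - z) * ((g p.2 : ℂ) / ((p.2 : ℂ) - z))) (r, t) =
      (f r : ℂ) / ((r : ℂ) - z) * (g t : ℂ) * (truncKernel ε (t - r) : ℂ) +
        (g t : ℂ) / ((t : ℂ) - z) * (f r : ℂ) * (truncKernel ε (r - t) : ℂ) := by
  rw [← neg_sub t r, truncKernel_neg]
  by_cases h : ε < |t - r|
  · have hr := ofReal_sub_ne_zero hz r
    have ht := ofReal_sub_ne_zero hz t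
    have htr : (t : ℂ) - r ≠ 0 := by exact_mod_cast abs_pos.1 (hε.trans h)
    rw [indicator_of_mem (by exact h), truncKernel_of_lt h]
    push_cast
    field_simp
    ring
  · rw [indicator_of_notMem (by exact h), truncKernel_of_not_lt h]
    simp

theorem integral_prod_indicator_lt_abs (hf : IntegrableOn f (Ioo a b))
    (hg : IntegrableOn g (Ioo a b)) (hz : z.im ≠ 0) (hε : 0 < ε) :
    ∫ p : ℝ × ℝ, {p : ℝ × ℝ | ε < |p.2 - p.1|}.indicator
      (fun p => (f p.1 : ℂ) / ((p.1 : ℂ) - z) * ((g p.2 : ℂ) / ((p.2 : ℂ) - z))) p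
      ∂((volume.restrict (Ioo a b)).prod (volume.restrict (Ioo a b))) =
      π * (∫ r in Ioo a b, (f r : ℂ) / ((r : ℂ) - z) * (truncHilbert a b g r ε : ℂ)) +
        π * ∫ r in Ioo a b, (g r : ℂ) / ((r : ℂ) - z) * (truncHilbert a b f r ε : ℂ) := by
  have hF := integrableOn_div_ofReal_sub hf hz
  have hG := integrableOn_div_ofReal_sub hg hz
  have hf' : IntegrableOn (fun r => (f r : ℂ)) (Ioo a b) := hf.ofReal
  have hg' : IntegrableOn (fun r => (g r : ℂ)) (Ioo a b) := hg.ofReal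
  have hswap := (integrable_prod_mul_truncKernel hG hf' hε).swap
  simp only [Function.comp_def] at hswap
  rw [← integral_prod_mul_truncKernel hF hg hε, ← integral_prod_mul_truncKernel hG hf hε,
    ← integral_prod_swap (fun p : ℝ × ℝ => (g p.1 : ℂ) / ((p.1 : ℂ) - z) * (f p.2 : ℂ) *
      (truncKernel ε (p.2 - p.1) : ℂ)),
    ← integral_add (integrable_prod_mul_truncKernel hF hg' hε) hswap]
  congr 1 with p
  exact indicator_mul_div_ofReal_sub f g hz hε p.1 p.2

theorem tendsto_integral_prod_indicator_lt_abs (hf : IntegrableOn f (Ioo a b))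
    (hg : IntegrableOn g (Ioo a b)) (hz : z.im ≠ 0) :
    Tendsto (fun ε : ℝ => ∫ p : ℝ × ℝ, {p : ℝ × ℝ | ε < |p.2 - p.1|}.indicator
      (fun p => (f p.1 : ℂ) / ((p.1 : ℂ) - z) * ((g p.2 : ℂ) / ((p.2 : ℂ) - z))) p
      ∂((volume.restrict (Ioo a b)).prod (volume.restrict (Ioo a b)))) (𝓝[>] 0)
      (𝓝 ((∫ r in Ioo a b, (f r : ℂ) / ((r : ℂ) - z)) *
        ∫ r in Ioo a b, (g r : ℂ) / ((r : ℂ) - z))) := by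
  have hFG := (integrableOn_div_ofReal_sub hf hz).mul_prod (integrableOn_div_ofReal_sub hg hz)
  rw [← integral_prod_mul]
  refine tendsto_integral_filter_of_dominated_convergence _
    (Eventually.of_forall fun ε => hFG.1.indicator
      (measurableSet_lt measurable_const (by fun_prop)))
    (Eventually.of_forall fun ε => Eventually.of_forall fun r => norm_indicator_le_norm_self _ _)
    hFG.norm ?_
  filter_upwards [ae_fst_ne_snd] with p hp
  refine tendsto_const_nhds.congr' ?_
  filter_upwards [mem_nhdsWithin_of_mem_nhds
    (Iio_mem_nhds (abs_pos.2 (sub_ne_zero.2 hp.symm)))] with ε hε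
  rw [indicator_of_mem (by exact hε)]

end TruncatedProduct

/-- The condition on the orders `γ₁`, `γ₂` of the singularities of `f` and `g` at an endpoint under
which `f H[g]` and `g H[f]` are integrable there. -/
structure CompatibleOrders (γ₁ γ₂ : ℝ) : Prop where
  left_lt_one : γ₁ < 1
  right_lt_one : γ₂ < 1
  add_lt_one : γ₁ + γ₂ < 1

section Product

variable {a b γ₁ δ₁ γ₂ δ₂ s ε : ℝ} {f g : ℝ → ℝ} {z : ℂ}

theorem CompatibleOrders.symm (h : CompatibleOrders γ₁ γ₂) : CompatibleOrders γ₂ γ₁ :=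
  ⟨h.right_lt_one, h.left_lt_one, by linarith [h.add_lt_one]⟩

-- `H` maps singularities of order `γ₂` to singularities of order `γ'`.
theorem CompatibleOrders.exists_between (h : CompatibleOrders γ₁ γ₂) :
    ∃ γ', γ₂ < γ' ∧ 0 ≤ γ' ∧ γ' ≤ 1 ∧ γ₁ + γ' < 1 := by
  obtain ⟨γ', hlower, hupper⟩ := _root_.exists_between
    (max_lt (lt_min h.right_lt_one (by linarith [h.add_lt_one] : γ₂ < 1 - γ₁))
      (lt_min one_pos (sub_pos.2 h.left_lt_one)))
  rw [max_lt_iff] at hlower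
  rw [lt_min_iff] at hupper
  exact ⟨γ', hlower.1, hlower.2.le, hupper.1.le, by linarith⟩

theorem WeightedHolder.exists_mul_hilbert (hf : WeightedHolder a b γ₁ δ₁ f)
    (hg : WeightedHolder a b γ₂ δ₂ g) (hγ : CompatibleOrders γ₁ γ₂)
    (hδ : CompatibleOrders δ₁ δ₂) :
    ∃ γ < 1, ∃ δ < 1, WeightedHolder a b γ δ (fun s => f s * hilbert a b g s) := by
  obtain ⟨γ', hγ', hγ'₀, hγ'₁, hγ_add⟩ := hγ.exists_between
  obtain ⟨δ', hδ', hδ'₀, hδ'₁, hδ_add⟩ := hδ.exists_between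
  exact ⟨_, hγ_add, _, hδ_add, hf.mul (hg.hilbertTransform hγ' hδ' hγ'₀ hδ'₀ hγ'₁ hδ'₁)⟩

theorem WeightedHolder.exists_mul_hilbert_add (hf : WeightedHolder a b γ₁ δ₁ f)
    (hg : WeightedHolder a b γ₂ δ₂ g) (hγ : CompatibleOrders γ₁ γ₂)
    (hδ : CompatibleOrders δ₁ δ₂) :
    ∃ γ < 1, ∃ δ < 1, WeightedHolder a b γ δ
      (fun r => f r * hilbert a b g r + g r * hilbert a b f r) := by
  obtain ⟨γ, hγ₁, δ, hδ₁, hfg⟩ := hf.exists_mul_hilbert hg hγ hδ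
  obtain ⟨γ', hγ'₁, δ', hδ'₁, hgf⟩ := hg.exists_mul_hilbert hf hγ.symm hδ.symm
  exact ⟨max γ γ', max_lt hγ₁ hγ'₁, max δ δ', max_lt hδ₁ hδ'₁,
    (hfg.mono (le_max_left _ _) (le_max_left _ _)).add
      (hgf.mono (le_max_right _ _) (le_max_right _ _))⟩

theorem WeightedHolder.tendsto_integral_truncHilbert (hf : WeightedHolder a b γ₁ δ₁ f)
    (hg : WeightedHolder a b γ₂ δ₂ g) (hγ : CompatibleOrders γ₁ γ₂)
    (hδ : CompatibleOrders δ₁ δ₂) (hz : z.im ≠ 0) :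
    Tendsto (fun ε => ∫ r in Ioo a b, (f r : ℂ) / ((r : ℂ) - z) * (truncHilbert a b g r ε : ℂ))
      (𝓝[>] 0) (𝓝 (∫ r in Ioo a b, ((f r * hilbert a b g r : ℝ) : ℂ) / ((r : ℂ) - z))) := by
  obtain ⟨γ', hγ', hγ'₀, hγ'₁, hγ_add⟩ := hγ.exists_between
  obtain ⟨δ', hδ', hδ'₀, hδ'₁, hδ_add⟩ := hδ.exists_between
  obtain ⟨C, _, htrunc⟩ := hg.exists_abs_truncHilbert_le hγ' hδ' hγ'₀ hδ'₀ hγ'₁ hδ'₁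
  have hf_int := hf.integrableOn hγ.left_lt_one hδ.left_lt_one
  have hg_int := hg.integrableOn hγ.right_lt_one hδ.right_lt_one
  have hbound : IntegrableOn (fun r => |f r * edgeWeight a b γ' δ' r| * (1 / |z.im| * C))
      (Ioo a b) :=
    ((hf.mul (weightedHolder_edgeWeight a b γ' δ')).integrableOn hγ_add hδ_add).abs.mul_const _
  refine tendsto_integral_filter_of_dominated_convergence _ ?_ ?_ hbound ?_
  · filter_upwards [self_mem_nhdsWithin] with ε hε
    exact (integrableOn_div_ofReal_sub hf_int hz).1.mul
      (aestronglyMeasurable_truncHilbert hg_int hε)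
  · filter_upwards [self_mem_nhdsWithin] with ε hε
    filter_upwards [ae_restrict_mem measurableSet_Ioo] with r hr
    rw [norm_mul, div_eq_mul_inv, norm_mul, Complex.norm_real, Complex.norm_real, norm_eq_abs,
      norm_eq_abs, abs_mul, abs_of_pos (edgeWeight_pos hr)]
    calc |f r| * ‖((r : ℂ) - z)⁻¹‖ * |truncHilbert a b g r ε|
        ≤ |f r| * (1 / |z.im|) * (C * edgeWeight a b γ' δ' r) := by
          gcongr
          exacts [norm_inv_ofReal_sub_le hz r, htrunc r hr ε hε]
      _ = |f r| * edgeWeight a b γ' δ' r * (1 / |z.im| * C) := by ring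
  · filter_upwards [ae_restrict_mem measurableSet_Ioo] with r hr
    have hlim := (Complex.continuous_ofReal.tendsto _).comp
      (hg.hilbertExists hγ.right_lt_one hδ.right_lt_one hr).tendsto
    rw [Complex.ofReal_mul, mul_div_right_comm]
    exact hlim.const_mul ((f r : ℂ) / ((r : ℂ) - z))

theorem WeightedHolder.cauchyTransform_mul (hf : WeightedHolder a b γ₁ δ₁ f)
    (hg : WeightedHolder a b γ₂ δ₂ g) (hγ : CompatibleOrders γ₁ γ₂)
    (hδ : CompatibleOrders δ₁ δ₂) (hz : z.im ≠ 0) :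
    cauchyTransform a b f z * cauchyTransform a b g z = cauchyTransform a b
      (fun r => f r * hilbert a b g r + g r * hilbert a b f r) z := by
  have hf_int := hf.integrableOn hγ.left_lt_one hδ.left_lt_one
  have hg_int := hg.integrableOn hγ.right_lt_one hδ.right_lt_one
  have hlim := ((hf.tendsto_integral_truncHilbert hg hγ hδ hz).const_mul (π : ℂ)).add
    ((hg.tendsto_integral_truncHilbert hf hγ.symm hδ.symm hz).const_mul (π : ℂ))
  have hproduct := tendsto_nhds_unique (tendsto_integral_prod_indicator_lt_abs hf_int hg_int hz)
    (hlim.congr' (by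
      filter_upwards [self_mem_nhdsWithin] with ε hε
      exact (integral_prod_indicator_lt_abs hf_int hg_int hz hε).symm))
  obtain ⟨γ, hγ₁, δ, hδ₁, hfg⟩ := hf.exists_mul_hilbert hg hγ hδ
  obtain ⟨γ', hγ'₁, δ', hδ'₁, hgf⟩ := hg.exists_mul_hilbert hf hγ.symm hδ.symm
  have hpi : (π : ℂ) ≠ 0 := by exact_mod_cast pi_ne_zero
  rw [cauchyTransform, cauchyTransform, cauchyTransform, mul_mul_mul_comm, hproduct, ← mul_add,
    ← integral_add (integrableOn_div_ofReal_sub (hfg.integrableOn hγ₁ hδ₁) hz)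
      (integrableOn_div_ofReal_sub (hgf.integrableOn hγ'₁ hδ'₁) hz)]
  simp only [Complex.ofReal_add, add_div]
  field_simp

theorem WeightedHolder.hilbert_mul_hilbert_add (hf : WeightedHolder a b γ₁ δ₁ f)
    (hg : WeightedHolder a b γ₂ δ₂ g) (hγ : CompatibleOrders γ₁ γ₂)
    (hδ : CompatibleOrders δ₁ δ₂) (hs : s ∈ Ioo a b) :
    hilbert a b (fun r => f r * hilbert a b g r + g r * hilbert a b f r) s =
      hilbert a b f s * hilbert a b g s - f s * g s := by
  obtain ⟨γ, hγ₁, δ, hδ₁, hfg⟩ := hf.exists_mul_hilbert_add hg hγ hδ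
  have hproduct := (hf.tendsto_cauchyTransform hγ.left_lt_one hδ.left_lt_one hs).mul
    (hg.tendsto_cauchyTransform hγ.right_lt_one hδ.right_lt_one hs)
  have heq := tendsto_nhds_unique (hfg.tendsto_cauchyTransform hγ₁ hδ₁ hs) (hproduct.congr' (by
    filter_upwards [self_mem_nhdsWithin] with ε hε
    have him : ((s : ℂ) + ε * Complex.I).im ≠ 0 := by simpa using hε.ne'
    exact hf.cauchyTransform_mul hg hγ hδ him))
  simpa using congrArg Complex.re heq

end Product

section Linear

variable {a b s : ℝ} {f g : ℝ → ℝ}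

theorem truncHilbert_congr (h : EqOn f g (Ioo a b)) : truncHilbert a b f = truncHilbert a b g := by
  funext s ε
  have hset : MeasurableSet {r : ℝ | r ∈ Ioo a b ∧ ε < |r - s|} :=
    measurableSet_Ioo.inter (measurableSet_lt_abs_sub s ε)
  rw [truncHilbert, truncHilbert, setIntegral_congr_fun hset]
  intro r hr
  simp only [h hr.1]

theorem hilbert_congr (h : EqOn f g (Ioo a b)) : hilbert a b f = hilbert a b g := by
  funext s
  rw [hilbert, hilbert, truncHilbert_congr h]

theorem HilbertExists.hilbert_add (hf : HilbertExists a b f s) (hg : HilbertExists a b g s) :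
    hilbert a b (fun r => f r + g r) s = hilbert a b f s + hilbert a b g s := by
  refine Tendsto.limUnder_eq ((hf.tendsto.add hg.tendsto).congr' ?_)
  filter_upwards [self_mem_nhdsWithin] with ε hε
  simp only [truncHilbert, add_div]
  rw [integral_add (hf.1 ε hε) (hg.1 ε hε), mul_add]

theorem HilbertExists.hilbert_const_mul (c : ℝ) (hf : HilbertExists a b f s) :
    hilbert a b (fun r => c * f r) s = c * hilbert a b f s := by
  refine Tendsto.limUnder_eq ((hf.tendsto.const_mul c).congr fun ε => ?_)
  simp only [truncHilbert, mul_div_assoc]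
  rw [integral_const_mul]
  ring

theorem HilbertExists.hilbert_neg (hf : HilbertExists a b f s) :
    hilbert a b (fun r => -f r) s = -hilbert a b f s := by
  simpa only [neg_one_mul] using hf.hilbert_const_mul (-1)

theorem HilbertExists.hilbert_sub (hf : HilbertExists a b f s) (hg : HilbertExists a b g s) :
    hilbert a b (fun r => f r - g r) s = hilbert a b f s - hilbert a b g s := by
  refine Tendsto.limUnder_eq ((hf.tendsto.sub hg.tendsto).congr' ?_)
  filter_upwards [self_mem_nhdsWithin] with ε hε
  simp only [truncHilbert, sub_div]
  rw [integral_sub (hf.1 ε hε) (hg.1 ε hε), mul_sub]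

theorem cauchyTransform_congr (h : EqOn f g (Ioo a b)) :
    cauchyTransform a b f = cauchyTransform a b g := by
  funext z
  rw [cauchyTransform, cauchyTransform, setIntegral_congr_fun measurableSet_Ioo]
  intro r hr
  simp only [h hr]

theorem cauchyTransform_const_mul (c : ℝ) (z : ℂ) :
    cauchyTransform a b (fun r => c * f r) z = c * cauchyTransform a b f z := by
  simp only [cauchyTransform, Complex.ofReal_mul, mul_div_assoc]
  rw [integral_const_mul]
  ring

end Linear

/-! ### Endpoint behaviour of the exponential factor -/

section HilbertOne

variable {a b s ε : ℝ}

theorem integral_conjugatePoisson (hab : a ≤ b) (hε : 0 < ε) :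
    ∫ r in Ioo a b, (r - s) / ((r - s) ^ 2 + ε ^ 2) =
      log ((b - s) ^ 2 + ε ^ 2) / 2 - log ((a - s) ^ 2 + ε ^ 2) / 2 := by
  have hcont : Continuous fun r : ℝ => (r - s) / ((r - s) ^ 2 + ε ^ 2) :=
    (continuous_div_sq_add_sq continuous_id hε).comp (continuous_id.sub continuous_const)
  rw [← integral_Ioc_eq_integral_Ioo, ← intervalIntegral.integral_of_le hab]
  refine intervalIntegral.integral_eq_sub_of_hasDerivAt
    (f := fun r => log ((r - s) ^ 2 + ε ^ 2) / 2) (fun r _ => ?_) (hcont.intervalIntegrable _ _)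
  have hne : (r - s) ^ 2 + ε ^ 2 ≠ 0 := by positivity
  have hlog := ((((hasDerivAt_id r).sub_const s).pow 2).add_const (ε ^ 2)).log hne
  refine (hlog.div_const 2).congr_deriv ?_
  simp only [id, Nat.cast_ofNat, Pi.pow_apply, Nat.add_one_sub_one, pow_one]
  field_simp

theorem pi_mul_hilbert_one (hs : s ∈ Ioo a b) :
    π * hilbert a b (fun _ => 1) s = log (b - s) - log (s - a) := by
  have hone : WeightedHolder a b 0 0 (fun _ : ℝ => (1 : ℝ)) := weightedHolder_const 1
  obtain ⟨A, μ, h⟩ := hone.exists_holderAt hs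
  have hint := hone.integrableOn one_pos one_pos
  have hb : b - s ≠ 0 := (sub_pos.2 hs.2).ne'
  have ha : a - s ≠ 0 := (sub_neg.2 hs.1).ne
  rw [h.hilbert_eq hint, ← mul_assoc, mul_one_div_cancel pi_ne_zero, one_mul]
  refine tendsto_nhds_unique (h.tendsto_conjugatePoisson hint) ?_
  simp only [one_mul]
  have hcont : ContinuousAt (fun ε : ℝ => log ((b - s) ^ 2 + ε ^ 2) / 2 -
      log ((a - s) ^ 2 + ε ^ 2) / 2) 0 := by
    refine ContinuousAt.sub (ContinuousAt.div_const (ContinuousAt.log (by fun_prop) ?_) _)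
      (ContinuousAt.div_const (ContinuousAt.log (by fun_prop) ?_) _) <;> positivity
  have hvalue : log ((b - s) ^ 2 + 0 ^ 2) / 2 - log ((a - s) ^ 2 + 0 ^ 2) / 2 =
      log (b - s) - log (s - a) := by
    rw [← neg_sub s a, neg_sq, zero_pow two_ne_zero, add_zero, add_zero, log_pow, log_pow]
    push_cast
    ring
  have hlim := hcont.tendsto.mono_left (nhdsWithin_le_nhds (s := Ioi 0))
  rw [hvalue] at hlim
  refine hlim.congr' ?_
  filter_upwards [self_mem_nhdsWithin] with ε hε
  exact (integral_conjugatePoisson (hs.1.trans hs.2).le hε).symm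

end HilbertOne

section LogBound

variable {a b s γ δ K r : ℝ} {α : ℝ → ℝ}

theorem pi_mul_hilbert_eq (hα : WeightedHolder a b 0 0 α) (hs : s ∈ Ioo a b) :
    π * hilbert a b α s = (∫ r in Ioo a b, (α r - α s) / (r - s)) +
      α s * (log (b - s) - log (s - a)) := by
  have hdiff : WeightedHolder a b 0 0 (fun r => α r - α s) := hα.sub (weightedHolder_const _)
  have hone : WeightedHolder a b 0 0 (fun _ : ℝ => (1 : ℝ)) := weightedHolder_const 1
  have hsplit : hilbert a b α s = hilbert a b (fun r => α r - α s) s +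
      α s * hilbert a b (fun _ => 1) s := by
    rw [← (hone.hilbertExists one_pos one_pos hs).hilbert_const_mul,
      ← (hdiff.hilbertExists one_pos one_pos hs).hilbert_add
        ((hone.const_mul _).hilbertExists one_pos one_pos hs)]
    simp only [mul_one, sub_add_cancel]
  obtain ⟨A, μ, h⟩ := hdiff.exists_holderAt hs
  rw [hsplit, mul_add, h.hilbert_eq (hdiff.integrableOn one_pos one_pos), ← mul_assoc,
    mul_one_div_cancel pi_ne_zero, one_mul, mul_left_comm, pi_mul_hilbert_one hs]
  simp only [pvIntegrand, sub_self, zero_mul, sub_zero]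

theorem abs_log_le_rpow_add_inv_div {x : ℝ} (hr : 0 < r) (hx : 0 < x) :
    |log x| ≤ (x ^ r + (x ^ r)⁻¹) / r := by
  have hupper := log_le_rpow_div hx.le hr
  have hlower := log_le_rpow_div (inv_pos.2 hx).le hr
  rw [log_inv, inv_rpow hx.le] at hlower
  have : 0 ≤ x ^ r / r := by positivity
  have : 0 ≤ (x ^ r)⁻¹ / r := by positivity
  rw [add_div]
  exact abs_le.2 ⟨by linarith, by linarith⟩

theorem exists_rpow_mul_abs_log_le (L : ℝ) (hr : 0 < r) :
    ∃ C, ∀ x, 0 < x → x ≤ L → x ^ r * |log x| ≤ C := by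
  refine ⟨(|L ^ r| * |L ^ r| + 1) / r, fun x hx hxL => ?_⟩
  have := rpow_pos_of_pos hx r
  have hmono : x ^ r ≤ |L ^ r| := (rpow_le_rpow hx.le hxL hr.le).trans (le_abs_self _)
  calc x ^ r * |log x| ≤ x ^ r * ((x ^ r + (x ^ r)⁻¹) / r) := by
        gcongr
        exact abs_log_le_rpow_add_inv_div hr hx
    _ = (x ^ r * x ^ r + 1) / r := by field_simp
    _ ≤ (|L ^ r| * |L ^ r| + 1) / r := by gcongr

theorem abs_integral_sub_div_sub_le (hK : 0 ≤ K) (hr : 0 < r)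
    (hα : ∀ x ∈ Ioo a b, |α x - α s| ≤ K * |x - s| ^ r) (hs : s ∈ Ioo a b) :
    |∫ x in Ioo a b, (α x - α s) / (x - s)| ≤ K * (2 * ((b - a) ^ r / r)) := by
  have hL : 0 < b - a := sub_pos.2 (hs.1.trans hs.2)
  have hbound : Integrable fun x => K * nearBound (b - a) r (x - s) :=
    ((integrable_nearBound hL hr).comp_sub_right s).const_mul K
  have hle : ∀ x ∈ Ioo a b, |(α x - α s) / (x - s)| ≤ K * nearBound (b - a) r (x - s) := by
    intro x hx
    have hxs : |x - s| ≤ b - a := abs_le.2 ⟨by linarith [hx.1, hs.2], by linarith [hx.2, hs.1]⟩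
    rw [nearBound, indicator_of_mem (mem_Iic.2 hxs), abs_div]
    rcases eq_or_ne (x - s) 0 with h0 | h0
    · rw [h0, abs_zero, div_zero]
      exact mul_nonneg hK (rpow_nonneg le_rfl _)
    · have hpos := abs_pos.2 h0
      rw [rpow_sub_one hpos.ne', ← mul_div_assoc]
      exact div_le_div_of_nonneg_right (hα x hx) hpos.le
  calc |∫ x in Ioo a b, (α x - α s) / (x - s)|
      ≤ ∫ x in Ioo a b, K * nearBound (b - a) r (x - s) := by
        rw [← norm_eq_abs]
        exact norm_integral_le_of_norm_le hbound.integrableOn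
          ((ae_restrict_mem measurableSet_Ioo).mono hle)
    _ ≤ ∫ x, K * nearBound (b - a) r (x - s) :=
        setIntegral_le_integral hbound (Eventually.of_forall fun x =>
          mul_nonneg hK (nearBound_nonneg _))
    _ = K * (2 * ((b - a) ^ r / r)) := by
        rw [integral_const_mul, integral_sub_right_eq_self (nearBound (b - a) r),
          integral_nearBound hL hr]

theorem exists_abs_pi_mul_hilbert_sub_le (hα : IsHolderOn α (Icc a b)) : ∃ C, ∀ s ∈ Ioo a b,
    |π * hilbert a b α s - (α b * log (b - s) - α a * log (s - a))| ≤ C := by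
  have hα_weighted := weightedHolder_of_isHolderOn hα
  obtain ⟨K, r, hK, hr, -, hholder⟩ := isHolderOn_iff.1 hα
  obtain ⟨C, hlog⟩ := exists_rpow_mul_abs_log_le (b - a) hr
  refine ⟨K * (2 * ((b - a) ^ r / r)) + (K * C + K * C), fun s hs => ?_⟩
  have hab := hs.1.trans hs.2
  have hs' := Ioo_subset_Icc_self hs
  have hlog_mul : ∀ e ∈ Icc a b, 0 < |s - e| → |s - e| ≤ b - a →
      |(α s - α e) * log (|s - e|)| ≤ K * C := fun e he hpos hle => by
    rw [abs_mul]
    calc |α s - α e| * |log (|s - e|)| ≤ K * |s - e| ^ r * |log (|s - e|)| :=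
          mul_le_mul_of_nonneg_right (hholder s hs' e he) (abs_nonneg _)
      _ ≤ K * C := by
          rw [mul_assoc]
          exact mul_le_mul_of_nonneg_left (hlog _ hpos hle) hK
  have hleft := hlog_mul a (left_mem_Icc.2 hab.le)
  have hright := hlog_mul b (right_mem_Icc.2 hab.le)
  rw [abs_of_pos (sub_pos.2 hs.1)] at hleft
  rw [abs_sub_comm s b, abs_of_pos (sub_pos.2 hs.2)] at hright
  rw [pi_mul_hilbert_eq hα_weighted hs, show (∫ r in Ioo a b, (α r - α s) / (r - s)) +
      α s * (log (b - s) - log (s - a)) - (α b * log (b - s) - α a * log (s - a)) =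
    (∫ r in Ioo a b, (α r - α s) / (r - s)) +
      ((α s - α b) * log (b - s) - (α s - α a) * log (s - a)) by ring]
  refine (abs_add_le _ _).trans (add_le_add
    (abs_integral_sub_div_sub_le hK hr
      (fun x hx => hholder x (Ioo_subset_Icc_self hx) s hs') hs)
    ((abs_sub _ _).trans (add_le_add (hright (sub_pos.2 hs.2) ?_) (hleft (sub_pos.2 hs.1) ?_))))
  · linarith [hs.1]
  · linarith [hs.2]

theorem exists_exp_pi_mul_hilbert_le (hα : IsHolderOn α (Icc a b)) : ∃ M, 0 ≤ M ∧ ∀ s ∈ Ioo a b,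
    exp (π * hilbert a b α s) ≤ M * edgeWeight a b (α a) (-α b) s := by
  obtain ⟨C, hC⟩ := exists_abs_pi_mul_hilbert_sub_le hα
  refine ⟨exp C, (exp_pos _).le, fun s hs => ?_⟩
  have hupper := (abs_le.1 (hC s hs)).2
  rw [edgeWeight, rpow_def_of_pos (sub_pos.2 hs.1), rpow_def_of_pos (sub_pos.2 hs.2), ← exp_add,
    ← exp_add]
  exact exp_le_exp.2 (by linarith)

theorem weightedHolder_exp_pi_mul_hilbert (hα : IsHolderOn α (Icc a b)) (hγ : α a < γ)
    (hδ : -α b < δ) : WeightedHolder a b γ δ (fun s => exp (π * hilbert a b α s)) := by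
  obtain ⟨M, hM, hle⟩ := exists_exp_pi_mul_hilbert_le hα
  obtain ⟨η, hη, hη_lt⟩ := exists_between (lt_min one_pos (lt_min (sub_pos.2 hγ) (sub_pos.2 hδ)))
  simp only [lt_min_iff] at hη_lt
  obtain ⟨hη₁, hηγ, hηδ⟩ := hη_lt
  have hH := (weightedHolder_of_isHolderOn hα).hilbertTransform hη hη hη.le hη.le hη₁.le hη₁.le
  exact (WeightedHolder.exp_comp hM (hH.const_mul π) hη.le hη.le hle).mono (by linarith)
    (by linarith)

theorem hilbert_neg_of_isHolderOn (hα : IsHolderOn α (Icc a b)) (hs : s ∈ Ioo a b) :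
    hilbert a b (fun r => -α r) s = -hilbert a b α s :=
  ((weightedHolder_of_isHolderOn hα).hilbertExists one_pos one_pos hs).hilbert_neg

theorem weightedHolder_exp_neg_pi_mul_hilbert (hα : IsHolderOn α (Icc a b)) (hγ : -α a < γ)
    (hδ : α b < δ) : WeightedHolder a b γ δ (fun s => exp (-(π * hilbert a b α s))) := by
  have hneg := weightedHolder_exp_pi_mul_hilbert hα.neg hγ (by rwa [neg_neg])
  refine hneg.congr fun s hs => ?_
  simp only [hilbert_neg_of_isHolderOn hα hs, mul_neg]

end LogBound

/-! ### The exponential of the Cauchy transform -/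

/-- The boundary value `H[f] + i f` from the upper half plane of the Cauchy transform of `f`. -/
def boundaryValue (a b : ℝ) (f : ℝ → ℝ) (r : ℝ) : ℂ := (hilbert a b f r : ℂ) + f r * Complex.I

section BoundaryValue

variable {a b s γ δ K : ℝ} {f : ℝ → ℝ} {z : ℂ}

theorem boundaryValue_pow_succ_re (n : ℕ) (r : ℝ) : (boundaryValue a b f r ^ (n + 1)).re =
    (boundaryValue a b f r ^ n).re * hilbert a b f r - (boundaryValue a b f r ^ n).im * f r := by
  simp [pow_succ, boundaryValue]

theorem boundaryValue_pow_succ_im (n : ℕ) (r : ℝ) : (boundaryValue a b f r ^ (n + 1)).im =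
    (boundaryValue a b f r ^ n).re * f r + (boundaryValue a b f r ^ n).im * hilbert a b f r := by
  simp [pow_succ, boundaryValue]

theorem exp_boundaryValue_re (r : ℝ) :
    (Complex.exp (boundaryValue a b f r)).re = cos (f r) * exp (hilbert a b f r) := by
  simp [Complex.exp_re, boundaryValue, mul_comm]

theorem exp_boundaryValue_im (r : ℝ) :
    (Complex.exp (boundaryValue a b f r)).im = sin (f r) * exp (hilbert a b f r) := by
  simp [Complex.exp_im, boundaryValue, mul_comm]

theorem WeightedHolder.boundaryValue_pow (hf : WeightedHolder a b 0 0 f) (n : ℕ) {η : ℝ}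
    (hη : 0 < η) (hη₁ : η ≤ 1) :
    WeightedHolder a b η η (fun r => (boundaryValue a b f r ^ n).re) ∧
      WeightedHolder a b η η (fun r => (boundaryValue a b f r ^ n).im) := by
  induction n generalizing η with
  | zero =>
    simp only [pow_zero, Complex.one_re, Complex.one_im]
    exact ⟨(weightedHolder_const 1).mono hη.le hη.le, (weightedHolder_const 0).mono hη.le hη.le⟩
  | succ n ih =>
    have hη₂ := half_pos hη
    have hη₂_le : η / 2 ≤ 1 := by linarith
    obtain ⟨hre, him⟩ := ih hη₂ hη₂_le
    have hH := hf.hilbertTransform hη₂ hη₂ hη₂.le hη₂.le hη₂_le hη₂_le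
    have hf' := hf.mono hη₂.le hη₂.le
    simp only [boundaryValue_pow_succ_re, boundaryValue_pow_succ_im]
    rw [← add_halves η]
    exact ⟨(hre.mul hH).sub (him.mul hf'), (hre.mul hf').add (him.mul hH)⟩

theorem compatibleOrders_half_zero : CompatibleOrders (1 / 2) 0 :=
  ⟨by norm_num, by norm_num, by norm_num⟩

theorem WeightedHolder.hilbert_boundaryValue_pow_im (hf : WeightedHolder a b 0 0 f) (n : ℕ)
    (hs : s ∈ Ioo a b) :
    hilbert a b (fun r => (boundaryValue a b f r ^ (n + 1)).im) s =
      (boundaryValue a b f s ^ (n + 1)).re := by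
  induction n generalizing s with
  | zero => simp [boundaryValue]
  | succ n ih =>
    have hpow := (hf.boundaryValue_pow (n + 1) one_half_pos one_half_lt_one.le).2
    have hprod : EqOn (fun r => (boundaryValue a b f r ^ (n + 1 + 1)).im)
        (fun r => (boundaryValue a b f r ^ (n + 1)).im * hilbert a b f r +
          f r * hilbert a b (fun r => (boundaryValue a b f r ^ (n + 1)).im) r) (Ioo a b) :=
      fun r hr => by simp only [boundaryValue_pow_succ_im (n + 1), ih hr]; ring
    rw [hilbert_congr hprod, hpow.hilbert_mul_hilbert_add hf compatibleOrders_half_zero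
      compatibleOrders_half_zero hs, ih hs, boundaryValue_pow_succ_re (n + 1)]

theorem WeightedHolder.cauchyTransform_pow_succ (hf : WeightedHolder a b 0 0 f) (n : ℕ)
    (hz : z.im ≠ 0) : cauchyTransform a b f z ^ (n + 1) =
      cauchyTransform a b (fun r => (boundaryValue a b f r ^ (n + 1)).im) z := by
  induction n with
  | zero => simp [boundaryValue]
  | succ n ih =>
    have hpow := (hf.boundaryValue_pow (n + 1) one_half_pos one_half_lt_one.le).2
    rw [pow_succ, ih, hpow.cauchyTransform_mul hf compatibleOrders_half_zero
      compatibleOrders_half_zero hz]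
    refine congrFun (cauchyTransform_congr fun r hr => ?_) z
    simp only [boundaryValue_pow_succ_im (n + 1), hf.hilbert_boundaryValue_pow_im n hr]
    ring

theorem exp_norm_boundaryValue_le {r : ℝ} (hK : |f r| ≤ K) : exp ‖boundaryValue a b f r‖ ≤
    exp K * (exp (hilbert a b f r) + exp (-hilbert a b f r)) := by
  have hnorm : ‖boundaryValue a b f r‖ ≤ K + |hilbert a b f r| := by
    refine (norm_add_le _ _).trans ?_
    simpa [add_comm] using hK
  calc exp ‖boundaryValue a b f r‖ ≤ exp K * exp |hilbert a b f r| := by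
        rw [← exp_add]
        exact exp_le_exp.2 hnorm
    _ ≤ exp K * (exp (hilbert a b f r) + exp (-hilbert a b f r)) := by
        gcongr
        exact exp_abs_le _

theorem WeightedHolder.continuousOn_boundaryValue (hf : WeightedHolder a b 0 0 f) :
    ContinuousOn (boundaryValue a b f) (Ioo a b) := by
  have hH := hf.hilbertTransform one_pos one_pos zero_le_one zero_le_one le_rfl le_rfl
  exact (Complex.continuous_ofReal.comp_continuousOn hH.continuousOn).add
    ((Complex.continuous_ofReal.comp_continuousOn hf.continuousOn).mul continuousOn_const)

theorem WeightedHolder.integrableOn_exp_norm_boundaryValue (hf : WeightedHolder a b 0 0 f)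
    (hexp : IntegrableOn (fun r => exp (hilbert a b f r)) (Ioo a b))
    (hexp_neg : IntegrableOn (fun r => exp (-hilbert a b f r)) (Ioo a b)) :
    IntegrableOn (fun r => exp ‖boundaryValue a b f r‖) (Ioo a b) := by
  obtain ⟨K, -, hK⟩ := hf.exists_abs_le
  simp only [edgeWeight_zero, mul_one] at hK
  refine Integrable.mono' ((hexp.add hexp_neg).const_mul (exp K)) ?_ ?_
  · exact (continuous_exp.comp_continuousOn hf.continuousOn_boundaryValue.norm).aestronglyMeasurable
      measurableSet_Ioo
  · filter_upwards [ae_restrict_mem measurableSet_Ioo] with r hr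
    rw [norm_of_nonneg (exp_pos _).le]
    exact exp_norm_boundaryValue_le (hK r hr)

theorem hasSum_im_pow_div_factorial (w : ℂ) :
    HasSum (fun n : ℕ => (n.factorial : ℝ)⁻¹ * (w ^ n).im) (Complex.exp w).im := by
  have h := Complex.hasSum_im (NormedSpace.expSeries_div_hasSum_exp w)
  rw [← Complex.exp_eq_exp_ℂ] at h
  refine h.congr_fun fun n => ?_
  rw [div_eq_inv_mul, ← Complex.ofReal_natCast, ← Complex.ofReal_inv, Complex.im_ofReal_mul]

theorem WeightedHolder.hasSum_cauchyTransform (hf : WeightedHolder a b 0 0 f)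
    (hexp : IntegrableOn (fun r => exp ‖boundaryValue a b f r‖) (Ioo a b)) (hz : z.im ≠ 0) :
    HasSum (fun n : ℕ => cauchyTransform a b
        (fun r => (n.factorial : ℝ)⁻¹ * (boundaryValue a b f r ^ n).im) z)
      (cauchyTransform a b (fun r => (Complex.exp (boundaryValue a b f r)).im) z) := by
  have hexp_sum : ∀ r, HasSum
      (fun n : ℕ => ‖boundaryValue a b f r‖ ^ n / n.factorial * (1 / |z.im|))
      (exp ‖boundaryValue a b f r‖ * (1 / |z.im|)) := fun r => by
    have hseries := NormedSpace.expSeries_div_hasSum_exp ‖boundaryValue a b f r‖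
    rw [← Real.exp_eq_exp_ℝ] at hseries
    exact hseries.mul_right _
  have hsum : HasSum (fun n : ℕ => ∫ r in Ioo a b,
        (((n.factorial : ℝ)⁻¹ * (boundaryValue a b f r ^ n).im : ℝ) : ℂ) / ((r : ℂ) - z))
      (∫ r in Ioo a b, ((Complex.exp (boundaryValue a b f r)).im : ℂ) / ((r : ℂ) - z)) := by
    refine hasSum_integral_of_dominated_convergence
      (fun n r => ‖boundaryValue a b f r‖ ^ n / n.factorial * (1 / |z.im|)) (fun n => ?_)
      (fun n => Eventually.of_forall fun r => ?_)
      (Eventually.of_forall fun r => (hexp_sum r).summable) ?_ (Eventually.of_forall fun r => ?_)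
    · have hpow := (hf.boundaryValue_pow n one_half_pos one_half_lt_one.le).2
      exact (integrableOn_div_ofReal_sub
        ((hpow.integrableOn one_half_lt_one one_half_lt_one).const_mul _) hz).1
    · rw [div_eq_mul_inv, norm_mul, Complex.norm_real, norm_mul, div_eq_inv_mul, norm_inv,
        Real.norm_natCast]
      gcongr
      · exact (Complex.abs_im_le_norm _).trans (norm_pow _ _).le
      · exact norm_inv_ofReal_sub_le hz r
    · simp only [(hexp_sum _).tsum_eq]
      exact hexp.mul_const _
    · exact (Complex.hasSum_ofReal.2 (hasSum_im_pow_div_factorial _)).div_const _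
  exact hsum.mul_left _

theorem WeightedHolder.exp_cauchyTransform_sub_one (hf : WeightedHolder a b 0 0 f)
    (hexp : IntegrableOn (fun r => exp ‖boundaryValue a b f r‖) (Ioo a b)) (hz : z.im ≠ 0) :
    Complex.exp (cauchyTransform a b f z) - 1 =
      cauchyTransform a b (fun r => (Complex.exp (boundaryValue a b f r)).im) z := by
  have hseries := NormedSpace.expSeries_div_hasSum_exp (cauchyTransform a b f z)
  rw [← Complex.exp_eq_exp_ℂ] at hseries
  refine (hseries.sub (hasSum_ite_eq 0 (1 : ℂ))).unique
    ((hf.hasSum_cauchyTransform hexp hz).congr_fun fun n => ?_)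
  rw [cauchyTransform_const_mul]
  rcases n with _ | n
  · simp [cauchyTransform]
  · rw [← hf.cauchyTransform_pow_succ n hz, if_neg n.succ_ne_zero, sub_zero, div_eq_inv_mul]
    push_cast
    rfl

theorem WeightedHolder.hilbert_sin_mul_exp (hf : WeightedHolder a b 0 0 f)
    (hexp : WeightedHolder a b γ δ (fun r => exp (hilbert a b f r))) (hγ : γ < 1) (hδ : δ < 1)
    (hexp_neg : IntegrableOn (fun r => exp (-hilbert a b f r)) (Ioo a b)) (hs : s ∈ Ioo a b) :
    hilbert a b (fun r => sin (f r) * exp (hilbert a b f r)) s =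
      cos (f s) * exp (hilbert a b f s) - 1 := by
  have hsin : WeightedHolder a b γ δ (fun r => sin (f r) * exp (hilbert a b f r)) := by
    simpa only [zero_add] using hf.sin_comp.mul hexp
  have hnorm := hf.integrableOn_exp_norm_boundaryValue (hexp.integrableOn hγ hδ) hexp_neg
  have hboundary := ((Complex.continuous_exp.tendsto _).comp
    (hf.tendsto_cauchyTransform one_pos one_pos hs)).sub_const 1
  have heq := tendsto_nhds_unique (hsin.tendsto_cauchyTransform hγ hδ hs) (hboundary.congr' (by
    filter_upwards [self_mem_nhdsWithin] with ε hε
    have him : ((s : ℂ) + ε * Complex.I).im ≠ 0 := by simpa using ne_of_gt hε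
    simp only [Function.comp_apply, hf.exp_cauchyTransform_sub_one hnorm him,
      exp_boundaryValue_im]))
  have hre := exp_boundaryValue_re (a := a) (b := b) (f := f) s
  rw [boundaryValue] at hre
  simpa [hre] using congrArg Complex.re heq

end BoundaryValue

section ExponentialFactor

variable {a b s : ℝ} {α : ℝ → ℝ}

theorem hilbert_pi_mul_of_isHolderOn (hα : IsHolderOn α (Icc a b)) (hs : s ∈ Ioo a b) :
    hilbert a b (fun r => π * α r) s = π * hilbert a b α s :=
  ((weightedHolder_of_isHolderOn hα).hilbertExists one_pos one_pos hs).hilbert_const_mul π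

theorem exists_weightedHolder_exp_pi_mul_hilbert (hα : IsHolderOn α (Icc a b)) (ha : α a < 1)
    (hb : -α b < 1) :
    ∃ γ < 1, ∃ δ < 1, WeightedHolder a b γ δ (fun s => exp (π * hilbert a b α s)) := by
  obtain ⟨γ, hγ, hγ₁⟩ := exists_between ha
  obtain ⟨δ, hδ, hδ₁⟩ := exists_between hb
  exact ⟨γ, hγ₁, δ, hδ₁, weightedHolder_exp_pi_mul_hilbert hα hγ hδ⟩

theorem hilbert_sin_mul_exp (hα : IsHolderOn α (Icc a b)) (ha : |α a| < 1) (hb : |α b| < 1)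
    (hs : s ∈ Ioo a b) :
    hilbert a b (fun r => sin (π * α r) * exp (π * hilbert a b α r)) s =
      cos (π * α s) * exp (π * hilbert a b α s) - 1 := by
  rw [abs_lt] at ha hb
  obtain ⟨γ, hγ, δ, hδ, hexp⟩ :=
    exists_weightedHolder_exp_pi_mul_hilbert hα ha.2 (by linarith)
  obtain ⟨γ', hγ', δ', hδ', hexp_neg⟩ :=
    exists_weightedHolder_exp_pi_mul_hilbert hα.neg (by linarith) (by linarith)
  have hpi := ((weightedHolder_of_isHolderOn hα).const_mul π).hilbert_sin_mul_exp
    (hexp.congr fun r hr => by simp only [hilbert_pi_mul_of_isHolderOn hα hr]) hγ hδ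
    ((hexp_neg.congr fun r hr => by
      simp only [hilbert_pi_mul_of_isHolderOn hα hr, hilbert_neg_of_isHolderOn hα hr,
        mul_neg]).integrableOn hγ' hδ') hs
  rw [hilbert_pi_mul_of_isHolderOn hα hs] at hpi
  rw [← hpi]
  refine congrFun (hilbert_congr fun r hr => ?_) s
  simp only [hilbert_pi_mul_of_isHolderOn hα hr]

theorem hilbert_sin_mul_exp_neg (hα : IsHolderOn α (Icc a b)) (ha : |α a| < 1) (hb : |α b| < 1)
    (hs : s ∈ Ioo a b) :
    hilbert a b (fun r => sin (π * α r) * exp (-(π * hilbert a b α r))) s =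
      1 - cos (π * α s) * exp (-(π * hilbert a b α s)) := by
  have hneg := hilbert_sin_mul_exp hα.neg (by rwa [abs_neg]) (by rwa [abs_neg]) hs
  rw [abs_lt] at ha hb
  obtain ⟨γ, hγ, δ, hδ, hexp⟩ :=
    exists_weightedHolder_exp_pi_mul_hilbert hα.neg (by linarith) (by linarith)
  have hsin := ((weightedHolder_of_isHolderOn hα.neg).const_mul π).sin_comp.mul hexp
  rw [zero_add, zero_add] at hsin
  have hfun : EqOn (fun r => sin (π * α r) * exp (-(π * hilbert a b α r)))
      (fun r => -(sin (π * -α r) * exp (π * hilbert a b (fun r => -α r) r))) (Ioo a b) :=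
    fun r hr => by
      simp only [hilbert_neg_of_isHolderOn hα hr, mul_neg, sin_neg, neg_mul, neg_neg]
  rw [hilbert_congr hfun, (hsin.hilbertExists hγ hδ hs).hilbert_neg, hneg,
    hilbert_neg_of_isHolderOn hα hs, mul_neg, mul_neg, cos_neg, neg_sub]

end ExponentialFactor

/-! ### The inverse operator -/

section Orders

variable {x γ : ℝ}

theorem exists_compatibleOrders (hx : x < 1) (hγ : γ < 1 - max x 0) :
    ∃ κ, x < κ ∧ CompatibleOrders κ γ := by
  have hx_le := le_max_left x 0
  have h0_le := le_max_right x 0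
  obtain ⟨κ, hxκ, hκ⟩ := exists_between (lt_min hx (by linarith : x < 1 - γ))
  rw [lt_min_iff] at hκ
  exact ⟨κ, hxκ, hκ.1, by linarith, by linarith⟩

-- `κ`, `κ'`, `γ'` are orders for `e^{πH[α]}`, `e^{-πH[α]}` and `H[cos(πα) e^{πH[α]} φ]`.
theorem exists_orders_opLInv (hx : -1 < x) (hγ : γ < 1 - max x 0) :
    ∃ κ κ' γ', x < κ ∧ -x < κ' ∧ κ + γ < γ' ∧ 0 ≤ γ' ∧ γ' ≤ 1 ∧ κ' + γ' < 1 - max x 0 := by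
  have hx_le := le_max_left x 0
  have hmax : max x 0 < 1 + x := max_lt (by linarith) (by linarith)
  obtain ⟨γ', hlower, hupper⟩ := exists_between (max_lt
    (lt_min (by linarith) (by linarith) : x + γ < min 1 (1 - max x 0 + x))
    (lt_min one_pos (by linarith)))
  rw [max_lt_iff] at hlower
  rw [lt_min_iff] at hupper
  obtain ⟨κ, hxκ, hκ⟩ := exists_between (by linarith : x < γ' - γ)
  obtain ⟨κ', hxκ', hκ'⟩ := exists_between (by linarith : -x < 1 - max x 0 - γ')
  exact ⟨κ, κ', γ', hxκ, hxκ', by linarith, hlower.2.le, hupper.1.le, by linarith⟩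

theorem exists_compatibleOrders_neg (hx : -1 < x) (hγ : γ < 1 - max x 0) :
    ∃ κ κ', x < κ ∧ -x < κ' ∧ CompatibleOrders κ' (κ + γ) := by
  obtain ⟨κ, κ', γ', hκ, hκ', hγ', hγ'₀, hγ'₁, hadd⟩ := exists_orders_opLInv hx hγ
  have h0_le := le_max_right x 0
  exact ⟨κ, κ', hκ, hκ', by linarith, by linarith, by linarith⟩

end Orders

section Inverse

variable {a b γ δ κ κ' s : ℝ} {α φ ψ : ℝ → ℝ}

theorem mem_domL_iff (ha : α a < 1) (hb : -α b < 1) : ψ ∈ domL a b α ↔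
    ∃ γ δ, γ < 1 - max (α a) 0 ∧ δ < 1 - max (-α b) 0 ∧ WeightedHolder a b γ δ ψ :=
  mem_endpointClass_iff (sub_pos.2 (max_lt ha one_pos)) (sub_pos.2 (max_lt hb one_pos))

theorem weightedHolder_cos (hα : IsHolderOn α (Icc a b)) :
    WeightedHolder a b 0 0 (fun s => cos (π * α s)) :=
  ((weightedHolder_of_isHolderOn hα).const_mul π).cos_comp

theorem weightedHolder_sin (hα : IsHolderOn α (Icc a b)) :
    WeightedHolder a b 0 0 (fun s => sin (π * α s)) :=
  ((weightedHolder_of_isHolderOn hα).const_mul π).sin_comp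

theorem weightedHolder_tan (hab : a ≤ b) (hα : IsHolderOn α (Icc a b))
    (hcos : ∀ s ∈ Icc a b, cos (π * α s) ≠ 0) :
    WeightedHolder a b 0 0 (fun s => tan (π * α s)) := by
  have hcont : ContinuousOn (fun s => |cos (π * α s)|) (Icc a b) := by
    obtain ⟨C, r, hr, -, hholder⟩ := hα
    exact (continuous_cos.comp_continuousOn
      (continuousOn_const.mul (hholder.continuousOn hr))).abs
  obtain ⟨x, hx, hmin⟩ := isCompact_Icc.exists_isMinOn (nonempty_Icc.2 hab) hcont
  have htan := (weightedHolder_sin hα).mul ((weightedHolder_cos hα).inv (abs_pos.2 (hcos x hx))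
    fun s hs => hmin (Ioo_subset_Icc_self hs))
  rw [add_zero] at htan
  refine htan.congr fun s _ => ?_
  simp only [tan_eq_sin_div_cos, div_eq_mul_inv]

theorem weightedHolder_invDensity (hα : IsHolderOn α (Icc a b)) (hκ : α a < κ) (hκ' : -α b < κ')
    (hφ : WeightedHolder a b γ δ φ) :
    WeightedHolder a b (κ + γ) (κ' + δ) (invDensity a b α φ) := by
  have hprod := ((weightedHolder_cos hα).mul (weightedHolder_exp_pi_mul_hilbert hα hκ hκ')).mul hφ
  rwa [zero_add, zero_add] at hprod

theorem weightedHolder_sin_mul_exp (hα : IsHolderOn α (Icc a b)) (hγ : α a < γ)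
    (hδ : -α b < δ) :
    WeightedHolder a b γ δ (fun s => sin (π * α s) * exp (π * hilbert a b α s)) := by
  simpa only [zero_add] using
    (weightedHolder_sin hα).mul (weightedHolder_exp_pi_mul_hilbert hα hγ hδ)

theorem weightedHolder_sin_mul_exp_neg (hα : IsHolderOn α (Icc a b)) (hγ : -α a < γ)
    (hδ : α b < δ) :
    WeightedHolder a b γ δ (fun s => sin (π * α s) * exp (-(π * hilbert a b α s))) := by
  simpa only [zero_add] using
    (weightedHolder_sin hα).mul (weightedHolder_exp_neg_pi_mul_hilbert hα hγ hδ)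

theorem hilbertExists_of_mem_domL (ha : α a < 1) (hb : -α b < 1) (hψ : ψ ∈ domL a b α)
    (hs : s ∈ Ioo a b) : HilbertExists a b ψ s := by
  obtain ⟨γ, δ, hγ, hδ, hψ_weighted⟩ := (mem_domL_iff ha hb).1 hψ
  exact hψ_weighted.hilbertExists (by linarith [le_max_right (α a) 0])
    (by linarith [le_max_right (-α b) 0]) hs

theorem hilbertExists_invDensity (hα : IsHolderOn α (Icc a b)) (ha : α a < 1) (hb : -α b < 1)
    (hφ : φ ∈ domL a b α) (hs : s ∈ Ioo a b) : HilbertExists a b (invDensity a b α φ) s := by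
  obtain ⟨γ, δ, hγ, hδ, hφ_weighted⟩ := (mem_domL_iff ha hb).1 hφ
  obtain ⟨κ, hκ, hκγ⟩ := exists_compatibleOrders ha hγ
  obtain ⟨κ', hκ', hκδ⟩ := exists_compatibleOrders hb hδ
  exact (weightedHolder_invDensity hα hκ hκ' hφ_weighted).hilbertExists hκγ.add_lt_one
    hκδ.add_lt_one hs

theorem opL_mem_domL (hab : a ≤ b) (hα : IsHolderOn α (Icc a b))
    (hcos : ∀ s ∈ Icc a b, cos (π * α s) ≠ 0) (ha : α a < 1) (hb : -α b < 1)
    (hψ : ψ ∈ domL a b α) : opL a b α ψ ∈ domL a b α := by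
  obtain ⟨γ, δ, hγ, hδ, hψ_weighted⟩ := (mem_domL_iff ha hb).1 hψ
  obtain ⟨γ', hγγ', hγ'⟩ := exists_between (max_lt hγ (sub_pos.2 (max_lt ha one_pos)))
  obtain ⟨δ', hδδ', hδ'⟩ := exists_between (max_lt hδ (sub_pos.2 (max_lt hb one_pos)))
  rw [max_lt_iff] at hγγ' hδδ'
  have hH := hψ_weighted.hilbertTransform hγγ'.1 hδδ'.1 hγγ'.2.le hδδ'.2.le
    (by linarith [le_max_right (α a) 0]) (by linarith [le_max_right (-α b) 0])
  have htan := (weightedHolder_tan hab hα hcos).mul hH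
  rw [zero_add, zero_add] at htan
  exact (mem_domL_iff ha hb).2 ⟨γ', δ', hγ', hδ', (hψ_weighted.mono hγγ'.1.le hδδ'.1.le).add htan⟩

theorem opLInv_mem_domL (hα : IsHolderOn α (Icc a b)) (ha : |α a| < 1) (hb : |α b| < 1)
    (hφ : φ ∈ domL a b α) : opLInv a b α φ ∈ domL a b α := by
  rw [abs_lt] at ha hb
  have hb' : -α b < 1 := neg_lt.1 hb.1
  obtain ⟨γ, δ, hγ, hδ, hφ_weighted⟩ := (mem_domL_iff ha.2 hb').1 hφ
  obtain ⟨κ, κ', γ', hκ, hκ', hγ', hγ'₀, hγ'₁, hκγ⟩ := exists_orders_opLInv ha.1 hγ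
  obtain ⟨l, l', δ', hl, hl', hδ', hδ'₀, hδ'₁, hlδ⟩ :=
    exists_orders_opLInv (neg_lt_neg hb.2) hδ
  rw [neg_neg] at hl'
  have hH := (weightedHolder_invDensity hα hκ hl hφ_weighted).hilbertTransform hγ' hδ' hγ'₀ hδ'₀
    hγ'₁ hδ'₁
  have hsin := (weightedHolder_sin_mul_exp_neg hα hκ' hl').mul hH
  have hcos := ((weightedHolder_cos hα).mul (weightedHolder_cos hα)).mul hφ_weighted
  rw [add_zero, zero_add, zero_add] at hcos
  refine (mem_domL_iff ha.2 hb').2 ⟨_, _, max_lt hγ hκγ, max_lt hδ hlδ,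
    ((hcos.mono (le_max_left _ _) (le_max_left _ _)).sub
      (hsin.mono (le_max_right _ _) (le_max_right _ _))).congr fun s _ => ?_⟩
  simp only [opLInv, sq]

theorem hilbert_invDensity_opL (hα : IsHolderOn α (Icc a b))
    (hcos : ∀ s ∈ Icc a b, cos (π * α s) ≠ 0) (ha : |α a| < 1) (hb : |α b| < 1)
    (hψ : ψ ∈ domL a b α) (hs : s ∈ Ioo a b) :
    hilbert a b (invDensity a b α (opL a b α ψ)) s = exp (π * hilbert a b α s) *
      (cos (π * α s) * hilbert a b ψ s - sin (π * α s) * ψ s) := by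
  have ha' := (abs_lt.1 ha).2
  have hb' : -α b < 1 := neg_lt.1 (abs_lt.1 hb).1
  obtain ⟨γ, δ, hγ, hδ, hψ_weighted⟩ := (mem_domL_iff ha' hb').1 hψ
  obtain ⟨κ, hκ, hκγ⟩ := exists_compatibleOrders ha' hγ
  obtain ⟨κ', hκ', hκδ⟩ := exists_compatibleOrders hb' hδ
  have hsin := weightedHolder_sin_mul_exp hα hκ hκ'
  set S := fun r => sin (π * α r) * exp (π * hilbert a b α r) with hS
  have hHS : ∀ r ∈ Ioo a b, hilbert a b S r = cos (π * α r) * exp (π * hilbert a b α r) - 1 :=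
    fun r hr => hilbert_sin_mul_exp hα ha hb hr
  have hdensity : EqOn (invDensity a b α (opL a b α ψ))
      (fun r => ψ r + (S r * hilbert a b ψ r + ψ r * hilbert a b S r)) (Ioo a b) := fun r hr => by
    have := hcos r (Ioo_subset_Icc_self hr)
    simp only [hHS r hr]
    simp only [invDensity, opL, hS, tan_eq_sin_div_cos]
    field_simp
    ring
  obtain ⟨_, hleft, _, hright, hproduct⟩ := hsin.exists_mul_hilbert_add hψ_weighted hκγ hκδ
  rw [hilbert_congr hdensity, (hilbertExists_of_mem_domL ha' hb' hψ hs).hilbert_add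
    (hproduct.hilbertExists hleft hright hs), hsin.hilbert_mul_hilbert_add hψ_weighted hκγ hκδ hs,
    hHS s hs]
  ring

theorem opLInv_opL (hα : IsHolderOn α (Icc a b))
    (hcos : ∀ s ∈ Icc a b, cos (π * α s) ≠ 0) (ha : |α a| < 1) (hb : |α b| < 1)
    (hψ : ψ ∈ domL a b α) : EqOn (opLInv a b α (opL a b α ψ)) ψ (Ioo a b) := by
  intro s hs
  have := hcos s (Ioo_subset_Icc_self hs)
  simp only [opLInv, hilbert_invDensity_opL hα hcos ha hb hψ hs, opL, tan_eq_sin_div_cos, exp_neg]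
  field_simp
  linear_combination ψ s * sin_sq_add_cos_sq (π * α s)

theorem opLInv_eqOn_sub (hα : IsHolderOn α (Icc a b)) (ha : |α a| < 1) (hb : |α b| < 1) :
    EqOn (opLInv a b α φ) (fun s => invDensity a b α φ s -
      (sin (π * α s) * exp (-(π * hilbert a b α s)) * hilbert a b (invDensity a b α φ) s +
        invDensity a b α φ s *
          hilbert a b (fun r => sin (π * α r) * exp (-(π * hilbert a b α r))) s)) (Ioo a b) := by
  intro s hs
  have hdensity : cos (π * α s) * exp (-(π * hilbert a b α s)) * invDensity a b α φ s =
      cos (π * α s) ^ 2 * φ s := by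
    rw [invDensity, exp_neg]
    field_simp
  simp only [hilbert_sin_mul_exp_neg hα ha hb hs, opLInv]
  linear_combination -hdensity

theorem hilbert_opLInv (hα : IsHolderOn α (Icc a b)) (ha : |α a| < 1) (hb : |α b| < 1)
    (hφ : φ ∈ domL a b α) (hs : s ∈ Ioo a b) :
    hilbert a b (opLInv a b α φ) s =
      cos (π * α s) * exp (-(π * hilbert a b α s)) * hilbert a b (invDensity a b α φ) s +
        sin (π * α s) * cos (π * α s) * φ s := by
  have ha' := abs_lt.1 ha
  have hb' := abs_lt.1 hb
  have hb_neg : -α b < 1 := neg_lt.1 hb'.1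
  obtain ⟨γ, δ, hγ, hδ, hφ_weighted⟩ := (mem_domL_iff ha'.2 hb_neg).1 hφ
  obtain ⟨κ, κ', hκ, hκ', hκγ⟩ := exists_compatibleOrders_neg ha'.1 hγ
  obtain ⟨l, l', hl, hl', hlδ⟩ := exists_compatibleOrders_neg (neg_lt_neg hb'.2) hδ
  rw [neg_neg] at hl'
  have hf := weightedHolder_invDensity hα hκ hl hφ_weighted
  have hsin := weightedHolder_sin_mul_exp_neg hα hκ' hl'
  obtain ⟨_, hleft, _, hright, hproduct⟩ := hsin.exists_mul_hilbert_add hf hκγ hlδ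
  rw [hilbert_congr (opLInv_eqOn_sub hα ha hb),
    (hilbertExists_invDensity hα ha'.2 hb_neg hφ hs).hilbert_sub
      (hproduct.hilbertExists hleft hright hs),
    hsin.hilbert_mul_hilbert_add hf hκγ hlδ hs, hilbert_sin_mul_exp_neg hα ha hb hs, exp_neg]
  simp only [invDensity]
  field_simp
  ring

theorem opL_opLInv (hα : IsHolderOn α (Icc a b))
    (hcos : ∀ s ∈ Icc a b, cos (π * α s) ≠ 0) (ha : |α a| < 1) (hb : |α b| < 1)
    (hφ : φ ∈ domL a b α) : EqOn (opL a b α (opLInv a b α φ)) φ (Ioo a b) := by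
  intro s hs
  have := hcos s (Ioo_subset_Icc_self hs)
  rw [opL, hilbert_opLInv hα ha hb hφ hs, opLInv, tan_eq_sin_div_cos]
  field_simp
  linear_combination φ s * sin_sq_add_cos_sq (π * α s)

theorem opL_congr (h : EqOn φ ψ (Ioo a b)) : EqOn (opL a b α φ) (opL a b α ψ) (Ioo a b) :=
  fun s hs => by rw [opL, opL, h hs, hilbert_congr h]

theorem opLInv_congr (h : EqOn φ ψ (Ioo a b)) :
    EqOn (opLInv a b α φ) (opLInv a b α ψ) (Ioo a b) := fun s hs => by
  have hdensity : EqOn (invDensity a b α φ) (invDensity a b α ψ) (Ioo a b) := fun r hr => by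
    rw [invDensity, invDensity, h hr]
  rw [opLInv, opLInv, h hs, hilbert_congr hdensity]

end Inverse

section ConstantAlpha

variable {a b c s : ℝ} {α φ : ℝ → ℝ}

theorem exp_pi_mul_hilbert_of_const (hc : ∀ s ∈ Ioo a b, α s = c) (hs : s ∈ Ioo a b) :
    exp (π * hilbert a b α s) = ((b - s) / (s - a)) ^ c := by
  have hleft := sub_pos.2 hs.1
  have hright := sub_pos.2 hs.2
  have hone : WeightedHolder a b 0 0 (fun _ : ℝ => (1 : ℝ)) := weightedHolder_const 1
  have hconst : EqOn α (fun _ => c * 1) (Ioo a b) := fun r hr => by simp only [hc r hr, mul_one]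
  rw [hilbert_congr hconst, (hone.hilbertExists one_pos one_pos hs).hilbert_const_mul,
    mul_left_comm, pi_mul_hilbert_one hs, rpow_def_of_pos (div_pos hright hleft),
    log_div hright.ne' hleft.ne', mul_comm]

theorem hilbertExists_rpow_mul (hα : IsHolderOn α (Icc a b)) (ha : α a < 1) (hb : -α b < 1)
    (hc : ∀ s ∈ Ioo a b, α s = c) (hφ : φ ∈ domL a b α) (hs : s ∈ Ioo a b) :
    HilbertExists a b (fun r => ((b - r) / (r - a)) ^ c * φ r) s := by
  obtain ⟨γ, δ, hγ, hδ, hφ_weighted⟩ := (mem_domL_iff ha hb).1 hφ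
  obtain ⟨κ, hκ, hκγ⟩ := exists_compatibleOrders ha hγ
  obtain ⟨κ', hκ', hκδ⟩ := exists_compatibleOrders hb hδ
  have hproduct := (weightedHolder_exp_pi_mul_hilbert hα hκ hκ').mul hφ_weighted
  exact (hproduct.congr fun r hr => by
    simp only [exp_pi_mul_hilbert_of_const hc hr]).hilbertExists hκγ.add_lt_one
      hκδ.add_lt_one hs

theorem opLInv_of_const (hα : IsHolderOn α (Icc a b)) (ha : α a < 1) (hb : -α b < 1)
    (hc : ∀ s ∈ Ioo a b, α s = c) (hφ : φ ∈ domL a b α) (hs : s ∈ Ioo a b) :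
    opLInv a b α φ s = cos (π * c) ^ 2 * φ s - sin (π * c) * cos (π * c) *
      ((s - a) / (b - s)) ^ c * hilbert a b (fun r => ((b - r) / (r - a)) ^ c * φ r) s := by
  have hdensity : EqOn (invDensity a b α φ)
      (fun r => cos (π * c) * (((b - r) / (r - a)) ^ c * φ r)) (Ioo a b) := fun r hr => by
    simp only [invDensity, exp_pi_mul_hilbert_of_const hc hr, hc r hr, mul_assoc]
  rw [opLInv, hilbert_congr hdensity,
    (hilbertExists_rpow_mul hα ha hb hc hφ hs).hilbert_const_mul, exp_neg,
    exp_pi_mul_hilbert_of_const hc hs, hc s hs,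
    ← inv_rpow (div_pos (sub_pos.2 hs.2) (sub_pos.2 hs.1)).le, inv_div]
  ring

end ConstantAlpha

end

theorem mainTheorem2_general {a b : ℝ} (hab : a ≤ b) {α : ℝ → ℝ}
    (hα : IsHolderOn α (Icc a b)) (hcos : ∀ s ∈ Icc a b, cos (π * α s) ≠ 0)
    (hα₁ : |α a| < 1) (hα₂ : |α b| < 1) :
    (∀ s ∈ Ioo a b, HilbertExists a b α s) ∧
    (∀ ψ ∈ domL a b α, ∀ s ∈ Ioo a b,
      HilbertExists a b ψ s ∧ HilbertExists a b (invDensity a b α ψ) s) ∧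
    (∀ ψ ∈ domL a b α, opL a b α ψ ∈ domL a b α ∧ opLInv a b α ψ ∈ domL a b α) ∧
    (∀ ψ ∈ domL a b α,
      EqOn (opLInv a b α (opL a b α ψ)) ψ (Ioo a b) ∧
      EqOn (opL a b α (opLInv a b α ψ)) ψ (Ioo a b)) ∧
    (∀ φ ∈ domL a b α, ∀ ψ ∈ domL a b α,
      EqOn (opL a b α ψ) φ (Ioo a b) ↔ EqOn ψ (opLInv a b α φ) (Ioo a b)) ∧
    (∀ c : ℝ, (∀ s ∈ Icc a b, α s = c) →
      ∀ φ ∈ domL a b α, ∀ s ∈ Ioo a b,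
        HilbertExists a b (fun r => ((b - r) / (r - a)) ^ c * φ r) s ∧
        opLInv a b α φ s =
          cos (π * c) ^ 2 * φ s - sin (π * c) * cos (π * c) * ((s - a) / (b - s)) ^ c *
            hilbert a b (fun r => ((b - r) / (r - a)) ^ c * φ r) s) := by
  have ha : α a < 1 := (abs_lt.1 hα₁).2
  have hb : -α b < 1 := neg_lt.1 (abs_lt.1 hα₂).1
  refine ⟨fun s hs => (weightedHolder_of_isHolderOn hα).hilbertExists one_pos one_pos hs,
    fun ψ hψ s hs => ⟨hilbertExists_of_mem_domL ha hb hψ hs,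
      hilbertExists_invDensity hα ha hb hψ hs⟩,
    fun ψ hψ => ⟨opL_mem_domL hab hα hcos ha hb hψ, opLInv_mem_domL hα hα₁ hα₂ hψ⟩,
    fun ψ hψ => ⟨opLInv_opL hα hcos hα₁ hα₂ hψ, opL_opLInv hα hcos hα₁ hα₂ hψ⟩,
    fun φ hφ ψ hψ => ⟨fun h => (opLInv_opL hα hcos hα₁ hα₂ hψ).symm.trans (opLInv_congr h),
      fun h => (opL_congr h).trans (opL_opLInv hα hcos hα₁ hα₂ hφ)⟩,
    fun c hc φ hφ s hs => ?_⟩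
  have hc' : ∀ r ∈ Ioo a b, α r = c := fun r hr => hc r (Ioo_subset_Icc_self hr)
  exact ⟨hilbertExists_rpow_mul hα ha hb hc' hφ hs, opLInv_of_const hα ha hb hc' hφ hs⟩

theorem mainTheorem2 (k₁ k₂ : ℝ) (hk₁ : 0 ≤ k₁) (hk : k₁ < k₂) (α : ℝ → ℝ)
    (hα : IsHolderOn α (Icc (k₁ ^ 2) (k₂ ^ 2)))
    (hcos : ∀ s ∈ Icc (k₁ ^ 2) (k₂ ^ 2), cos (π * α s) ≠ 0)
    (hα₁ : |α (k₁ ^ 2)| < 1) (hα₂ : |α (k₂ ^ 2)| < 1) :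
    -- the principal values in `L_α` and in the formula for its inverse exist
    (∀ s ∈ Ioo (k₁ ^ 2) (k₂ ^ 2), HilbertExists (k₁ ^ 2) (k₂ ^ 2) α s) ∧
    (∀ ψ ∈ domL (k₁ ^ 2) (k₂ ^ 2) α, ∀ s ∈ Ioo (k₁ ^ 2) (k₂ ^ 2),
      HilbertExists (k₁ ^ 2) (k₂ ^ 2) ψ s ∧
      HilbertExists (k₁ ^ 2) (k₂ ^ 2) (invDensity (k₁ ^ 2) (k₂ ^ 2) α ψ) s) ∧
    -- both operators map the function space into itself
    (∀ ψ ∈ domL (k₁ ^ 2) (k₂ ^ 2) α,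
      opL (k₁ ^ 2) (k₂ ^ 2) α ψ ∈ domL (k₁ ^ 2) (k₂ ^ 2) α ∧
      opLInv (k₁ ^ 2) (k₂ ^ 2) α ψ ∈ domL (k₁ ^ 2) (k₂ ^ 2) α) ∧
    -- they are two-sided inverses of each other
    (∀ ψ ∈ domL (k₁ ^ 2) (k₂ ^ 2) α,
      EqOn (opLInv (k₁ ^ 2) (k₂ ^ 2) α (opL (k₁ ^ 2) (k₂ ^ 2) α ψ)) ψ
        (Ioo (k₁ ^ 2) (k₂ ^ 2)) ∧
      EqOn (opL (k₁ ^ 2) (k₂ ^ 2) α (opLInv (k₁ ^ 2) (k₂ ^ 2) α ψ)) ψ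
        (Ioo (k₁ ^ 2) (k₂ ^ 2))) ∧
    -- `L_α ψ = φ` has the formula as its one and only solution
    (∀ φ ∈ domL (k₁ ^ 2) (k₂ ^ 2) α, ∀ ψ ∈ domL (k₁ ^ 2) (k₂ ^ 2) α,
      EqOn (opL (k₁ ^ 2) (k₂ ^ 2) α ψ) φ (Ioo (k₁ ^ 2) (k₂ ^ 2)) ↔
        EqOn ψ (opLInv (k₁ ^ 2) (k₂ ^ 2) α φ) (Ioo (k₁ ^ 2) (k₂ ^ 2))) ∧
    -- the explicit form for constant `α`
    (∀ c : ℝ, (∀ s ∈ Icc (k₁ ^ 2) (k₂ ^ 2), α s = c) →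
      ∀ φ ∈ domL (k₁ ^ 2) (k₂ ^ 2) α, ∀ s ∈ Ioo (k₁ ^ 2) (k₂ ^ 2),
        HilbertExists (k₁ ^ 2) (k₂ ^ 2)
          (fun r => ((k₂ ^ 2 - r) / (r - k₁ ^ 2)) ^ c * φ r) s ∧
        opLInv (k₁ ^ 2) (k₂ ^ 2) α φ s =
          cos (π * c) ^ 2 * φ s -
            sin (π * c) * cos (π * c) * ((s - k₁ ^ 2) / (k₂ ^ 2 - s)) ^ c *
              hilbert (k₁ ^ 2) (k₂ ^ 2)
                (fun r => ((k₂ ^ 2 - r) / (r - k₁ ^ 2)) ^ c * φ r) s) :=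
  mainTheorem2_general (pow_le_pow_left₀ hk₁ hk.le 2) hα hcos hα₁ hα₂
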